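/- Let $\mathbb{D}$ be a (pseudo) double category, with category $\mathbb{D}_0$ of objects and arrows and category $\mathbb{D}_1$ of proarrows and cells; external composition $\odot$ is written in diagrammatic order. $\mathbb{D}$ is an *equipment* if every niche (arrows $f\colon x\to w$, $g\colon y\to z$ and a proarrow $n\colon w \nrightarrow z$) has a restriction, i.e. if the source-target pairing $\mathbb{D}_1\to\mathbb{D}_0\times\mathbb{D}_0$ is a fibration. $\mathbb{D}$ is *precartesian* (resp. *cartesian*) if for every finite set $I$ the diagonal double functor $\mathbb{D}\to\mathbb{D}^I$ has a lax (resp. pseudo) right adjoint. Here and below, adjunctions are taken in the 2-category of double categories, lax double functors and natural transformations. Let $\mathbb{F}\mathrm{inFam}^*(\mathbb{D})$ be the contravariant double category of finite families in $\mathbb{D}$. Its objects $(I,\vec x)$ are finite families $(x_i)_{i\in I}$ of objects; an arrow $(I,\vec x)\to(J,\vec y)$ is a function $f_0\colon J\to I$ with arrows $f_j\colon x_{f_0(j)}\to y_j$; a proarrow $(A,\vec m)\colon (I,\vec x)\nrightarrow(J,\vec y)$ is a span of finite sets $I\xleftarrow{\ell}A\xrightarrow{r}J$ with proarrows $m_a\colon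 x_{\ell(a)}\nrightarrow y_{r(a)}$; a cell $(A,\vec m)\to(B,\vec n)$, where $(B,\vec n)\colon(K,\vec w)\nrightarrow(L,\vec z)$, with left and right boundary arrows $(f_0,f)\colon(I,\vec x)\to(K,\vec w)$ and $(g_0,g)\colon(J,\vec y)\to(L,\vec z)$, is a function $\alpha_0\colon B\to A$ forming a map of spans with $f_0$ and $g_0$, together with cells $m_{\alpha_0(b)}\to n_b$ with boundary arrows $f_{\ell(b)}$ and $g_{r(b)}$. Proarrows are composed by pullback of spans and componentwise composition in $\mathbb{D}$. Let $\Delta\colon\mathbb{D}\to\mathbb{F}\mathrm{inFam}^*(\mathbb{D})$ be the embedding as families indexed by a singleton. $\mathbb{D}$ has *lax finite products* (resp. *strong finite products*) if $\Delta$ has a lax (resp. pseudo) right adjoint $\Pi$. It has *iso-strong finite products* if it has lax finite products such that the comparison cell $\Pi\vec m\odot\Pi\vec n\to\Pi(\vec m\odot\vec n)$ is an isomorphism whenever the adjacent legs $A\to J$ and $J\leftarrow B$ of the indexing spans of $(A,\vec m)\colon(I,\vec x)\nrightarrow(J,\vec y)$ and $(B,\vec n)\colon(J,\vec y)\nrightarrow(K,\vec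 z)$ are bijections, and the comparison cell $\mathrm{id}_{\Pi\vec x}\to\Pi(\mathrm{id}_{\vec x})$ is an isomorphism for every finite family of objects $(I,\vec x)$. **Corollary.** (1) Every precartesian equipment has lax finite products. (2) Every cartesian equipment has iso-strong finite products. (3) The converses fail: there is a double category that has strong finite products, and in particular iso-strong and lax finite products, but is not an equipment. -/

import Mathlib

open CategoryTheory

universe u v w c u' v' w' c' u'' v'' w'' c''

set_option linter.checkUnivs false in
/-- A (pseudo) double category, i.e. a pseudocategory in the 2-category of categories.

The category `D₀` is given by `Obj`. The category `D₁` has the proarrows `m : Pro x y` (for varying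
`x`, `y`) as its objects and the cells as its morphisms. `Cell m n` is the type of *all* cells from
`m : x ⇸ y` to `n : x' ⇸ y'`; the left and right boundary of a cell `α` are the arrows
`src α : x ⟶ x'` and `tgt α : y ⟶ y'`. Composition of cells along proarrows (in `D₁`) is `vcomp`,
with identities `vid`; it is strictly associative and unital. External composition of proarrows and
of cells, in diagrammatic order, is `hcomp` and `hcompCell`, with identities `hid` and `hidMap`; it
is associative and unital up to the coherent invertible globular cells `assoc`, `lunit`, `runit`. -/
structure DoubleCat where
  Obj : Type u
  [cat : Category.{v} Obj]
  Pro : Obj → Obj → Type w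
  Cell : ∀ {x y x' y' : Obj}, Pro x y → Pro x' y' → Type c
  src : ∀ {x y x' y' : Obj} {m : Pro x y} {n : Pro x' y'}, Cell m n → (x ⟶ x')
  tgt : ∀ {x y x' y' : Obj} {m : Pro x y} {n : Pro x' y'}, Cell m n → (y ⟶ y')
  -- the category `D₁`, with source and target functors to `D₀`
  vid : ∀ {x y : Obj} (m : Pro x y), Cell m m
  vcomp : ∀ {x y x' y' x'' y'' : Obj} {m : Pro x y} {n : Pro x' y'} {p : Pro x'' y''},
    Cell m n → Cell n p → Cell m p
  src_vid : ∀ {x y : Obj} (m : Pro x y), src (vid m) = 𝟙 x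
  tgt_vid : ∀ {x y : Obj} (m : Pro x y), tgt (vid m) = 𝟙 y
  src_vcomp : ∀ {x y x' y' x'' y'' : Obj} {m : Pro x y} {n : Pro x' y'} {p : Pro x'' y''}
    (α : Cell m n) (β : Cell n p), src (vcomp α β) = src α ≫ src β
  tgt_vcomp : ∀ {x y x' y' x'' y'' : Obj} {m : Pro x y} {n : Pro x' y'} {p : Pro x'' y''}
    (α : Cell m n) (β : Cell n p), tgt (vcomp α β) = tgt α ≫ tgt β
  vid_vcomp : ∀ {x y x' y' : Obj} {m : Pro x y} {n : Pro x' y'} (α : Cell m n),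
    vcomp (vid m) α = α
  vcomp_vid : ∀ {x y x' y' : Obj} {m : Pro x y} {n : Pro x' y'} (α : Cell m n),
    vcomp α (vid n) = α
  vcomp_assoc : ∀ {x y x' y' x'' y'' x''' y''' : Obj} {m : Pro x y} {n : Pro x' y'}
    {p : Pro x'' y''} {q : Pro x''' y'''} (α : Cell m n) (β : Cell n p) (γ : Cell p q),
    vcomp (vcomp α β) γ = vcomp α (vcomp β γ)
  -- the external identity functor
  hid : ∀ x : Obj, Pro x x
  hidMap : ∀ {x y : Obj}, (x ⟶ y) → Cell (hid x) (hid y)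
  src_hidMap : ∀ {x y : Obj} (f : x ⟶ y), src (hidMap f) = f
  tgt_hidMap : ∀ {x y : Obj} (f : x ⟶ y), tgt (hidMap f) = f
  hidMap_id : ∀ x : Obj, hidMap (𝟙 x) = vid (hid x)
  hidMap_comp : ∀ {x y z : Obj} (f : x ⟶ y) (g : y ⟶ z),
    hidMap (f ≫ g) = vcomp (hidMap f) (hidMap g)
  -- the external composition functor
  hcomp : ∀ {x y z : Obj}, Pro x y → Pro y z → Pro x z
  hcompCell : ∀ {x y z x' y' z' : Obj} {m : Pro x y} {n : Pro y z} {m' : Pro x' y'}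
    {n' : Pro y' z'} (α : Cell m m') (β : Cell n n'), tgt α = src β →
    Cell (hcomp m n) (hcomp m' n')
  src_hcompCell : ∀ {x y z x' y' z' : Obj} {m : Pro x y} {n : Pro y z} {m' : Pro x' y'}
    {n' : Pro y' z'} (α : Cell m m') (β : Cell n n') (h : tgt α = src β),
    src (hcompCell α β h) = src α
  tgt_hcompCell : ∀ {x y z x' y' z' : Obj} {m : Pro x y} {n : Pro y z} {m' : Pro x' y'}
    {n' : Pro y' z'} (α : Cell m m') (β : Cell n n') (h : tgt α = src β),
    tgt (hcompCell α β h) = tgt β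
  hcompCell_vid : ∀ {x y z : Obj} (m : Pro x y) (n : Pro y z),
    hcompCell (vid m) (vid n) ((tgt_vid m).trans (src_vid n).symm) = vid (hcomp m n)
  hcompCell_vcomp : ∀ {x y z x' y' z' x'' y'' z'' : Obj} {m : Pro x y} {n : Pro y z}
    {m' : Pro x' y'} {n' : Pro y' z'} {m'' : Pro x'' y''} {n'' : Pro y'' z''}
    (α : Cell m m') (β : Cell n n') (α' : Cell m' m'') (β' : Cell n' n'')
    (h : tgt α = src β) (h' : tgt α' = src β'),
    hcompCell (vcomp α α') (vcomp β β') (by rw [tgt_vcomp, src_vcomp, h, h']) =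
      vcomp (hcompCell α β h) (hcompCell α' β' h')
  -- associators
  assoc : ∀ {x y z t : Obj} (m : Pro x y) (n : Pro y z) (p : Pro z t),
    Cell (hcomp (hcomp m n) p) (hcomp m (hcomp n p))
  assocInv : ∀ {x y z t : Obj} (m : Pro x y) (n : Pro y z) (p : Pro z t),
    Cell (hcomp m (hcomp n p)) (hcomp (hcomp m n) p)
  src_assoc : ∀ {x y z t : Obj} (m : Pro x y) (n : Pro y z) (p : Pro z t),
    src (assoc m n p) = 𝟙 x
  tgt_assoc : ∀ {x y z t : Obj} (m : Pro x y) (n : Pro y z) (p : Pro z t),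
    tgt (assoc m n p) = 𝟙 t
  assoc_assocInv : ∀ {x y z t : Obj} (m : Pro x y) (n : Pro y z) (p : Pro z t),
    vcomp (assoc m n p) (assocInv m n p) = vid _
  assocInv_assoc : ∀ {x y z t : Obj} (m : Pro x y) (n : Pro y z) (p : Pro z t),
    vcomp (assocInv m n p) (assoc m n p) = vid _
  assoc_naturality : ∀ {x y z t x' y' z' t' : Obj} {m : Pro x y} {n : Pro y z} {p : Pro z t}
    {m' : Pro x' y'} {n' : Pro y' z'} {p' : Pro z' t'}
    (α : Cell m m') (β : Cell n n') (γ : Cell p p') (h : tgt α = src β) (h' : tgt β = src γ),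
    vcomp (hcompCell (hcompCell α β h) γ ((tgt_hcompCell α β h).trans h')) (assoc m' n' p') =
      vcomp (assoc m n p)
        (hcompCell α (hcompCell β γ h') (h.trans (src_hcompCell β γ h').symm))
  -- unitors
  lunit : ∀ {x y : Obj} (m : Pro x y), Cell (hcomp (hid x) m) m
  lunitInv : ∀ {x y : Obj} (m : Pro x y), Cell m (hcomp (hid x) m)
  src_lunit : ∀ {x y : Obj} (m : Pro x y), src (lunit m) = 𝟙 x
  tgt_lunit : ∀ {x y : Obj} (m : Pro x y), tgt (lunit m) = 𝟙 y
  lunit_lunitInv : ∀ {x y : Obj} (m : Pro x y), vcomp (lunit m) (lunitInv m) = vid _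
  lunitInv_lunit : ∀ {x y : Obj} (m : Pro x y), vcomp (lunitInv m) (lunit m) = vid _
  lunit_naturality : ∀ {x y x' y' : Obj} {m : Pro x y} {m' : Pro x' y'} (α : Cell m m'),
    vcomp (hcompCell (hidMap (src α)) α (tgt_hidMap (src α))) (lunit m') = vcomp (lunit m) α
  runit : ∀ {x y : Obj} (m : Pro x y), Cell (hcomp m (hid y)) m
  runitInv : ∀ {x y : Obj} (m : Pro x y), Cell m (hcomp m (hid y))
  src_runit : ∀ {x y : Obj} (m : Pro x y), src (runit m) = 𝟙 x
  tgt_runit : ∀ {x y : Obj} (m : Pro x y), tgt (runit m) = 𝟙 y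
  runit_runitInv : ∀ {x y : Obj} (m : Pro x y), vcomp (runit m) (runitInv m) = vid _
  runitInv_runit : ∀ {x y : Obj} (m : Pro x y), vcomp (runitInv m) (runit m) = vid _
  runit_naturality : ∀ {x y x' y' : Obj} {m : Pro x y} {m' : Pro x' y'} (α : Cell m m'),
    vcomp (hcompCell α (hidMap (tgt α)) (src_hidMap (tgt α)).symm) (runit m') = vcomp (runit m) α
  -- coherence
  pentagon : ∀ {x y z t s : Obj} (m : Pro x y) (n : Pro y z) (p : Pro z t) (q : Pro t s),
    vcomp (hcompCell (assoc m n p) (vid q) ((tgt_assoc m n p).trans (src_vid q).symm))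
      (vcomp (assoc m (hcomp n p) q)
        (hcompCell (vid m) (assoc n p q) ((tgt_vid m).trans (src_assoc n p q).symm))) =
      vcomp (assoc (hcomp m n) p q) (assoc m n (hcomp p q))
  triangle : ∀ {x y z : Obj} (m : Pro x y) (n : Pro y z),
    vcomp (assoc m (hid y) n)
      (hcompCell (vid m) (lunit n) ((tgt_vid m).trans (src_lunit n).symm)) =
      hcompCell (runit m) (vid n) ((tgt_runit m).trans (src_vid n).symm)

attribute [instance] DoubleCat.cat

namespace DoubleCat

/-- A cell is invertible if it is an isomorphism in the category `D₁`. -/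
def IsInvertible (D : DoubleCat.{u, v, w, c}) {x y x' y' : D.Obj} {m : D.Pro x y}
    {n : D.Pro x' y'} (α : D.Cell m n) : Prop :=
  ∃ β : D.Cell n m, D.vcomp α β = D.vid m ∧ D.vcomp β α = D.vid n

/-- A restriction (cartesian) cell: a morphism of `D₁` that is cartesian with respect to the
source-target pairing `D₁ ⥤ D₀ × D₀`. -/
def IsRestriction (D : DoubleCat.{u, v, w, c}) {x y x' y' : D.Obj} {m : D.Pro x y}
    {n : D.Pro x' y'} (ρ : D.Cell m n) : Prop :=
  ∀ {a b : D.Obj} (p : D.Pro a b) (q : a ⟶ x) (r : b ⟶ y) (α : D.Cell p n),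
    D.src α = q ≫ D.src ρ → D.tgt α = r ≫ D.tgt ρ →
    ∃! β : D.Cell p m, D.src β = q ∧ D.tgt β = r ∧ D.vcomp β ρ = α

/-- A double category is an equipment if every niche has a restriction, i.e. if the source-target
pairing `D₁ ⥤ D₀ × D₀` is a fibration. -/
def IsEquipment (D : DoubleCat.{u, v, w, c}) : Prop :=
  ∀ {x y x' y' : D.Obj} (f : x ⟶ x') (g : y ⟶ y') (n : D.Pro x' y'),
    ∃ (m : D.Pro x y) (ρ : D.Cell m n), D.src ρ = f ∧ D.tgt ρ = g ∧ D.IsRestriction ρ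

theorem src_assocInv (D : DoubleCat.{u, v, w, c}) {x y z t : D.Obj} (m : D.Pro x y)
    (n : D.Pro y z) (p : D.Pro z t) : D.src (D.assocInv m n p) = 𝟙 x := by
  have := congrArg D.src (D.assocInv_assoc m n p)
  rwa [D.src_vcomp, D.src_assoc, Category.comp_id, D.src_vid] at this

theorem tgt_assocInv (D : DoubleCat.{u, v, w, c}) {x y z t : D.Obj} (m : D.Pro x y)
    (n : D.Pro y z) (p : D.Pro z t) : D.tgt (D.assocInv m n p) = 𝟙 t := by
  have := congrArg D.tgt (D.assocInv_assoc m n p)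
  rwa [D.tgt_vcomp, D.tgt_assoc, Category.comp_id, D.tgt_vid] at this

theorem src_lunitInv (D : DoubleCat.{u, v, w, c}) {x y : D.Obj} (m : D.Pro x y) :
    D.src (D.lunitInv m) = 𝟙 x := by
  have := congrArg D.src (D.lunitInv_lunit m)
  rwa [D.src_vcomp, D.src_lunit, Category.comp_id, D.src_vid] at this

theorem tgt_lunitInv (D : DoubleCat.{u, v, w, c}) {x y : D.Obj} (m : D.Pro x y) :
    D.tgt (D.lunitInv m) = 𝟙 y := by
  have := congrArg D.tgt (D.lunitInv_lunit m)
  rwa [D.tgt_vcomp, D.tgt_lunit, Category.comp_id, D.tgt_vid] at this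

theorem src_runitInv (D : DoubleCat.{u, v, w, c}) {x y : D.Obj} (m : D.Pro x y) :
    D.src (D.runitInv m) = 𝟙 x := by
  have := congrArg D.src (D.runitInv_runit m)
  rwa [D.src_vcomp, D.src_runit, Category.comp_id, D.src_vid] at this

theorem tgt_runitInv (D : DoubleCat.{u, v, w, c}) {x y : D.Obj} (m : D.Pro x y) :
    D.tgt (D.runitInv m) = 𝟙 y := by
  have := congrArg D.tgt (D.runitInv_runit m)
  rwa [D.tgt_vcomp, D.tgt_runit, Category.comp_id, D.tgt_vid] at this

theorem hcompCell_congr (D : DoubleCat.{u, v, w, c}) {x y z x' y' z' : D.Obj} {m : D.Pro x y}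
    {n : D.Pro y z} {m' : D.Pro x' y'} {n' : D.Pro y' z'} {α α' : D.Cell m m'}
    {β β' : D.Cell n n'} (hα : α = α') (hβ : β = β') (h : D.tgt α = D.src β)
    (h' : D.tgt α' = D.src β') : D.hcompCell α β h = D.hcompCell α' β' h' := by
  subst hα hβ
  rfl

/-- Composing a horizontal composite with an identity cell on the right, in stages. -/
theorem hcompCell_vcomp_vid (D : DoubleCat.{u, v, w, c}) {x y z x' x'' : D.Obj}
    {m : D.Pro x y} {m' : D.Pro x' y} {m'' : D.Pro x'' y} (n : D.Pro y z)
    (α : D.Cell m m') (α' : D.Cell m' m'') (h : D.tgt α = 𝟙 y) (h' : D.tgt α' = 𝟙 y)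
    (h'' : D.tgt (D.vcomp α α') = D.src (D.vid n)) :
    D.hcompCell (D.vcomp α α') (D.vid n) h'' =
      D.vcomp (D.hcompCell α (D.vid n) (h.trans (D.src_vid n).symm))
        (D.hcompCell α' (D.vid n) (h'.trans (D.src_vid n).symm)) := by
  have := D.hcompCell_vcomp α (D.vid n) α' (D.vid n) (h.trans (D.src_vid n).symm)
    (h'.trans (D.src_vid n).symm)
  simp only [D.vid_vcomp] at this
  exact this

/-- Composing a horizontal composite with an identity cell on the left, in stages. -/
theorem hcompCell_vid_vcomp (D : DoubleCat.{u, v, w, c}) {x y z z' z'' : D.Obj}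
    (m : D.Pro x y) {n : D.Pro y z} {n' : D.Pro y z'} {n'' : D.Pro y z''}
    (β : D.Cell n n') (β' : D.Cell n' n'') (h : D.src β = 𝟙 y) (h' : D.src β' = 𝟙 y)
    (h'' : D.tgt (D.vid m) = D.src (D.vcomp β β')) :
    D.hcompCell (D.vid m) (D.vcomp β β') h'' =
      D.vcomp (D.hcompCell (D.vid m) β ((D.tgt_vid m).trans h.symm))
        (D.hcompCell (D.vid m) β' ((D.tgt_vid m).trans h'.symm)) := by
  have := D.hcompCell_vcomp (D.vid m) β (D.vid m) β' ((D.tgt_vid m).trans h.symm)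
    ((D.tgt_vid m).trans h'.symm)
  simp only [D.vid_vcomp] at this
  exact this

end DoubleCat

/-- A lax double functor: functors on objects and arrows and on proarrows and cells, compatible
with sources and targets, with natural and coherent globular comparison cells
`F m ⊙ F n → F (m ⊙ n)` and `id (F x) → F (id x)`. -/
structure LaxDoubleFunctor (D : DoubleCat.{u, v, w, c}) (E : DoubleCat.{u', v', w', c'}) where
  obj : D.Obj → E.Obj
  map : ∀ {x y : D.Obj}, (x ⟶ y) → (obj x ⟶ obj y)
  map_id : ∀ x : D.Obj, map (𝟙 x) = 𝟙 (obj x)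
  map_comp : ∀ {x y z : D.Obj} (f : x ⟶ y) (g : y ⟶ z), map (f ≫ g) = map f ≫ map g
  pro : ∀ {x y : D.Obj}, D.Pro x y → E.Pro (obj x) (obj y)
  cell : ∀ {x y x' y' : D.Obj} {m : D.Pro x y} {n : D.Pro x' y'},
    D.Cell m n → E.Cell (pro m) (pro n)
  src_cell : ∀ {x y x' y' : D.Obj} {m : D.Pro x y} {n : D.Pro x' y'} (α : D.Cell m n),
    E.src (cell α) = map (D.src α)
  tgt_cell : ∀ {x y x' y' : D.Obj} {m : D.Pro x y} {n : D.Pro x' y'} (α : D.Cell m n),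
    E.tgt (cell α) = map (D.tgt α)
  cell_vid : ∀ {x y : D.Obj} (m : D.Pro x y), cell (D.vid m) = E.vid (pro m)
  cell_vcomp : ∀ {x y x' y' x'' y'' : D.Obj} {m : D.Pro x y} {n : D.Pro x' y'}
    {p : D.Pro x'' y''} (α : D.Cell m n) (β : D.Cell n p),
    cell (D.vcomp α β) = E.vcomp (cell α) (cell β)
  -- comparison cells
  laxComp : ∀ {x y z : D.Obj} (m : D.Pro x y) (n : D.Pro y z),
    E.Cell (E.hcomp (pro m) (pro n)) (pro (D.hcomp m n))
  src_laxComp : ∀ {x y z : D.Obj} (m : D.Pro x y) (n : D.Pro y z),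
    E.src (laxComp m n) = 𝟙 (obj x)
  tgt_laxComp : ∀ {x y z : D.Obj} (m : D.Pro x y) (n : D.Pro y z),
    E.tgt (laxComp m n) = 𝟙 (obj z)
  laxUnit : ∀ x : D.Obj, E.Cell (E.hid (obj x)) (pro (D.hid x))
  src_laxUnit : ∀ x : D.Obj, E.src (laxUnit x) = 𝟙 (obj x)
  tgt_laxUnit : ∀ x : D.Obj, E.tgt (laxUnit x) = 𝟙 (obj x)
  laxComp_naturality : ∀ {x y z x' y' z' : D.Obj} {m : D.Pro x y} {n : D.Pro y z}
    {m' : D.Pro x' y'} {n' : D.Pro y' z'} (α : D.Cell m m') (β : D.Cell n n')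
    (h : D.tgt α = D.src β),
    E.vcomp (E.hcompCell (cell α) (cell β) (by rw [tgt_cell, src_cell, h])) (laxComp m' n') =
      E.vcomp (laxComp m n) (cell (D.hcompCell α β h))
  laxUnit_naturality : ∀ {x y : D.Obj} (f : x ⟶ y),
    E.vcomp (E.hidMap (map f)) (laxUnit y) = E.vcomp (laxUnit x) (cell (D.hidMap f))
  -- coherence
  laxComp_assoc : ∀ {x y z t : D.Obj} (m : D.Pro x y) (n : D.Pro y z) (p : D.Pro z t),
    E.vcomp
      (E.hcompCell (laxComp m n) (E.vid (pro p))
        ((tgt_laxComp m n).trans (E.src_vid (pro p)).symm))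
      (E.vcomp (laxComp (D.hcomp m n) p) (cell (D.assoc m n p))) =
    E.vcomp (E.assoc (pro m) (pro n) (pro p))
      (E.vcomp
        (E.hcompCell (E.vid (pro m)) (laxComp n p)
          ((E.tgt_vid (pro m)).trans (src_laxComp n p).symm))
        (laxComp m (D.hcomp n p)))
  laxComp_lunit : ∀ {x y : D.Obj} (m : D.Pro x y),
    E.vcomp
      (E.hcompCell (laxUnit x) (E.vid (pro m)) ((tgt_laxUnit x).trans (E.src_vid (pro m)).symm))
      (E.vcomp (laxComp (D.hid x) m) (cell (D.lunit m))) = E.lunit (pro m)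
  laxComp_runit : ∀ {x y : D.Obj} (m : D.Pro x y),
    E.vcomp
      (E.hcompCell (E.vid (pro m)) (laxUnit y) ((E.tgt_vid (pro m)).trans (src_laxUnit y).symm))
      (E.vcomp (laxComp m (D.hid y)) (cell (D.runit m))) = E.runit (pro m)

namespace LaxDoubleFunctor

variable {D : DoubleCat.{u, v, w, c}} {E : DoubleCat.{u', v', w', c'}}
  {F : DoubleCat.{u'', v'', w'', c''}}

/-- A lax double functor is pseudo if all its comparison cells are invertible. -/
def IsPseudo (G : LaxDoubleFunctor D E) : Prop :=
  (∀ {x y z : D.Obj} (m : D.Pro x y) (n : D.Pro y z), E.IsInvertible (G.laxComp m n)) ∧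
    ∀ x : D.Obj, E.IsInvertible (G.laxUnit x)

/-- The identity double functor. -/
def id (D : DoubleCat.{u, v, w, c}) : LaxDoubleFunctor D D where
  obj x := x
  map f := f
  map_id _ := rfl
  map_comp _ _ := rfl
  pro m := m
  cell α := α
  src_cell _ := rfl
  tgt_cell _ := rfl
  cell_vid _ := rfl
  cell_vcomp _ _ := rfl
  laxComp m n := D.vid (D.hcomp m n)
  src_laxComp _ _ := D.src_vid _
  tgt_laxComp _ _ := D.tgt_vid _
  laxUnit x := D.vid (D.hid x)
  src_laxUnit _ := D.src_vid _
  tgt_laxUnit _ := D.tgt_vid _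
  laxComp_naturality _ _ _ := by rw [D.vcomp_vid, D.vid_vcomp]
  laxUnit_naturality _ := by rw [D.vcomp_vid, D.vid_vcomp]
  laxComp_assoc _ _ _ := by
    rw [D.hcompCell_vid, D.hcompCell_vid, D.vid_vcomp, D.vid_vcomp, D.vid_vcomp, D.vcomp_vid]
  laxComp_lunit _ := by rw [D.hcompCell_vid, D.vid_vcomp, D.vid_vcomp]
  laxComp_runit _ := by rw [D.hcompCell_vid, D.vid_vcomp, D.vid_vcomp]

/-- Naturality of the comparison cells for a composite with an identity cell on the right. -/
theorem laxComp_naturality_vid (G : LaxDoubleFunctor D E) {x y z x' : D.Obj} {m : D.Pro x y}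
    {m' : D.Pro x' y} (α : D.Cell m m') (n : D.Pro y z) (h : D.tgt α = 𝟙 y)
    (h' : E.tgt (G.cell α) = E.src (E.vid (G.pro n))) :
    E.vcomp (E.hcompCell (G.cell α) (E.vid (G.pro n)) h') (G.laxComp m' n) =
      E.vcomp (G.laxComp m n)
        (G.cell (D.hcompCell α (D.vid n) (h.trans (D.src_vid n).symm))) := by
  have := G.laxComp_naturality α (D.vid n) (h.trans (D.src_vid n).symm)
  simp only [G.cell_vid] at this
  exact this

/-- Naturality of the comparison cells for a composite with an identity cell on the left. -/
theorem laxComp_vid_naturality (G : LaxDoubleFunctor D E) {x y z z' : D.Obj} (m : D.Pro x y)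
    {n : D.Pro y z} {n' : D.Pro y z'} (β : D.Cell n n') (h : D.src β = 𝟙 y)
    (h' : E.tgt (E.vid (G.pro m)) = E.src (G.cell β)) :
    E.vcomp (E.hcompCell (E.vid (G.pro m)) (G.cell β) h') (G.laxComp m n') =
      E.vcomp (G.laxComp m n)
        (G.cell (D.hcompCell (D.vid m) β ((D.tgt_vid m).trans h.symm))) := by
  have := G.laxComp_naturality (D.vid m) β ((D.tgt_vid m).trans h.symm)
  simp only [G.cell_vid] at this
  exact this

/-- Composition (in diagrammatic order) of lax double functors. -/
def comp (G : LaxDoubleFunctor D E) (H : LaxDoubleFunctor E F) : LaxDoubleFunctor D F where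
  obj x := H.obj (G.obj x)
  map f := H.map (G.map f)
  map_id x := by rw [G.map_id, H.map_id]
  map_comp f g := by rw [G.map_comp, H.map_comp]
  pro m := H.pro (G.pro m)
  cell α := H.cell (G.cell α)
  src_cell α := by rw [H.src_cell, G.src_cell]
  tgt_cell α := by rw [H.tgt_cell, G.tgt_cell]
  cell_vid m := by rw [G.cell_vid, H.cell_vid]
  cell_vcomp α β := by rw [G.cell_vcomp, H.cell_vcomp]
  laxComp m n := F.vcomp (H.laxComp (G.pro m) (G.pro n)) (H.cell (G.laxComp m n))
  src_laxComp m n := by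
    rw [F.src_vcomp, H.src_laxComp, H.src_cell, G.src_laxComp, H.map_id, Category.id_comp]
  tgt_laxComp m n := by
    rw [F.tgt_vcomp, H.tgt_laxComp, H.tgt_cell, G.tgt_laxComp, H.map_id, Category.id_comp]
  laxUnit x := F.vcomp (H.laxUnit (G.obj x)) (H.cell (G.laxUnit x))
  src_laxUnit x := by
    rw [F.src_vcomp, H.src_laxUnit, H.src_cell, G.src_laxUnit, H.map_id, Category.id_comp]
  tgt_laxUnit x := by
    rw [F.tgt_vcomp, H.tgt_laxUnit, H.tgt_cell, G.tgt_laxUnit, H.map_id, Category.id_comp]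
  laxComp_naturality α β h := by
    rw [← F.vcomp_assoc, H.laxComp_naturality (G.cell α) (G.cell β)
      (by rw [G.tgt_cell, G.src_cell, h]), F.vcomp_assoc, ← H.cell_vcomp,
      G.laxComp_naturality α β h, H.cell_vcomp, F.vcomp_assoc]
  laxUnit_naturality f := by
    rw [← F.vcomp_assoc, H.laxUnit_naturality, F.vcomp_assoc, ← H.cell_vcomp,
      G.laxUnit_naturality, H.cell_vcomp, F.vcomp_assoc]
  laxComp_assoc m n p := by
    have hs : ∀ {x y z : D.Obj} (a : D.Pro x y) (b : D.Pro y z),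
        F.src (H.cell (G.laxComp a b)) = 𝟙 _ := fun a b => by
      rw [H.src_cell, G.src_laxComp, H.map_id]
    have ht : ∀ {x y z : D.Obj} (a : D.Pro x y) (b : D.Pro y z),
        F.tgt (H.cell (G.laxComp a b)) = 𝟙 _ := fun a b => by
      rw [H.tgt_cell, G.tgt_laxComp, H.map_id]
    rw [F.hcompCell_vcomp_vid _ _ _ (H.tgt_laxComp _ _) (ht m n),
      F.hcompCell_vid_vcomp _ _ _ (H.src_laxComp _ _) (hs n p)]
    simp only [F.vcomp_assoc]
    rw [← F.vcomp_assoc _ (H.laxComp (G.pro (D.hcomp m n)) (G.pro p)),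
      H.laxComp_naturality_vid (G.laxComp m n) (G.pro p) (G.tgt_laxComp m n),
      ← F.vcomp_assoc _ (H.laxComp (G.pro m) (G.pro (D.hcomp n p))),
      H.laxComp_vid_naturality (G.pro m) (G.laxComp n p) (G.src_laxComp n p)]
    simp only [F.vcomp_assoc, ← H.cell_vcomp]
    rw [G.laxComp_assoc m n p, H.cell_vcomp (E.assoc _ _ _)]
    have := H.laxComp_assoc (G.pro m) (G.pro n) (G.pro p)
    rw [← F.vcomp_assoc (H.laxComp (E.hcomp (G.pro m) (G.pro n)) (G.pro p)),
      ← F.vcomp_assoc _ _ (H.cell (E.vcomp _ (G.laxComp m (D.hcomp n p)))), this]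
    simp only [F.vcomp_assoc]
  laxComp_lunit m := by
    have ht : ∀ x : D.Obj, F.tgt (H.cell (G.laxUnit x)) = 𝟙 _ := fun x => by
      rw [H.tgt_cell, G.tgt_laxUnit, H.map_id]
    rw [F.hcompCell_vcomp_vid _ _ _ (H.tgt_laxUnit _) (ht _)]
    simp only [F.vcomp_assoc]
    rw [← F.vcomp_assoc _ (H.laxComp (G.pro (D.hid _)) (G.pro m)),
      H.laxComp_naturality_vid (G.laxUnit _) (G.pro m) (G.tgt_laxUnit _)]
    simp only [F.vcomp_assoc, ← H.cell_vcomp]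
    rw [G.laxComp_lunit, H.laxComp_lunit]
  laxComp_runit m := by
    have hs : ∀ x : D.Obj, F.src (H.cell (G.laxUnit x)) = 𝟙 _ := fun x => by
      rw [H.src_cell, G.src_laxUnit, H.map_id]
    rw [F.hcompCell_vid_vcomp _ _ _ (H.src_laxUnit _) (hs _)]
    simp only [F.vcomp_assoc]
    rw [← F.vcomp_assoc _ (H.laxComp (G.pro m) (G.pro (D.hid _))),
      H.laxComp_vid_naturality (G.pro m) (G.laxUnit _) (G.src_laxUnit _)]
    simp only [F.vcomp_assoc, ← H.cell_vcomp]
    rw [G.laxComp_runit, H.laxComp_runit]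

end LaxDoubleFunctor

/-- A natural transformation between lax double functors: natural families of arrows and of
cells, compatible with the comparison cells. -/
structure DoubleTrans {D : DoubleCat.{u, v, w, c}} {E : DoubleCat.{u', v', w', c'}}
    (F G : LaxDoubleFunctor D E) where
  app : ∀ x : D.Obj, F.obj x ⟶ G.obj x
  appPro : ∀ {x y : D.Obj} (m : D.Pro x y), E.Cell (F.pro m) (G.pro m)
  src_appPro : ∀ {x y : D.Obj} (m : D.Pro x y), E.src (appPro m) = app x
  tgt_appPro : ∀ {x y : D.Obj} (m : D.Pro x y), E.tgt (appPro m) = app y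
  naturality : ∀ {x y : D.Obj} (f : x ⟶ y), F.map f ≫ app y = app x ≫ G.map f
  naturality_cell : ∀ {x y x' y' : D.Obj} {m : D.Pro x y} {n : D.Pro x' y'} (α : D.Cell m n),
    E.vcomp (F.cell α) (appPro n) = E.vcomp (appPro m) (G.cell α)
  laxComp_appPro : ∀ {x y z : D.Obj} (m : D.Pro x y) (n : D.Pro y z),
    E.vcomp (F.laxComp m n) (appPro (D.hcomp m n)) =
      E.vcomp (E.hcompCell (appPro m) (appPro n) ((tgt_appPro m).trans (src_appPro n).symm))
        (G.laxComp m n)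
  laxUnit_appPro : ∀ x : D.Obj,
    E.vcomp (F.laxUnit x) (appPro (D.hid x)) = E.vcomp (E.hidMap (app x)) (G.laxUnit x)

/-- An adjunction `F ⊣ G` in the 2-category of double categories, lax double functors and natural
transformations. -/
structure DoubleAdjunction {D : DoubleCat.{u, v, w, c}} {E : DoubleCat.{u', v', w', c'}}
    (F : LaxDoubleFunctor D E) (G : LaxDoubleFunctor E D) where
  unit : DoubleTrans (LaxDoubleFunctor.id D) (F.comp G)
  counit : DoubleTrans (G.comp F) (LaxDoubleFunctor.id E)
  left_triangle : ∀ x : D.Obj, F.map (unit.app x) ≫ counit.app (F.obj x) = 𝟙 (F.obj x)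
  left_triangle_pro : ∀ {x y : D.Obj} (m : D.Pro x y),
    E.vcomp (F.cell (unit.appPro m)) (counit.appPro (F.pro m)) = E.vid (F.pro m)
  right_triangle : ∀ x : E.Obj, unit.app (G.obj x) ≫ G.map (counit.app x) = 𝟙 (G.obj x)
  right_triangle_pro : ∀ {x y : E.Obj} (m : E.Pro x y),
    D.vcomp (unit.appPro (G.pro m)) (G.cell (counit.appPro m)) = D.vid (G.pro m)

/-! ### Parallel products -/

namespace DoubleCat

/-- The power double category `D ^ I`, with componentwise structure. -/
def power (D : DoubleCat.{u, v, w, c}) (I : Type) : DoubleCat.{u, v, w, c} where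
  Obj := I → D.Obj
  Pro x y := ∀ i, D.Pro (x i) (y i)
  Cell m n := ∀ i, D.Cell (m i) (n i)
  src α i := D.src (α i)
  tgt α i := D.tgt (α i)
  vid m i := D.vid (m i)
  vcomp α β i := D.vcomp (α i) (β i)
  src_vid m := funext fun i => D.src_vid (m i)
  tgt_vid m := funext fun i => D.tgt_vid (m i)
  src_vcomp α β := funext fun i => D.src_vcomp (α i) (β i)
  tgt_vcomp α β := funext fun i => D.tgt_vcomp (α i) (β i)
  vid_vcomp α := funext fun i => D.vid_vcomp (α i)
  vcomp_vid α := funext fun i => D.vcomp_vid (α i)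
  vcomp_assoc α β γ := funext fun i => D.vcomp_assoc (α i) (β i) (γ i)
  hid x i := D.hid (x i)
  hidMap f i := D.hidMap (f i)
  src_hidMap f := funext fun i => D.src_hidMap (f i)
  tgt_hidMap f := funext fun i => D.tgt_hidMap (f i)
  hidMap_id x := funext fun i => D.hidMap_id (x i)
  hidMap_comp f g := funext fun i => D.hidMap_comp (f i) (g i)
  hcomp m n i := D.hcomp (m i) (n i)
  hcompCell α β h i := D.hcompCell (α i) (β i) (congrFun h i)
  src_hcompCell α β h := funext fun i => D.src_hcompCell (α i) (β i) (congrFun h i)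
  tgt_hcompCell α β h := funext fun i => D.tgt_hcompCell (α i) (β i) (congrFun h i)
  hcompCell_vid m n := funext fun i => D.hcompCell_vid (m i) (n i)
  hcompCell_vcomp α β α' β' h h' := funext fun i =>
    D.hcompCell_vcomp (α i) (β i) (α' i) (β' i) (congrFun h i) (congrFun h' i)
  assoc m n p i := D.assoc (m i) (n i) (p i)
  assocInv m n p i := D.assocInv (m i) (n i) (p i)
  src_assoc m n p := funext fun i => D.src_assoc (m i) (n i) (p i)
  tgt_assoc m n p := funext fun i => D.tgt_assoc (m i) (n i) (p i)
  assoc_assocInv m n p := funext fun i => D.assoc_assocInv (m i) (n i) (p i)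
  assocInv_assoc m n p := funext fun i => D.assocInv_assoc (m i) (n i) (p i)
  assoc_naturality α β γ h h' := funext fun i =>
    D.assoc_naturality (α i) (β i) (γ i) (congrFun h i) (congrFun h' i)
  lunit m i := D.lunit (m i)
  lunitInv m i := D.lunitInv (m i)
  src_lunit m := funext fun i => D.src_lunit (m i)
  tgt_lunit m := funext fun i => D.tgt_lunit (m i)
  lunit_lunitInv m := funext fun i => D.lunit_lunitInv (m i)
  lunitInv_lunit m := funext fun i => D.lunitInv_lunit (m i)
  lunit_naturality α := funext fun i => D.lunit_naturality (α i)
  runit m i := D.runit (m i)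
  runitInv m i := D.runitInv (m i)
  src_runit m := funext fun i => D.src_runit (m i)
  tgt_runit m := funext fun i => D.tgt_runit (m i)
  runit_runitInv m := funext fun i => D.runit_runitInv (m i)
  runitInv_runit m := funext fun i => D.runitInv_runit (m i)
  runit_naturality α := funext fun i => D.runit_naturality (α i)
  pentagon m n p q := funext fun i => D.pentagon (m i) (n i) (p i) (q i)
  triangle m n := funext fun i => D.triangle (m i) (n i)

/-- The diagonal double functor `D → D ^ I`, which is strict. -/
def diag (D : DoubleCat.{u, v, w, c}) (I : Type) : LaxDoubleFunctor D (D.power I) where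
  obj x _ := x
  map f _ := f
  map_id _ := rfl
  map_comp _ _ := rfl
  pro m _ := m
  cell α _ := α
  src_cell _ := rfl
  tgt_cell _ := rfl
  cell_vid _ := rfl
  cell_vcomp _ _ := rfl
  laxComp _ _ := (D.power I).vid _
  src_laxComp _ _ := (D.power I).src_vid _
  tgt_laxComp _ _ := (D.power I).tgt_vid _
  laxUnit _ := (D.power I).vid _
  src_laxUnit _ := (D.power I).src_vid _
  tgt_laxUnit _ := (D.power I).tgt_vid _
  laxComp_naturality α β h := funext fun _ =>
    (LaxDoubleFunctor.id D).laxComp_naturality α β h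
  laxUnit_naturality f := funext fun _ => (LaxDoubleFunctor.id D).laxUnit_naturality f
  laxComp_assoc m n p := funext fun _ => (LaxDoubleFunctor.id D).laxComp_assoc m n p
  laxComp_lunit m := funext fun _ => (LaxDoubleFunctor.id D).laxComp_lunit m
  laxComp_runit m := funext fun _ => (LaxDoubleFunctor.id D).laxComp_runit m

/-- A double category is precartesian if it has lax finite parallel products: for every finite set
`I`, the diagonal `D → D ^ I` has a lax right adjoint. -/
def IsPrecartesian (D : DoubleCat.{u, v, w, c}) : Prop :=
  ∀ (I : Type) [Finite I],
    ∃ P : LaxDoubleFunctor (D.power I) D, Nonempty (DoubleAdjunction (D.diag I) P)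

/-- A double category is cartesian if it has strong finite parallel products: for every finite set
`I`, the diagonal `D → D ^ I` has a pseudo right adjoint. -/
def IsCartesian (D : DoubleCat.{u, v, w, c}) : Prop :=
  ∀ (I : Type) [Finite I],
    ∃ P : LaxDoubleFunctor (D.power I) D,
      P.IsPseudo ∧ Nonempty (DoubleAdjunction (D.diag I) P)

end DoubleCat

/-! ### Finite families -/

/-- An object of the double category of finite families: a finite indexing set `I` (up to bijection,
a finite type in `Type`) and an `I`-indexed family of objects. -/
structure FinFam (D : DoubleCat.{u, v, w, c}) where
  I : Type
  fin : Finite I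
  obj : I → D.Obj

namespace FinFam

variable {D : DoubleCat.{u, v, w, c}}

/-- An arrow of contravariant families `(I, x) ⟶ (J, y)`: a function `f₀ : J → I` and arrows
`f j : x (f₀ j) ⟶ y j`. The arrow `f j` is recorded as an arrow `x i ⟶ y j` for the unique `i` with
`f₀ j = i`, so that no transport along equations between indices is ever needed. -/
structure Hom (X Y : FinFam D) where
  base : Y.I → X.I
  hom : ∀ {i : X.I} {j : Y.I}, base j = i → (X.obj i ⟶ Y.obj j)

/-- A proarrow of families `(I, x) ⇸ (J, y)`: a span `I ← A → J` with finite apex `A` and a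
proarrow `x i ⇸ y j` for every `a : i ⇸ j`, i.e. for every `a` in `A` with `l a = i` and
`r a = j`. -/
structure Pro (X Y : FinFam D) where
  A : Type
  fin : Finite A
  l : A → X.I
  r : A → Y.I
  pro : ∀ {i : X.I} {j : Y.I} (a : A), l a = i → r a = j → D.Pro (X.obj i) (Y.obj j)

/-- A cell of contravariant families from `(A, m) : (I, x) ⇸ (J, y)` to `(B, n) : (K, w) ⇸ (L, z)`,
with left boundary `(f₀, f)` and right boundary `(g₀, g)`: a function `α₀ : B → A` that forms a map
of spans together with `f₀ : K → I` and `g₀ : L → J`, and for every `b : k ⇸ l` in `B` a cell from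
`m (α₀ b)` to `n b` with left boundary `f k` and right boundary `g l`. -/
structure Cell {X Y X' Y' : FinFam D} (M : Pro X Y) (N : Pro X' Y') where
  src : Hom X X'
  tgt : Hom Y Y'
  base : N.A → M.A
  l_base : ∀ b, src.base (N.l b) = M.l (base b)
  r_base : ∀ b, tgt.base (N.r b) = M.r (base b)
  cell : ∀ {i : X.I} {j : Y.I} {k : X'.I} {l : Y'.I} (b : N.A) (hi : M.l (base b) = i)
    (hj : M.r (base b) = j) (hk : N.l b = k) (hl : N.r b = l),
    D.Cell (M.pro (base b) hi hj) (N.pro b hk hl)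
  src_cell : ∀ {i : X.I} {j : Y.I} {k : X'.I} {l : Y'.I} (b : N.A) (hi : M.l (base b) = i)
    (hj : M.r (base b) = j) (hk : N.l b = k) (hl : N.r b = l),
    D.src (cell b hi hj hk hl) =
      src.hom ((congrArg src.base hk.symm).trans ((l_base b).trans hi))
  tgt_cell : ∀ {i : X.I} {j : Y.I} {k : X'.I} {l : Y'.I} (b : N.A) (hi : M.l (base b) = i)
    (hj : M.r (base b) = j) (hk : N.l b = k) (hl : N.r b = l),
    D.tgt (cell b hi hj hk hl) =
      tgt.hom ((congrArg tgt.base hl.symm).trans ((r_base b).trans hj))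

theorem Hom.ext' {X Y : FinFam D} {f g : Hom X Y} (hb : f.base = g.base)
    (hh : ∀ (i : X.I) (j : Y.I) (h : f.base j = i) (h' : g.base j = i), f.hom h = g.hom h') :
    f = g := by
  cases f with
  | mk fb fh =>
    cases g with
    | mk gb gh =>
      cases hb
      have : @fh = @gh := by
        funext i j h
        exact hh i j h h
      cases this
      rfl

theorem Hom.hom_congr {X Y : FinFam D} {f g : Hom X Y} (e : f = g) {i : X.I} {j : Y.I}
    (h : f.base j = i) (h' : g.base j = i) : f.hom h = g.hom h' := by
  subst e
  rfl

theorem Cell.ext' {X Y X' Y' : FinFam D} {M : Pro X Y} {N : Pro X' Y'} {α β : Cell M N}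
    (hs : α.src = β.src) (ht : α.tgt = β.tgt) (hb : ∀ b, α.base b = β.base b)
    (hc : ∀ (i : X.I) (j : Y.I) (k : X'.I) (l : Y'.I) (b : N.A) (hi : M.l (α.base b) = i)
      (hj : M.r (α.base b) = j) (hi' : M.l (β.base b) = i) (hj' : M.r (β.base b) = j)
      (hk : N.l b = k) (hl : N.r b = l),
      HEq (α.cell b hi hj hk hl) (β.cell b hi' hj' hk hl)) : α = β := by
  cases α with
  | mk αs αt αb αl αr αc αsc αtc =>
    cases β with
    | mk βs βt βb βl βr βc βsc βtc =>
      cases hs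
      cases ht
      have : αb = βb := funext hb
      cases this
      have : @αc = @βc := by
        funext i j k l b hi hj hk hl
        exact eq_of_heq (hc i j k l b hi hj hi hj hk hl)
      cases this
      rfl

/-- The identity arrow `x i ⟶ x j` of a family at equal indices `i = j`. -/
def idHom (X : FinFam D) {i j : X.I} (h : j = i) : X.obj i ⟶ X.obj j :=
  eqToHom (congrArg X.obj h.symm)

/-- The identity arrow on a family. -/
def Hom.id (X : FinFam D) : Hom X X where
  base i := i
  hom h := X.idHom h

/-- Composition of arrows of families. -/
def Hom.comp {X Y Z : FinFam D} (f : Hom X Y) (g : Hom Y Z) : Hom X Z where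
  base k := f.base (g.base k)
  hom h := f.hom h ≫ g.hom rfl

theorem Hom.id_comp {X Y : FinFam D} (f : Hom X Y) : (Hom.id X).comp f = f :=
  Hom.ext' rfl fun _ _ h _ => by
    subst h
    exact Category.id_comp _

theorem Hom.comp_id {X Y : FinFam D} (f : Hom X Y) : f.comp (Hom.id Y) = f :=
  Hom.ext' rfl fun _ _ _ _ => Category.comp_id _

theorem Hom.assoc {X Y Z W : FinFam D} (f : Hom X Y) (g : Hom Y Z) (k : Hom Z W) :
    (f.comp g).comp k = f.comp (g.comp k) :=
  Hom.ext' rfl fun _ _ _ _ => Category.assoc _ _ _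

instance : Category (FinFam D) where
  Hom X Y := Hom X Y
  id X := Hom.id X
  comp f g := Hom.comp f g
  id_comp f := Hom.id_comp f
  comp_id f := Hom.comp_id f
  assoc f g k := Hom.assoc f g k

/-- The identity cell on a proarrow of families. -/
def vid {X Y : FinFam D} (M : Pro X Y) : Cell M M where
  src := Hom.id X
  tgt := Hom.id Y
  base a := a
  l_base _ := rfl
  r_base _ := rfl
  cell a hi hj hk hl := by
    subst hi hj hk hl
    exact D.vid _
  src_cell a hi hj hk hl := by
    subst hi hj hk hl
    exact D.src_vid _
  tgt_cell a hi hj hk hl := by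
    subst hi hj hk hl
    exact D.tgt_vid _

/-- Composition of cells of families along proarrows. -/
def vcomp {X Y X' Y' X'' Y'' : FinFam D} {M : Pro X Y} {N : Pro X' Y'} {P : Pro X'' Y''}
    (α : Cell M N) (β : Cell N P) : Cell M P where
  src := α.src.comp β.src
  tgt := α.tgt.comp β.tgt
  base b := α.base (β.base b)
  l_base b := (congrArg α.src.base (β.l_base b)).trans (α.l_base _)
  r_base b := (congrArg α.tgt.base (β.r_base b)).trans (α.r_base _)
  cell {i j k l} b hi hj hk hl :=
    D.vcomp
      (α.cell (k := β.src.base k) (l := β.tgt.base l) (β.base b) hi hj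
        ((β.l_base b).symm.trans (congrArg β.src.base hk))
        ((β.r_base b).symm.trans (congrArg β.tgt.base hl)))
      (β.cell b _ _ hk hl)
  src_cell b hi hj hk hl := by
    rw [D.src_vcomp, α.src_cell, β.src_cell]
    rfl
  tgt_cell b hi hj hk hl := by
    rw [D.tgt_vcomp, α.tgt_cell, β.tgt_cell]
    rfl

/-- The external identity on a family: the identity span with the family of identity proarrows. -/
def hid (X : FinFam D) : Pro X X where
  A := X.I
  fin := X.fin
  l i := i
  r i := i
  pro a hi hj := by
    subst hi hj
    exact D.hid _

/-- The external identity on an arrow of families. -/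
def hidMap {X Y : FinFam D} (f : Hom X Y) : Cell (hid X) (hid Y) where
  src := f
  tgt := f
  base := f.base
  l_base _ := rfl
  r_base _ := rfl
  cell a hi hj hk hl := by
    subst hi hj hk hl
    exact D.hidMap (f.hom rfl)
  src_cell a hi hj hk hl := by
    subst hi hj hk hl
    exact D.src_hidMap _
  tgt_cell a hi hj hk hl := by
    subst hi hj hk hl
    exact D.tgt_hidMap _

/-- External composition of proarrows of families: the pullback of the indexing spans, with the
componentwise composites in `D`. -/
def hcomp {X Y Z : FinFam D} (M : Pro X Y) (N : Pro Y Z) : Pro X Z where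
  A := { p : M.A × N.A // M.r p.1 = N.l p.2 }
  fin := by
    have := M.fin
    have := N.fin
    infer_instance
  l p := M.l p.1.1
  r p := N.r p.1.2
  pro p hi hk := D.hcomp (M.pro p.1.1 hi rfl) (N.pro p.1.2 p.2.symm hk)

/-- External composition of cells of families. -/
def hcompCell {X Y Z X' Y' Z' : FinFam D} {M : Pro X Y} {N : Pro Y Z} {M' : Pro X' Y'}
    {N' : Pro Y' Z'} (α : Cell M M') (β : Cell N N') (h : α.tgt = β.src) :
    Cell (hcomp M N) (hcomp M' N') where
  src := α.src
  tgt := β.tgt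
  base p := ⟨(α.base p.1.1, β.base p.1.2), by
    rw [← α.r_base, ← β.l_base, h, p.2]⟩
  l_base p := α.l_base _
  r_base p := β.r_base _
  cell p hi hj hk hl :=
    D.hcompCell (α.cell p.1.1 hi rfl hk rfl) (β.cell p.1.2 _ hj p.2.symm hl) 
      ((α.tgt_cell ..).trans ((Hom.hom_congr h _ _).trans (β.src_cell ..).symm))
  src_cell _ _ _ _ _ := (D.src_hcompCell _ _ _).trans (α.src_cell ..)
  tgt_cell _ _ _ _ _ := (D.tgt_hcompCell _ _ _).trans (β.tgt_cell ..)

/-- The associator for families. -/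
def assoc {X Y Z T : FinFam D} (M : Pro X Y) (N : Pro Y Z) (P : Pro Z T) :
    Cell (hcomp (hcomp M N) P) (hcomp M (hcomp N P)) where
  src := Hom.id X
  tgt := Hom.id T
  base p := ⟨(⟨(p.1.1, p.1.2.1.1), p.2⟩, p.1.2.1.2), p.1.2.2⟩
  l_base _ := rfl
  r_base _ := rfl
  cell p hi hj hk hl := by
    subst hi hj hk hl
    exact D.assoc _ _ _
  src_cell p hi hj hk hl := by
    subst hi hj hk hl
    exact D.src_assoc _ _ _
  tgt_cell p hi hj hk hl := by
    subst hi hj hk hl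
    exact D.tgt_assoc _ _ _

/-- The inverse associator for families. -/
def assocInv {X Y Z T : FinFam D} (M : Pro X Y) (N : Pro Y Z) (P : Pro Z T) :
    Cell (hcomp M (hcomp N P)) (hcomp (hcomp M N) P) where
  src := Hom.id X
  tgt := Hom.id T
  base p := ⟨(p.1.1.1.1, ⟨(p.1.1.1.2, p.1.2), p.2⟩), p.1.1.2⟩
  l_base _ := rfl
  r_base _ := rfl
  cell p hi hj hk hl := by
    subst hi hj hk hl
    exact D.assocInv _ _ _
  src_cell p hi hj hk hl := by
    subst hi hj hk hl
    exact D.src_assocInv _ _ _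
  tgt_cell p hi hj hk hl := by
    subst hi hj hk hl
    exact D.tgt_assocInv _ _ _

/-- The left unitor for families. -/
def lunit {X Y : FinFam D} (M : Pro X Y) : Cell (hcomp (hid X) M) M where
  src := Hom.id X
  tgt := Hom.id Y
  base a := ⟨(M.l a, a), rfl⟩
  l_base _ := rfl
  r_base _ := rfl
  cell a hi hj hk hl := by
    subst hi hj hk hl
    exact D.lunit _
  src_cell a hi hj hk hl := by
    subst hi hj hk hl
    exact D.src_lunit _
  tgt_cell a hi hj hk hl := by
    subst hi hj hk hl
    exact D.tgt_lunit _

/-- The inverse left unitor for families. -/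
def lunitInv {X Y : FinFam D} (M : Pro X Y) : Cell M (hcomp (hid X) M) where
  src := Hom.id X
  tgt := Hom.id Y
  base p := p.1.2
  l_base p := p.2
  r_base _ := rfl
  cell p hi hj hk hl := by
    obtain ⟨⟨i, a⟩, h⟩ := p
    change i = M.l a at h
    change M.l a = _ at hi
    subst h hi hj hk hl
    exact D.lunitInv _
  src_cell p hi hj hk hl := by
    obtain ⟨⟨i, a⟩, h⟩ := p
    change i = M.l a at h
    change M.l a = _ at hi
    subst h hi hj hk hl
    exact D.src_lunitInv _
  tgt_cell p hi hj hk hl := by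
    obtain ⟨⟨i, a⟩, h⟩ := p
    change i = M.l a at h
    change M.l a = _ at hi
    subst h hi hj hk hl
    exact D.tgt_lunitInv _

/-- The right unitor for families. -/
def runit {X Y : FinFam D} (M : Pro X Y) : Cell (hcomp M (hid Y)) M where
  src := Hom.id X
  tgt := Hom.id Y
  base a := ⟨(a, M.r a), rfl⟩
  l_base _ := rfl
  r_base _ := rfl
  cell a hi hj hk hl := by
    subst hi hj hk hl
    exact D.runit _
  src_cell a hi hj hk hl := by
    subst hi hj hk hl
    exact D.src_runit _
  tgt_cell a hi hj hk hl := by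
    subst hi hj hk hl
    exact D.tgt_runit _

/-- The inverse right unitor for families. -/
def runitInv {X Y : FinFam D} (M : Pro X Y) : Cell M (hcomp M (hid Y)) where
  src := Hom.id X
  tgt := Hom.id Y
  base p := p.1.1
  l_base _ := rfl
  r_base p := p.2.symm
  cell p hi hj hk hl := by
    obtain ⟨⟨a, j⟩, h⟩ := p
    change M.r a = j at h
    change M.r a = _ at hj
    subst h hi hj hk hl
    exact D.runitInv _
  src_cell p hi hj hk hl := by
    obtain ⟨⟨a, j⟩, h⟩ := p
    change M.r a = j at h
    change M.r a = _ at hj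
    subst h hi hj hk hl
    exact D.src_runitInv _
  tgt_cell p hi hj hk hl := by
    obtain ⟨⟨a, j⟩, h⟩ := p
    change M.r a = j at h
    change M.r a = _ at hj
    subst h hi hj hk hl
    exact D.tgt_runitInv _

theorem vid_cell {X Y : FinFam D} (M : Pro X Y) {i : X.I} {j : Y.I} (a : M.A) (hi : M.l a = i)
    (hj : M.r a = j) : (vid M).cell a hi hj hi hj = D.vid (M.pro a hi hj) := by
  subst hi hj
  rfl

/-- The components of a vertical composite can be computed with any name for the middle indices. -/
theorem vcomp_cell {X Y X' Y' X₂ Y₂ : FinFam D} {M : Pro X Y} {N : Pro X' Y'} {P : Pro X₂ Y₂}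
    (α : Cell M N) (β : Cell N P) {i : X.I} {j : Y.I} {k : X₂.I} {l : Y₂.I} {i' : X'.I}
    {j' : Y'.I} (b : P.A) (hi : M.l (α.base (β.base b)) = i)
    (hj : M.r (α.base (β.base b)) = j) (hk : P.l b = k) (hl : P.r b = l)
    (hi' : N.l (β.base b) = i') (hj' : N.r (β.base b) = j') :
    (vcomp α β).cell b hi hj hk hl =
      D.vcomp (α.cell (β.base b) hi hj hi' hj') (β.cell b hi' hj' hk hl) := by
  have key : ∀ (i₁ : X'.I) (j₁ : Y'.I) (h₁ : N.l (β.base b) = i₁) (h₂ : N.r (β.base b) = j₁),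
      D.vcomp (α.cell (β.base b) hi hj h₁ h₂) (β.cell b h₁ h₂ hk hl) =
        D.vcomp (α.cell (β.base b) hi hj hi' hj') (β.cell b hi' hj' hk hl) := by
    intro i₁ j₁ h₁ h₂
    subst h₁ h₂ hi' hj'
    rfl
  exact key _ _ _ _

theorem assoc_cell {X Y Z T : FinFam D} (M : Pro X Y) (N : Pro Y Z) (P : Pro Z T) {i : X.I}
    {l : T.I} (p : (hcomp M (hcomp N P)).A) (hi : M.l p.1.1 = i) (hl : P.r p.1.2.1.2 = l) :
    (assoc M N P).cell p hi hl hi hl =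
      D.assoc (M.pro p.1.1 hi rfl) (N.pro p.1.2.1.1 p.2.symm rfl)
        (P.pro p.1.2.1.2 p.1.2.2.symm hl) := by
  subst hi hl
  rfl

theorem vid_vcomp {X Y X' Y' : FinFam D} {M : Pro X Y} {N : Pro X' Y'} (α : Cell M N) :
    vcomp (vid M) α = α :=
  Cell.ext' (Hom.id_comp _) (Hom.id_comp _) (fun _ => rfl) fun _ _ _ _ _ hi hj _ _ _ _ => by
    subst hi hj
    exact heq_of_eq ((vcomp_cell (vid M) α _ _ _ _ _ rfl rfl).trans (D.vid_vcomp _))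

theorem vcomp_vid {X Y X' Y' : FinFam D} {M : Pro X Y} {N : Pro X' Y'} (α : Cell M N) :
    vcomp α (vid N) = α :=
  Cell.ext' (Hom.comp_id _) (Hom.comp_id _) (fun _ => rfl) fun _ _ _ _ _ _ _ _ _ hk hl => by
    subst hk hl
    exact heq_of_eq (D.vcomp_vid _)

theorem vcomp_assoc {X Y X' Y' X₂ Y₂ X₃ Y₃ : FinFam D} {M : Pro X Y} {N : Pro X' Y'}
    {P : Pro X₂ Y₂} {Q : Pro X₃ Y₃} (α : Cell M N) (β : Cell N P) (γ : Cell P Q) :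
    vcomp (vcomp α β) γ = vcomp α (vcomp β γ) :=
  Cell.ext' (Hom.assoc _ _ _) (Hom.assoc _ _ _) (fun _ => rfl) fun _ _ _ _ _ _ _ _ _ _ _ =>
    heq_of_eq (D.vcomp_assoc _ _ _)

theorem hidMap_id (X : FinFam D) : hidMap (Hom.id X) = vid (hid X) :=
  Cell.ext' rfl rfl (fun _ => rfl) fun _ _ _ _ _ hi hj _ _ hk hl => by
    cases hi
    cases hj
    cases hk
    cases hl
    exact heq_of_eq (D.hidMap_id _)

theorem hidMap_comp {X Y Z : FinFam D} (f : Hom X Y) (g : Hom Y Z) :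
    hidMap (f.comp g) = vcomp (hidMap f) (hidMap g) :=
  Cell.ext' rfl rfl (fun _ => rfl) fun _ _ _ _ _ hi hj _ _ hk hl => by
    cases hi
    cases hj
    cases hk
    cases hl
    exact heq_of_eq (D.hidMap_comp _ _)

theorem hcompCell_vid {X Y Z : FinFam D} (M : Pro X Y) (N : Pro Y Z) :
    hcompCell (vid M) (vid N) rfl = vid (hcomp M N) :=
  Cell.ext' rfl rfl (fun _ => rfl) fun _ _ _ _ p hi hj _ _ hk hl => by
    subst hi hj hk hl
    refine heq_of_eq ((D.hcompCell_congr (vid_cell M p.1.1 rfl rfl)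
      (vid_cell N p.1.2 p.2.symm rfl) _ _).trans (D.hcompCell_vid _ _))

theorem hcompCell_vcomp {X Y Z X' Y' Z' X₂ Y₂ Z₂ : FinFam D} {M : Pro X Y} {N : Pro Y Z}
    {M' : Pro X' Y'} {N' : Pro Y' Z'} {M₂ : Pro X₂ Y₂} {N₂ : Pro Y₂ Z₂}
    (α : Cell M M') (β : Cell N N') (α' : Cell M' M₂) (β' : Cell N' N₂)
    (h : α.tgt = β.src) (h' : α'.tgt = β'.src) (h₂ : (vcomp α α').tgt = (vcomp β β').src) :
    hcompCell (vcomp α α') (vcomp β β') h₂ = vcomp (hcompCell α β h) (hcompCell α' β' h') :=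
  Cell.ext' rfl rfl (fun _ => rfl) fun _ _ _ _ p hi hj _ _ hk hl => by
    have e : N'.l (β'.base p.1.2) = M'.r (α'.base p.1.1) :=
      (((hcompCell α' β' h').base p).2).symm
    refine heq_of_eq ((D.hcompCell_congr
      (vcomp_cell α α' p.1.1 hi rfl hk rfl ((α'.l_base _).symm.trans (congrArg _ hk)) rfl)
      (vcomp_cell β β' p.1.2 _ hj p.2.symm hl e
        ((β'.r_base _).symm.trans (congrArg _ hl))) _ _).trans (D.hcompCell_vcomp _ _ _ _ _ _))

theorem assoc_assocInv {X Y Z T : FinFam D} (M : Pro X Y) (N : Pro Y Z) (P : Pro Z T) :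
    vcomp (assoc M N P) (assocInv M N P) = vid _ :=
  Cell.ext' (Hom.id_comp _) (Hom.id_comp _) (fun _ => rfl) fun _ _ _ _ p hi hj _ _ hk hl => by
    subst hi hj hk hl
    exact heq_of_eq ((vcomp_cell _ _ p rfl rfl rfl rfl rfl rfl).trans (D.assoc_assocInv _ _ _))

theorem assocInv_assoc {X Y Z T : FinFam D} (M : Pro X Y) (N : Pro Y Z) (P : Pro Z T) :
    vcomp (assocInv M N P) (assoc M N P) = vid _ :=
  Cell.ext' (Hom.id_comp _) (Hom.id_comp _) (fun _ => rfl) fun _ _ _ _ p hi hj _ _ hk hl => by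
    subst hi hj hk hl
    exact heq_of_eq ((vcomp_cell _ _ p rfl rfl rfl rfl rfl rfl).trans (D.assocInv_assoc _ _ _))

theorem assoc_naturality {X Y Z T X' Y' Z' T' : FinFam D} {M : Pro X Y} {N : Pro Y Z}
    {P : Pro Z T} {M' : Pro X' Y'} {N' : Pro Y' Z'} {P' : Pro Z' T'} (α : Cell M M')
    (β : Cell N N') (γ : Cell P P') (h : α.tgt = β.src) (h' : β.tgt = γ.src) :
    vcomp (hcompCell (hcompCell α β h) γ h') (assoc M' N' P') =
      vcomp (assoc M N P) (hcompCell α (hcompCell β γ h') h) :=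
  Cell.ext' ((Hom.comp_id _).trans (Hom.id_comp _).symm)
    ((Hom.comp_id _).trans (Hom.id_comp _).symm) (fun _ => rfl)
    fun _ _ _ _ p hi hj hi' hj' hk hl => heq_of_eq <| by
      refine (vcomp_cell (hcompCell (hcompCell α β h) γ h') (assoc M' N' P') p
        hi hj hk hl hk hl).trans ?_
      refine Eq.trans ?_ (vcomp_cell (assoc M N P) (hcompCell α (hcompCell β γ h') h) p
        hi' hj' hk hl hi hj).symm
      refine (congrArg (D.vcomp _) (assoc_cell M' N' P' p hk hl)).trans ?_
      refine Eq.trans ?_ (congrArg (fun t => D.vcomp t _)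
        (assoc_cell M N P ((hcompCell α (hcompCell β γ h') h).base p) hi hj)).symm
      exact D.assoc_naturality _ _ _ _ _

theorem lunit_lunitInv {X Y : FinFam D} (M : Pro X Y) :
    vcomp (lunit M) (lunitInv M) = vid _ :=
  Cell.ext' (Hom.id_comp _) (Hom.id_comp _)
    (fun p => Subtype.ext (Prod.ext p.2.symm rfl)) fun _ _ _ _ p hi hj _ _ hk hl => by
    obtain ⟨⟨i, a⟩, h⟩ := p
    change i = M.l a at h
    subst h
    cases hi
    cases hj
    cases hk
    cases hl
    exact heq_of_eq ((vcomp_cell _ _ _ rfl rfl rfl rfl rfl rfl).trans (D.lunit_lunitInv _))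

theorem lunitInv_lunit {X Y : FinFam D} (M : Pro X Y) :
    vcomp (lunitInv M) (lunit M) = vid _ :=
  Cell.ext' (Hom.id_comp _) (Hom.id_comp _) (fun _ => rfl) fun _ _ _ _ p hi hj _ _ hk hl => by
    subst hi hj hk hl
    exact heq_of_eq ((vcomp_cell _ _ p rfl rfl rfl rfl rfl rfl).trans (D.lunitInv_lunit _))

theorem lunit_naturality {X Y X' Y' : FinFam D} {M : Pro X Y} {M' : Pro X' Y'}
    (α : Cell M M') :
    vcomp (hcompCell (hidMap α.src) α rfl) (lunit M') = vcomp (lunit M) α :=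
  Cell.ext' ((Hom.comp_id _).trans (Hom.id_comp _).symm)
    ((Hom.comp_id _).trans (Hom.id_comp _).symm)
    (fun b => Subtype.ext (Prod.ext (α.l_base b) rfl))
    fun i j k l b hi hj hi' hj' hk hl => by
      change α.src.base (M'.l b) = i at hi
      subst hi hk
      have key : ∀ (i : X.I) (h : M.l (α.base b) = i) {x y : D.Obj} {n : D.Pro x y}
          (β : D.Cell (M.pro (α.base b) h hj) n),
          HEq (D.vcomp (D.lunit (M.pro (α.base b) h hj)) β)
            (D.vcomp ((lunit M).cell (α.base b) h hj h hj) β) := by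
        intro i h x y n β
        subst h hj
        rfl
      refine HEq.trans (heq_of_eq ?_) ((key _ (α.l_base b).symm
        (α.cell b (α.l_base b).symm hj rfl hl)).trans
        (heq_of_eq (vcomp_cell (lunit M) α b hi' hj' rfl hl (α.l_base b).symm hj).symm))
      refine (vcomp_cell _ (lunit M') b rfl hj rfl hl rfl hl).trans ?_
      refine Eq.trans ?_ (D.lunit_naturality (α.cell b (α.l_base b).symm hj rfl hl))
      subst hl
      refine congrArg (fun t => D.vcomp t _) (D.hcompCell_congr ?_ rfl _ _)
      exact congrArg D.hidMap (α.src_cell ..).symm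

theorem runit_runitInv {X Y : FinFam D} (M : Pro X Y) :
    vcomp (runit M) (runitInv M) = vid _ :=
  Cell.ext' (Hom.id_comp _) (Hom.id_comp _)
    (fun p => Subtype.ext (Prod.ext rfl p.2)) fun _ _ _ _ p hi hj _ _ hk hl => by
    obtain ⟨⟨a, j⟩, h⟩ := p
    change M.r a = j at h
    subst h
    cases hi
    cases hj
    cases hk
    cases hl
    exact heq_of_eq ((vcomp_cell _ _ _ rfl rfl rfl rfl rfl rfl).trans (D.runit_runitInv _))

theorem runitInv_runit {X Y : FinFam D} (M : Pro X Y) :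
    vcomp (runitInv M) (runit M) = vid _ :=
  Cell.ext' (Hom.id_comp _) (Hom.id_comp _) (fun _ => rfl) fun _ _ _ _ p hi hj _ _ hk hl => by
    subst hi hj hk hl
    exact heq_of_eq ((vcomp_cell _ _ p rfl rfl rfl rfl rfl rfl).trans (D.runitInv_runit _))

theorem runit_naturality {X Y X' Y' : FinFam D} {M : Pro X Y} {M' : Pro X' Y'}
    (α : Cell M M') :
    vcomp (hcompCell α (hidMap α.tgt) rfl) (runit M') = vcomp (runit M) α :=
  Cell.ext' ((Hom.comp_id _).trans (Hom.id_comp _).symm)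
    ((Hom.comp_id _).trans (Hom.id_comp _).symm)
    (fun b => Subtype.ext (Prod.ext rfl (α.r_base b)))
    fun i j k l b hi hj hi' hj' hk hl => by
      change M.l (α.base b) = i at hi
      change α.tgt.base (M'.r b) = j at hj
      subst hl
      have key : ∀ (j₀ : Y.I) (h₀ : M.r (α.base b) = j₀) (h₁ : α.tgt.base (M'.r b) = j₀)
          (h₂ : M.r (α.base b) = j) h₃ h₄,
          HEq (D.vcomp (D.hcompCell (α.cell b hi h₀ hk rfl)
              ((hidMap α.tgt).cell (M'.r b) h₁ hj rfl rfl) h₃) (D.runit (M'.pro b hk rfl)))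
            (D.vcomp (D.hcompCell (α.cell b hi h₂ hk rfl)
              ((hidMap α.tgt).cell (M'.r b) hj hj rfl rfl) h₄) (D.runit (M'.pro b hk rfl))) := by
        intro j₀ h₀ h₁ h₂ h₃ h₄
        subst h₁ hj
        rfl
      have key' : ∀ (j : Y.I) (h : M.r (α.base b) = j) {x y : D.Obj} {n : D.Pro x y}
          (β : D.Cell (M.pro (α.base b) hi h) n),
          HEq (D.vcomp (D.runit (M.pro (α.base b) hi h)) β)
            (D.vcomp ((runit M).cell (α.base b) hi h hi h) β) := by
        intro i h x n m β
        subst h hi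
        rfl
      subst hj hk
      refine HEq.trans (heq_of_eq (vcomp_cell _ (runit M') b hi rfl rfl rfl rfl rfl)) ?_
      refine HEq.trans (key _ rfl (α.r_base b) (α.r_base b).symm
        ((α.tgt_cell ..).trans ((hidMap α.tgt).src_cell ..).symm)
        ((α.tgt_cell ..).trans ((hidMap α.tgt).src_cell ..).symm)) ?_
      refine HEq.trans (heq_of_eq ?_) ((key' _ (α.r_base b).symm
        (α.cell b hi (α.r_base b).symm rfl rfl)).trans
        (heq_of_eq (vcomp_cell (runit M) α b hi' hj' rfl rfl hi (α.r_base b).symm).symm))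
      refine Eq.trans ?_ (D.runit_naturality (α.cell b hi (α.r_base b).symm rfl rfl))
      refine congrArg (fun t => D.vcomp t _) (D.hcompCell_congr rfl ?_ _ _)
      exact congrArg D.hidMap (α.tgt_cell ..).symm

theorem pentagon {X Y Z T S : FinFam D} (M : Pro X Y) (N : Pro Y Z) (P : Pro Z T)
    (Q : Pro T S) :
    vcomp (hcompCell (assoc M N P) (vid Q) rfl)
      (vcomp (assoc M (hcomp N P) Q) (hcompCell (vid M) (assoc N P Q) rfl)) =
      vcomp (assoc (hcomp M N) P Q) (assoc M N (hcomp P Q)) :=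
  Cell.ext' (congrArg (Hom.comp (Hom.id _)) (Hom.id_comp _))
    (congrArg (Hom.comp (Hom.id _)) (Hom.id_comp _)) (fun _ => rfl)
    fun _ _ _ _ p hi hj hi' hj' hk hl => heq_of_eq <| by
      subst hi hj hk hl
      refine (vcomp_cell (hcompCell (assoc M N P) (vid Q) rfl)
        (vcomp (assoc M (hcomp N P) Q) (hcompCell (vid M) (assoc N P Q) rfl)) p
        rfl rfl rfl rfl rfl rfl).trans ?_
      refine (congrArg (D.vcomp _) (vcomp_cell (assoc M (hcomp N P) Q)
        (hcompCell (vid M) (assoc N P Q) rfl) p rfl rfl rfl rfl rfl rfl)).trans ?_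
      refine Eq.trans ?_ (vcomp_cell (assoc (hcomp M N) P Q) (assoc M N (hcomp P Q)) p
        rfl rfl rfl rfl rfl rfl).symm
      refine Eq.trans ?_ (D.pentagon (M.pro p.1.1 rfl rfl) (N.pro p.1.2.1.1 p.2.symm rfl)
        (P.pro p.1.2.1.2.1.1 p.1.2.2.symm rfl) (Q.pro p.1.2.1.2.1.2 p.1.2.1.2.2.symm rfl))
      refine congrArg₂ D.vcomp (D.hcompCell_congr rfl ?_ _ _)
        (congrArg₂ D.vcomp rfl (D.hcompCell_congr rfl ?_ _ _))
      · exact vid_cell Q _ _ _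
      · exact assoc_cell N P Q _ _ _

theorem triangle {X Y Z : FinFam D} (M : Pro X Y) (N : Pro Y Z) :
    vcomp (assoc M (hid Y) N) (hcompCell (vid M) (lunit N) rfl) =
      hcompCell (runit M) (vid N) rfl :=
  Cell.ext' (Hom.id_comp _) (Hom.id_comp _)
    (fun p => Subtype.ext (Prod.ext (Subtype.ext (Prod.ext rfl p.2.symm)) rfl))
    fun _ _ _ _ p hi hj hi' hj' hk hl => by
      subst hi hj hk hl
      have key : ∀ (j : Y.I) (h : N.l p.1.2 = j) {x : D.Obj} (m : D.Pro x (Y.obj j)) h₁ h₂,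
          HEq (D.vcomp (D.assoc m ((hid Y).pro (N.l p.1.2) h rfl) (N.pro p.1.2 rfl rfl))
              (D.hcompCell (D.vid m) ((lunit N).cell p.1.2 h rfl h rfl) h₁))
            (D.vcomp (D.assoc m (D.hid (Y.obj j)) (N.pro p.1.2 h rfl))
              (D.hcompCell (D.vid m) (D.lunit (N.pro p.1.2 h rfl)) h₂)) := by
        intro j h x m h₁ h₂
        subst h
        rfl
      have e : ((hcompCell (runit M) (vid N) rfl).cell p rfl rfl rfl rfl) =
          D.hcompCell (D.runit (M.pro p.1.1 rfl rfl)) (D.vid (N.pro p.1.2 p.2.symm rfl))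
            ((D.tgt_runit _).trans (D.src_vid _).symm) :=
        D.hcompCell_congr rfl (vid_cell N p.1.2 p.2.symm rfl) _ _
      refine HEq.trans (heq_of_eq (vcomp_cell (assoc M (hid Y) N)
        (hcompCell (vid M) (lunit N) rfl) p rfl rfl rfl rfl rfl rfl)) ?_
      refine HEq.trans ?_ ((key _ p.2.symm (M.pro p.1.1 rfl rfl)
        (((vid M).tgt_cell p.1.1 rfl rfl rfl rfl).trans
          ((lunit N).src_cell p.1.2 p.2.symm rfl p.2.symm rfl).symm)
        ((D.tgt_vid _).trans (D.src_lunit _).symm)).trans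
          (heq_of_eq ((D.triangle _ _).trans e.symm)))
      exact heq_of_eq (congrArg (fun t => D.vcomp t _)
        (assoc_cell M (hid Y) N ((hcompCell (vid M) (lunit N) rfl).base p) rfl rfl))

end FinFam

namespace DoubleCat

/-- The contravariant double category of finite families in `D`: its objects are finite families of
objects, its arrows and cells are those of contravariant families, and its proarrows are families
of proarrows indexed by spans of finite sets. -/
def finFamOp (D : DoubleCat.{u, v, w, c}) : DoubleCat.{max 1 u, v, max 1 w, max v c} where
  Obj := FinFam D
  Pro X Y := FinFam.Pro X Y
  Cell M N := FinFam.Cell M N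
  src α := α.src
  tgt α := α.tgt
  vid M := FinFam.vid M
  vcomp α β := FinFam.vcomp α β
  src_vid _ := rfl
  tgt_vid _ := rfl
  src_vcomp _ _ := rfl
  tgt_vcomp _ _ := rfl
  vid_vcomp α := FinFam.vid_vcomp α
  vcomp_vid α := FinFam.vcomp_vid α
  vcomp_assoc α β γ := FinFam.vcomp_assoc α β γ
  hid X := FinFam.hid X
  hidMap f := FinFam.hidMap f
  src_hidMap _ := rfl
  tgt_hidMap _ := rfl
  hidMap_id X := FinFam.hidMap_id X
  hidMap_comp f g := FinFam.hidMap_comp f g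
  hcomp M N := FinFam.hcomp M N
  hcompCell α β h := FinFam.hcompCell α β h
  src_hcompCell _ _ _ := rfl
  tgt_hcompCell _ _ _ := rfl
  hcompCell_vid M N := FinFam.hcompCell_vid M N
  hcompCell_vcomp α β α' β' h h' := FinFam.hcompCell_vcomp α β α' β' h h' _
  assoc M N P := FinFam.assoc M N P
  assocInv M N P := FinFam.assocInv M N P
  src_assoc _ _ _ := rfl
  tgt_assoc _ _ _ := rfl
  assoc_assocInv M N P := FinFam.assoc_assocInv M N P
  assocInv_assoc M N P := FinFam.assocInv_assoc M N P
  assoc_naturality α β γ h h' := FinFam.assoc_naturality α β γ h h'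
  lunit M := FinFam.lunit M
  lunitInv M := FinFam.lunitInv M
  src_lunit _ := rfl
  tgt_lunit _ := rfl
  lunit_lunitInv M := FinFam.lunit_lunitInv M
  lunitInv_lunit M := FinFam.lunitInv_lunit M
  lunit_naturality α := FinFam.lunit_naturality α
  runit M := FinFam.runit M
  runitInv M := FinFam.runitInv M
  src_runit _ := rfl
  tgt_runit _ := rfl
  runit_runitInv M := FinFam.runit_runitInv M
  runitInv_runit M := FinFam.runitInv_runit M
  runit_naturality α := FinFam.runit_naturality α
  pentagon M N P Q := FinFam.pentagon M N P Q
  triangle M N := FinFam.triangle M N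

/-- The embedding `Δ` of `D` into the double category of finite families, sending objects and
proarrows to families indexed by the singleton set and by the singleton span. -/
def singleton (D : DoubleCat.{u, v, w, c}) : LaxDoubleFunctor D D.finFamOp where
  obj x := { I := Unit, fin := inferInstance, obj := fun _ => x }
  map f := { base := fun i => i, hom := fun _ => f }
  map_id x := FinFam.Hom.ext' rfl fun _ _ _ _ => rfl
  map_comp f g := rfl
  pro m :=
    { A := Unit
      fin := inferInstance
      l := fun _ => ()
      r := fun _ => ()
      pro := fun _ _ _ => m }
  cell α :=
    { src := { base := fun i => i, hom := fun _ => D.src α }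
      tgt := { base := fun i => i, hom := fun _ => D.tgt α }
      base := fun a => a
      l_base := fun _ => rfl
      r_base := fun _ => rfl
      cell := fun _ _ _ _ _ => α
      src_cell := fun _ _ _ _ _ => rfl
      tgt_cell := fun _ _ _ _ _ => rfl }
  src_cell _ := rfl
  tgt_cell _ := rfl
  cell_vid m := FinFam.Cell.ext' (FinFam.Hom.ext' rfl fun _ _ _ _ => D.src_vid m)
    (FinFam.Hom.ext' rfl fun _ _ _ _ => D.tgt_vid m) (fun _ => rfl)
    fun _ _ _ _ _ _ _ _ _ _ _ => HEq.rfl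
  cell_vcomp α β := FinFam.Cell.ext' (FinFam.Hom.ext' rfl fun _ _ _ _ => D.src_vcomp α β)
    (FinFam.Hom.ext' rfl fun _ _ _ _ => D.tgt_vcomp α β) (fun _ => rfl)
    fun _ _ _ _ _ _ _ _ _ _ _ => HEq.rfl
  laxComp m n :=
    { src := FinFam.Hom.id _
      tgt := FinFam.Hom.id _
      base := fun _ => ⟨((), ()), rfl⟩
      l_base := fun _ => rfl
      r_base := fun _ => rfl
      cell := fun _ _ _ _ _ => D.vid (D.hcomp m n)
      src_cell := fun _ _ _ _ _ => D.src_vid _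
      tgt_cell := fun _ _ _ _ _ => D.tgt_vid _ }
  src_laxComp _ _ := rfl
  tgt_laxComp _ _ := rfl
  laxUnit x :=
    { src := FinFam.Hom.id _
      tgt := FinFam.Hom.id _
      base := fun _ => ()
      l_base := fun _ => rfl
      r_base := fun _ => rfl
      cell := fun _ _ _ _ _ => D.vid (D.hid x)
      src_cell := fun _ _ _ _ _ => D.src_vid _
      tgt_cell := fun _ _ _ _ _ => D.tgt_vid _ }
  src_laxUnit _ := rfl
  tgt_laxUnit _ := rfl
  laxComp_naturality α β h :=
    FinFam.Cell.ext'
      (FinFam.Hom.ext' rfl fun _ _ _ _ => by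
        change D.src α ≫ 𝟙 _ = 𝟙 _ ≫ D.src (D.hcompCell α β h)
        rw [D.src_hcompCell, Category.comp_id, Category.id_comp])
      (FinFam.Hom.ext' rfl fun _ _ _ _ => by
        change D.tgt β ≫ 𝟙 _ = 𝟙 _ ≫ D.tgt (D.hcompCell α β h)
        rw [D.tgt_hcompCell, Category.comp_id, Category.id_comp])
      (fun _ => rfl)
      fun _ _ _ _ _ _ _ _ _ _ _ => heq_of_eq ((LaxDoubleFunctor.id D).laxComp_naturality α β h)
  laxUnit_naturality f :=
    FinFam.Cell.ext'
      (FinFam.Hom.ext' rfl fun _ _ _ _ => by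
        change f ≫ 𝟙 _ = 𝟙 _ ≫ D.src (D.hidMap f)
        rw [D.src_hidMap, Category.comp_id, Category.id_comp])
      (FinFam.Hom.ext' rfl fun _ _ _ _ => by
        change f ≫ 𝟙 _ = 𝟙 _ ≫ D.tgt (D.hidMap f)
        rw [D.tgt_hidMap, Category.comp_id, Category.id_comp])
      (fun _ => rfl)
      fun _ _ _ _ _ _ _ _ _ _ _ => heq_of_eq ((LaxDoubleFunctor.id D).laxUnit_naturality f)
  laxComp_assoc m n p :=
    FinFam.Cell.ext' (FinFam.Hom.ext' rfl fun _ _ _ _ => by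
        change 𝟙 _ ≫ 𝟙 _ ≫ D.src (D.assoc m n p) = 𝟙 _ ≫ 𝟙 _ ≫ 𝟙 _
        rw [D.src_assoc])
      (FinFam.Hom.ext' rfl fun _ _ _ _ => by
        change 𝟙 _ ≫ 𝟙 _ ≫ D.tgt (D.assoc m n p) = 𝟙 _ ≫ 𝟙 _ ≫ 𝟙 _
        rw [D.tgt_assoc]) (fun _ => rfl)
      fun _ _ _ _ _ _ _ _ _ _ _ => heq_of_eq ((LaxDoubleFunctor.id D).laxComp_assoc m n p)
  laxComp_lunit m :=
    FinFam.Cell.ext' (FinFam.Hom.ext' rfl fun _ _ _ _ => by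
        change 𝟙 _ ≫ 𝟙 _ ≫ D.src (D.lunit m) = 𝟙 _
        rw [D.src_lunit, Category.id_comp, Category.id_comp])
      (FinFam.Hom.ext' rfl fun _ _ _ _ => by
        change 𝟙 _ ≫ 𝟙 _ ≫ D.tgt (D.lunit m) = 𝟙 _
        rw [D.tgt_lunit, Category.id_comp, Category.id_comp]) (fun _ => rfl)
      fun _ _ _ _ _ _ _ _ _ _ _ => heq_of_eq ((LaxDoubleFunctor.id D).laxComp_lunit m)
  laxComp_runit m :=
    FinFam.Cell.ext' (FinFam.Hom.ext' rfl fun _ _ _ _ => by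
        change 𝟙 _ ≫ 𝟙 _ ≫ D.src (D.runit m) = 𝟙 _
        rw [D.src_runit, Category.id_comp, Category.id_comp])
      (FinFam.Hom.ext' rfl fun _ _ _ _ => by
        change 𝟙 _ ≫ 𝟙 _ ≫ D.tgt (D.runit m) = 𝟙 _
        rw [D.tgt_runit, Category.id_comp, Category.id_comp]) (fun _ => rfl)
      fun _ _ _ _ _ _ _ _ _ _ _ => heq_of_eq ((LaxDoubleFunctor.id D).laxComp_runit m)

/-- A double category has lax finite products if the embedding `Δ` of `D` into the contravariant
double category of finite families has a lax right adjoint. -/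
def HasLaxFiniteProducts (D : DoubleCat.{u, v, w, c}) : Prop :=
  ∃ P : LaxDoubleFunctor D.finFamOp D, Nonempty (DoubleAdjunction D.singleton P)

/-- A double category has strong finite products if the embedding `Δ` of `D` into the contravariant
double category of finite families has a pseudo right adjoint. -/
def HasStrongFiniteProducts (D : DoubleCat.{u, v, w, c}) : Prop :=
  ∃ P : LaxDoubleFunctor D.finFamOp D,
    Nonempty (DoubleAdjunction D.singleton P) ∧ P.IsPseudo

/-- A double category has iso-strong finite products if it has lax finite products such that the
comparison cell `Π m ⊙ Π n → Π (m ⊙ n)` is invertible for every pair of families of proarrows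
indexed by spans `I ← A → J` and `J ← B → K` whose adjacent legs `A → J` and `J ← B` are bijections,
and the comparison cell `id (Π x) → Π (id x)` is invertible for every family of objects. -/
def HasIsoStrongFiniteProducts (D : DoubleCat.{u, v, w, c}) : Prop :=
  ∃ P : LaxDoubleFunctor D.finFamOp D,
    Nonempty (DoubleAdjunction D.singleton P) ∧
    (∀ {X Y Z : FinFam D} (M : FinFam.Pro X Y) (N : FinFam.Pro Y Z),
      Function.Bijective M.r → Function.Bijective N.l → D.IsInvertible (P.laxComp M N)) ∧
    ∀ X : FinFam D, D.IsInvertible (P.laxUnit X)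

end DoubleCat

/-! The embedding `Δ` of `D` into finite families is pseudo. For a pseudo double functor `F : D →
E`, a lax right adjoint is determined by universal data: a universal arrow `ε` from `F` to every
object of `E`, and a universal cell from `F` to every proarrow, with these arrows as boundary. The
comparison cells of the right adjoint are the lifts of `ε ⊙ ε`, precomposed with the inverse
comparison cells of `F`; every coherence law follows from uniqueness of lifts. So it suffices to
construct products of families one at a time (`UniversalArrows.adjunction`,
`FamilyProducts.adjunction`).

In a precartesian equipment, let `(A, m)` be a family of proarrows from `(I, x)` to `(J, y)`, with
legs `l` and `r`. The parallel product of the `m a` goes from the product of the `x (l a)` to that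
of the `y (r a)`. Restricting it along the two arrows that reindex the products of the `x i` and of
the `y j` gives `Π m` (`FamilyProducts.ofParallelProducts`).

In a cartesian equipment, suppose that the inner legs of two composable families are bijections. Up
to reindexing by these bijections, the first product is a restriction of a `J`-indexed parallel
product along its left boundary only, and the second along its right boundary only. External
composition preserves such outer restrictions, because they are given by composing with companions
and conjoints (`IsRestriction.hcompCell`). The composite of the two parallel products is again a
parallel product, as the products are strong. Hence `Π m ⊙ Π n` is a restriction of the parallel
product of the composites, which has the universal property of `Π (m ⊙ n)`
(`isInvertible_laxComp_of_isParallelCone`). For identities the legs are identities and no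
restriction intervenes.

The counterexample has sets as objects, relations both as arrows and as proarrows, and inclusions
`src ⊙ n ⊆ m ⊙ tgt` as cells. Products are disjoint unions, and a family of proarrows becomes a
matrix of unions of relations. Composition of relations distributes over unions, so matrix
multiplication matches the pullback of spans for all legs, bijective or not. Some niches are the
boundary of no cell at all, so restrictions do not exist. -/

namespace DoubleCat

/-! ### Interchange and cancellation of invertible cells. -/

variable {D : DoubleCat.{u, v, w, c}}

/-- The vertical composites enter through equations, so a rewrite can interchange and simplify both
factors at once without disturbing the boundary proof on which the horizontal composite depends. -/
theorem hcompCell_vcomp' {x y z x' y' z' x'' y'' z'' : D.Obj} {m : D.Pro x y} {n : D.Pro y z}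
    {m' : D.Pro x' y'} {n' : D.Pro y' z'} {m'' : D.Pro x'' y''} {n'' : D.Pro y'' z''}
    (α : D.Cell m m') (β : D.Cell n n') (α' : D.Cell m' m'') (β' : D.Cell n' n'')
    (h : D.tgt α = D.src β) (h' : D.tgt α' = D.src β') {γ : D.Cell m m''} {δ : D.Cell n n''}
    (hγ : D.vcomp α α' = γ) (hδ : D.vcomp β β' = δ) (h'' : D.tgt γ = D.src δ) :
    D.vcomp (D.hcompCell α β h) (D.hcompCell α' β' h') = D.hcompCell γ δ h'' := by
  subst hγ hδ
  exact (D.hcompCell_vcomp α β α' β' h h').symm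

theorem IsInvertible.vcomp_left_cancel {x y x' y' x'' y'' : D.Obj} {m : D.Pro x y}
    {n : D.Pro x' y'} {p : D.Pro x'' y''} {α : D.Cell m n} (h : D.IsInvertible α)
    {β γ : D.Cell n p} (e : D.vcomp α β = D.vcomp α γ) : β = γ := by
  obtain ⟨δ, -, h⟩ := h
  have := congrArg (D.vcomp δ) e
  rwa [← D.vcomp_assoc, ← D.vcomp_assoc, h, D.vid_vcomp, D.vid_vcomp] at this

theorem IsInvertible.vcomp_right_cancel {x y x' y' x'' y'' : D.Obj} {m : D.Pro x y}
    {n : D.Pro x' y'} {p : D.Pro x'' y''} {α : D.Cell n p} (h : D.IsInvertible α)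
    {β γ : D.Cell m n} (e : D.vcomp β α = D.vcomp γ α) : β = γ := by
  obtain ⟨δ, h, -⟩ := h
  have := congrArg (fun t => D.vcomp t δ) e
  rwa [D.vcomp_assoc, D.vcomp_assoc, h, D.vcomp_vid, D.vcomp_vid] at this

/-- The horizontal composite of an invertible globular cell with an identity cell is invertible. -/
theorem IsInvertible.hcompCell_vid {x y z : D.Obj} {m m' : D.Pro x y} {α : D.Cell m m'}
    (h : D.IsInvertible α) (hα : D.tgt α = 𝟙 y) (n : D.Pro y z)
    (h' : D.tgt α = D.src (D.vid n)) : D.IsInvertible (D.hcompCell α (D.vid n) h') := by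
  obtain ⟨δ, h₁, h₂⟩ := h
  have hδ : D.tgt δ = 𝟙 y := by
    have := congrArg D.tgt h₁
    rwa [D.tgt_vcomp, hα, Category.id_comp, D.tgt_vid] at this
  refine ⟨D.hcompCell δ (D.vid n) (hδ.trans (D.src_vid n).symm), ?_, ?_⟩
  · rw [hcompCell_vcomp' _ _ _ _ _ _ h₁ (D.vid_vcomp _) ((D.tgt_vid _).trans (D.src_vid _).symm),
      D.hcompCell_vid]
  · rw [hcompCell_vcomp' _ _ _ _ _ _ h₂ (D.vid_vcomp _) ((D.tgt_vid _).trans (D.src_vid _).symm),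
      D.hcompCell_vid]

theorem IsInvertible.vid_hcompCell {x y z : D.Obj} {m m' : D.Pro y z} {α : D.Cell m m'}
    (h : D.IsInvertible α) (hα : D.src α = 𝟙 y) (n : D.Pro x y)
    (h' : D.tgt (D.vid n) = D.src α) : D.IsInvertible (D.hcompCell (D.vid n) α h') := by
  obtain ⟨δ, h₁, h₂⟩ := h
  have hδ : D.src δ = 𝟙 y := by
    have := congrArg D.src h₁
    rwa [D.src_vcomp, hα, Category.id_comp, D.src_vid] at this
  refine ⟨D.hcompCell (D.vid n) δ ((D.tgt_vid n).trans hδ.symm), ?_, ?_⟩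
  · rw [hcompCell_vcomp' _ _ _ _ _ _ (D.vid_vcomp _) h₁ ((D.tgt_vid _).trans (D.src_vid _).symm),
      D.hcompCell_vid]
  · rw [hcompCell_vcomp' _ _ _ _ _ _ (D.vid_vcomp _) h₂ ((D.tgt_vid _).trans (D.src_vid _).symm),
      D.hcompCell_vid]

end DoubleCat

/-! ### Lax right adjoints of pseudo double functors from universal arrows. -/

/-- Universal arrows from a double functor `F : D → E` to the objects of `E`, and universal cells
from `F` to the proarrows of `E` lying over them. -/
structure UniversalArrows {D : DoubleCat.{u, v, w, c}} {E : DoubleCat.{u', v', w', c'}}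
    (F : LaxDoubleFunctor D E) where
  obj : E.Obj → D.Obj
  counit : ∀ X : E.Obj, F.obj (obj X) ⟶ X
  lift : ∀ {a : D.Obj} {X : E.Obj}, (F.obj a ⟶ X) → (a ⟶ obj X)
  fac : ∀ {a : D.Obj} {X : E.Obj} (f : F.obj a ⟶ X), F.map (lift f) ≫ counit X = f
  hom_ext : ∀ {a : D.Obj} {X : E.Obj} {f g : a ⟶ obj X},
    F.map f ≫ counit X = F.map g ≫ counit X → f = g
  pro : ∀ {X Y : E.Obj}, E.Pro X Y → D.Pro (obj X) (obj Y)
  counitPro : ∀ {X Y : E.Obj} (M : E.Pro X Y), E.Cell (F.pro (pro M)) M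
  src_counitPro : ∀ {X Y : E.Obj} (M : E.Pro X Y), E.src (counitPro M) = counit X
  tgt_counitPro : ∀ {X Y : E.Obj} (M : E.Pro X Y), E.tgt (counitPro M) = counit Y
  liftCell : ∀ {a b : D.Obj} {p : D.Pro a b} {X Y : E.Obj} {M : E.Pro X Y},
    E.Cell (F.pro p) M → D.Cell p (pro M)
  facCell : ∀ {a b : D.Obj} {p : D.Pro a b} {X Y : E.Obj} {M : E.Pro X Y}
    (α : E.Cell (F.pro p) M), E.vcomp (F.cell (liftCell α)) (counitPro M) = α
  cell_ext : ∀ {a b : D.Obj} {p : D.Pro a b} {X Y : E.Obj} {M : E.Pro X Y}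
    {α β : D.Cell p (pro M)},
    E.vcomp (F.cell α) (counitPro M) = E.vcomp (F.cell β) (counitPro M) → α = β

namespace UniversalArrows

variable {D : DoubleCat.{u, v, w, c}} {E : DoubleCat.{u', v', w', c'}}
  {F : LaxDoubleFunctor D E} (U : UniversalArrows F) (hF : F.IsPseudo)

/-- Uniqueness of lifts of arrows forces the boundary of a lifted cell, which is why the structure
does not record it. -/
theorem src_liftCell {a b : D.Obj} {p : D.Pro a b} {X Y : E.Obj} {M : E.Pro X Y}
    (α : E.Cell (F.pro p) M) : D.src (U.liftCell α) = U.lift (E.src α) := by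
  apply U.hom_ext
  rw [U.fac, ← F.src_cell, ← U.src_counitPro M, ← E.src_vcomp, U.facCell]

theorem tgt_liftCell {a b : D.Obj} {p : D.Pro a b} {X Y : E.Obj} {M : E.Pro X Y}
    (α : E.Cell (F.pro p) M) : D.tgt (U.liftCell α) = U.lift (E.tgt α) := by
  apply U.hom_ext
  rw [U.fac, ← F.tgt_cell, ← U.tgt_counitPro M, ← E.tgt_vcomp, U.facCell]

theorem lift_counit (X : E.Obj) : U.lift (U.counit X) = 𝟙 (U.obj X) :=
  U.hom_ext (by rw [U.fac, F.map_id, Category.id_comp])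

theorem counit_tgt_eq_src {X Y Z : E.Obj} (M : E.Pro X Y) (N : E.Pro Y Z) :
    E.tgt (U.counitPro M) = E.src (U.counitPro N) :=
  (U.tgt_counitPro M).trans (U.src_counitPro N).symm

/-- The cell is the inverse comparison cell of `F` followed by the composite of the two counits. The
displayed equation determines it, since `F.laxComp` is invertible, so later arguments use only this
equation. -/
theorem exists_comparison (hF : F.IsPseudo) {X Y Z : E.Obj} (M : E.Pro X Y) (N : E.Pro Y Z) :
    ∃ κ : E.Cell (F.pro (D.hcomp (U.pro M) (U.pro N))) (E.hcomp M N),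
      E.vcomp (F.laxComp (U.pro M) (U.pro N)) κ =
        E.hcompCell (U.counitPro M) (U.counitPro N) (U.counit_tgt_eq_src M N) := by
  obtain ⟨δ, h, -⟩ := hF.1 (U.pro M) (U.pro N)
  exact ⟨E.vcomp δ (E.hcompCell _ _ (U.counit_tgt_eq_src M N)),
    by rw [← E.vcomp_assoc, h, E.vid_vcomp]⟩

theorem exists_unitComparison (hF : F.IsPseudo) (X : E.Obj) :
    ∃ κ : E.Cell (F.pro (D.hid (U.obj X))) (E.hid X),
      E.vcomp (F.laxUnit (U.obj X)) κ = E.hidMap (U.counit X) := by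
  obtain ⟨δ, h, -⟩ := hF.2 (U.obj X)
  exact ⟨E.vcomp δ (E.hidMap (U.counit X)), by rw [← E.vcomp_assoc, h, E.vid_vcomp]⟩

/-- The comparison cell of the right adjoint for composites. -/
noncomputable def laxComp {X Y Z : E.Obj} (M : E.Pro X Y) (N : E.Pro Y Z) :
    D.Cell (D.hcomp (U.pro M) (U.pro N)) (U.pro (E.hcomp M N)) :=
  U.liftCell (U.exists_comparison hF M N).choose

/-- The comparison cell of the right adjoint for identities. -/
noncomputable def laxUnit (X : E.Obj) : D.Cell (D.hid (U.obj X)) (U.pro (E.hid X)) :=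
  U.liftCell (U.exists_unitComparison hF X).choose

/-- This characterizes the comparison cell. The compatibilities below involving composites rest on
it: apply `F`, compose with the counit, and precompose with invertible comparison cells of `F`. -/
theorem laxComp_fac {X Y Z : E.Obj} (M : E.Pro X Y) (N : E.Pro Y Z) :
    E.vcomp (F.laxComp (U.pro M) (U.pro N))
      (E.vcomp (F.cell (U.laxComp hF M N)) (U.counitPro (E.hcomp M N))) =
      E.hcompCell (U.counitPro M) (U.counitPro N) (U.counit_tgt_eq_src M N) := by
  rw [laxComp, U.facCell]
  exact (U.exists_comparison hF M N).choose_spec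

theorem laxUnit_fac (X : E.Obj) :
    E.vcomp (F.laxUnit (U.obj X))
      (E.vcomp (F.cell (U.laxUnit hF X)) (U.counitPro (E.hid X))) = E.hidMap (U.counit X) := by
  rw [laxUnit, U.facCell]
  exact (U.exists_unitComparison hF X).choose_spec

theorem src_laxComp {X Y Z : E.Obj} (M : E.Pro X Y) (N : E.Pro Y Z) :
    D.src (U.laxComp hF M N) = 𝟙 (U.obj X) := by
  apply U.hom_ext
  have := congrArg E.src (U.laxComp_fac hF M N)
  rw [E.src_vcomp, F.src_laxComp, Category.id_comp, E.src_vcomp, F.src_cell, U.src_counitPro,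
    E.src_hcompCell, U.src_counitPro] at this
  rw [this, F.map_id, Category.id_comp]

theorem tgt_laxComp {X Y Z : E.Obj} (M : E.Pro X Y) (N : E.Pro Y Z) :
    D.tgt (U.laxComp hF M N) = 𝟙 (U.obj Z) := by
  apply U.hom_ext
  have := congrArg E.tgt (U.laxComp_fac hF M N)
  rw [E.tgt_vcomp, F.tgt_laxComp, Category.id_comp, E.tgt_vcomp, F.tgt_cell, U.tgt_counitPro,
    E.tgt_hcompCell, U.tgt_counitPro] at this
  rw [this, F.map_id, Category.id_comp]

theorem src_laxUnit (X : E.Obj) : D.src (U.laxUnit hF X) = 𝟙 (U.obj X) := by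
  apply U.hom_ext
  have := congrArg E.src (U.laxUnit_fac hF X)
  rw [E.src_vcomp, F.src_laxUnit, Category.id_comp, E.src_vcomp, F.src_cell, U.src_counitPro,
    E.src_hidMap] at this
  rw [this, F.map_id, Category.id_comp]

theorem tgt_laxUnit (X : E.Obj) : D.tgt (U.laxUnit hF X) = 𝟙 (U.obj X) := by
  apply U.hom_ext
  have := congrArg E.tgt (U.laxUnit_fac hF X)
  rw [E.tgt_vcomp, F.tgt_laxUnit, Category.id_comp, E.tgt_vcomp, F.tgt_cell, U.tgt_counitPro,
    E.tgt_hidMap] at this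
  rw [this, F.map_id, Category.id_comp]

/-- The action of the right adjoint on cells. -/
def mapCell {X Y X' Y' : E.Obj} {M : E.Pro X Y} {N : E.Pro X' Y'} (α : E.Cell M N) :
    D.Cell (U.pro M) (U.pro N) :=
  U.liftCell (E.vcomp (U.counitPro M) α)

theorem mapCell_fac {X Y X' Y' : E.Obj} {M : E.Pro X Y} {N : E.Pro X' Y'} (α : E.Cell M N) :
    E.vcomp (F.cell (U.mapCell α)) (U.counitPro N) = E.vcomp (U.counitPro M) α :=
  U.facCell _

theorem src_mapCell {X Y X' Y' : E.Obj} {M : E.Pro X Y} {N : E.Pro X' Y'} (α : E.Cell M N) :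
    D.src (U.mapCell α) = U.lift (U.counit X ≫ E.src α) := by
  rw [mapCell, U.src_liftCell, E.src_vcomp, U.src_counitPro]

theorem tgt_mapCell {X Y X' Y' : E.Obj} {M : E.Pro X Y} {N : E.Pro X' Y'} (α : E.Cell M N) :
    D.tgt (U.mapCell α) = U.lift (U.counit Y ≫ E.tgt α) := by
  rw [mapCell, U.tgt_liftCell, E.tgt_vcomp, U.tgt_counitPro]

/-- Composing the comparison cell of the right adjoint with a horizontal composite. -/
theorem hcompCell_laxComp_fac {a b d : D.Obj} {p : D.Pro a b} {q : D.Pro b d} {X Y Z : E.Obj}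
    {M : E.Pro X Y} {N : E.Pro Y Z} (α : D.Cell p (U.pro M)) (β : D.Cell q (U.pro N))
    (h : D.tgt α = D.src β) (h' : E.tgt (F.cell α) = E.src (F.cell β)) :
    E.vcomp (F.laxComp p q) (E.vcomp (F.cell (D.hcompCell α β h))
      (E.vcomp (F.cell (U.laxComp hF M N)) (U.counitPro (E.hcomp M N)))) =
    E.vcomp (E.hcompCell (F.cell α) (F.cell β) h')
      (E.hcompCell (U.counitPro M) (U.counitPro N) (U.counit_tgt_eq_src M N)) := by
  rw [← E.vcomp_assoc, ← F.laxComp_naturality α β h, E.vcomp_assoc, U.laxComp_fac]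

/-- After transposition both sides are the horizontal composite of `counitPro M` followed by `α` and
`counitPro N` followed by `β`. -/
theorem laxComp_naturality {X Y Z X' Y' Z' : E.Obj} {M : E.Pro X Y} {N : E.Pro Y Z}
    {M' : E.Pro X' Y'} {N' : E.Pro Y' Z'} (α : E.Cell M M') (β : E.Cell N N')
    (h : E.tgt α = E.src β) (h' : D.tgt (U.mapCell α) = D.src (U.mapCell β)) :
    D.vcomp (D.hcompCell (U.mapCell α) (U.mapCell β) h') (U.laxComp hF M' N') =
      D.vcomp (U.laxComp hF M N) (U.mapCell (E.hcompCell α β h)) := by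
  apply U.cell_ext
  apply (hF.1 _ _).vcomp_left_cancel
  rw [F.cell_vcomp, E.vcomp_assoc, U.hcompCell_laxComp_fac hF _ _ h' (by
    rw [F.tgt_cell, F.src_cell, h']), F.cell_vcomp, E.vcomp_assoc, U.mapCell_fac,
    ← E.vcomp_assoc (F.cell (U.laxComp hF M N)), ← E.vcomp_assoc (F.laxComp _ _),
    U.laxComp_fac, ← E.hcompCell_vcomp, ← E.hcompCell_vcomp]
  exact E.hcompCell_congr (U.mapCell_fac α) (U.mapCell_fac β) _ _

theorem laxUnit_naturality {X Y : E.Obj} (f : X ⟶ Y) :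
    D.vcomp (D.hidMap (U.lift (U.counit X ≫ f))) (U.laxUnit hF Y) =
      D.vcomp (U.laxUnit hF X) (U.mapCell (E.hidMap f)) := by
  apply U.cell_ext
  apply (hF.2 _).vcomp_left_cancel
  rw [F.cell_vcomp, E.vcomp_assoc, ← E.vcomp_assoc (F.laxUnit _), ← F.laxUnit_naturality,
    E.vcomp_assoc, U.laxUnit_fac, ← E.hidMap_comp, U.fac, F.cell_vcomp, E.vcomp_assoc,
    U.mapCell_fac, ← E.vcomp_assoc (F.cell _), ← E.vcomp_assoc (F.laxUnit _), U.laxUnit_fac,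
    ← E.hidMap_comp]

theorem laxComp_assoc {X Y Z T : E.Obj} (M : E.Pro X Y) (N : E.Pro Y Z) (P : E.Pro Z T) :
    D.vcomp
      (D.hcompCell (U.laxComp hF M N) (D.vid (U.pro P))
        ((U.tgt_laxComp hF M N).trans (D.src_vid (U.pro P)).symm))
      (D.vcomp (U.laxComp hF (E.hcomp M N) P) (U.mapCell (E.assoc M N P))) =
    D.vcomp (D.assoc (U.pro M) (U.pro N) (U.pro P))
      (D.vcomp
        (D.hcompCell (D.vid (U.pro M)) (U.laxComp hF N P)
          ((D.tgt_vid (U.pro M)).trans (U.src_laxComp hF N P).symm))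
        (U.laxComp hF M (E.hcomp N P))) := by
  apply U.cell_ext
  -- The two cancellations let both sides start at the triple composite of the images under `F`,
  -- where each comparison cell can be replaced by counits.
  apply (hF.1 _ _).vcomp_left_cancel
  apply ((hF.1 (U.pro M) (U.pro N)).hcompCell_vid (F.tgt_laxComp _ _) (F.pro (U.pro P))
    ((F.tgt_laxComp _ _).trans (E.src_vid _).symm)).vcomp_left_cancel
  have h₁ : E.tgt (F.cell (U.laxComp hF M N)) = E.src (F.cell (D.vid (U.pro P))) := by
    rw [F.tgt_cell, F.src_cell, U.tgt_laxComp, D.src_vid]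
  have h₂ : E.tgt (F.cell (D.vid (U.pro M))) = E.src (F.cell (U.laxComp hF N P)) := by
    rw [F.tgt_cell, F.src_cell, U.src_laxComp, D.tgt_vid]
  have e := U.laxComp_fac hF (E.hcomp M N) P
  have e₁ : E.vcomp (F.cell (D.vcomp
      (D.hcompCell (U.laxComp hF M N) (D.vid (U.pro P))
        ((U.tgt_laxComp hF M N).trans (D.src_vid (U.pro P)).symm))
      (D.vcomp (U.laxComp hF (E.hcomp M N) P) (U.mapCell (E.assoc M N P)))))
      (U.counitPro (E.hcomp M (E.hcomp N P))) =
      E.vcomp (E.vcomp (F.cell (D.hcompCell (U.laxComp hF M N) (D.vid (U.pro P))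
        ((U.tgt_laxComp hF M N).trans (D.src_vid (U.pro P)).symm)))
        (E.vcomp (F.cell (U.laxComp hF (E.hcomp M N) P)) (U.counitPro _))) (E.assoc M N P) := by
    rw [F.cell_vcomp, F.cell_vcomp, E.vcomp_assoc, E.vcomp_assoc, U.mapCell_fac, E.vcomp_assoc,
      E.vcomp_assoc]
  -- The left side collapses to the composite of the three counits followed by the associator;
  -- naturality then moves the associator to the front.
  rw [e₁, ← E.vcomp_assoc (F.laxComp _ _), U.hcompCell_laxComp_fac hF _ _ _ h₁,
    ← E.hcompCell_vcomp, ← E.vcomp_assoc (E.hcompCell _ _ _),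
    DoubleCat.hcompCell_vcomp' _ _ _ _ _ _ (U.laxComp_fac hF M N)
      (by rw [E.vid_vcomp, F.cell_vid, E.vid_vcomp])
      ((E.tgt_hcompCell _ _ _).trans (U.counit_tgt_eq_src N P)),
    E.assoc_naturality _ _ _ _ (U.counit_tgt_eq_src N P)]
  -- On the right side, the associativity law of `F` brings out the associator of `E`, and the
  -- remaining factors collapse to counits in the same way.
  rw [F.cell_vcomp, E.vcomp_assoc, ← E.vcomp_assoc (F.laxComp _ _) (F.cell _),
    ← E.vcomp_assoc (E.hcompCell _ _ _), F.laxComp_assoc, E.vcomp_assoc, E.vcomp_assoc,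
    F.cell_vcomp, E.vcomp_assoc (F.cell _), U.hcompCell_laxComp_fac hF _ _ _ h₂,
    ← E.hcompCell_vcomp]
  rw [DoubleCat.hcompCell_vcomp' _ _ _ _ _ _
      (by rw [E.vid_vcomp, F.cell_vid, E.vid_vcomp]) (U.laxComp_fac hF N P)
      ((U.counit_tgt_eq_src M N).trans (E.src_hcompCell _ _ _).symm)]

theorem laxComp_lunit {X Y : E.Obj} (M : E.Pro X Y) :
    D.vcomp
      (D.hcompCell (U.laxUnit hF X) (D.vid (U.pro M))
        ((U.tgt_laxUnit hF X).trans (D.src_vid (U.pro M)).symm))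
      (D.vcomp (U.laxComp hF (E.hid X) M) (U.mapCell (E.lunit M))) = D.lunit (U.pro M) := by
  apply U.cell_ext
  apply (hF.1 _ _).vcomp_left_cancel
  apply ((hF.2 (U.obj X)).hcompCell_vid (F.tgt_laxUnit _) (F.pro (U.pro M))
    ((F.tgt_laxUnit _).trans (E.src_vid _).symm)).vcomp_left_cancel
  have h₁ : E.tgt (F.cell (U.laxUnit hF X)) = E.src (F.cell (D.vid (U.pro M))) := by
    rw [F.tgt_cell, F.src_cell, U.tgt_laxUnit, D.src_vid]
  -- The unit law of `F` turns the right side into the left unitor followed by the counit. The left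
  -- side becomes the counit whiskered with an identity, followed by the unitor, so naturality of
  -- the unitor concludes.
  rw [← E.vcomp_assoc (F.laxComp _ _) (F.cell (D.lunit _)),
    ← E.vcomp_assoc (E.hcompCell _ _ _) (E.vcomp _ (F.cell (D.lunit _))),
    F.laxComp_lunit, F.cell_vcomp, F.cell_vcomp, E.vcomp_assoc, E.vcomp_assoc, U.mapCell_fac,
    ← E.vcomp_assoc (F.cell (U.laxComp hF _ _)), ← E.vcomp_assoc (F.cell (D.hcompCell _ _ _)),
    ← E.vcomp_assoc (F.laxComp _ _), U.hcompCell_laxComp_fac hF _ _ _ h₁,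
    ← E.hcompCell_vcomp, ← E.vcomp_assoc (E.hcompCell _ _ _),
    DoubleCat.hcompCell_vcomp' _ _ _ _ _ _ (U.laxUnit_fac hF X)
      (by rw [E.vid_vcomp, F.cell_vid, E.vid_vcomp])
      ((E.tgt_hidMap _).trans (U.src_counitPro M).symm), ← E.lunit_naturality]
  exact congrArg (fun t => E.vcomp t _)
    (E.hcompCell_congr (congrArg E.hidMap (U.src_counitPro M).symm) rfl _ _)

theorem laxComp_runit {X Y : E.Obj} (M : E.Pro X Y) :
    D.vcomp
      (D.hcompCell (D.vid (U.pro M)) (U.laxUnit hF Y)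
        ((D.tgt_vid (U.pro M)).trans (U.src_laxUnit hF Y).symm))
      (D.vcomp (U.laxComp hF M (E.hid Y)) (U.mapCell (E.runit M))) = D.runit (U.pro M) := by
  apply U.cell_ext
  apply (hF.1 _ _).vcomp_left_cancel
  apply ((hF.2 (U.obj Y)).vid_hcompCell (F.src_laxUnit _) (F.pro (U.pro M))
    ((E.tgt_vid _).trans (F.src_laxUnit _).symm)).vcomp_left_cancel
  have h₁ : E.tgt (F.cell (D.vid (U.pro M))) = E.src (F.cell (U.laxUnit hF Y)) := by
    rw [F.tgt_cell, F.src_cell, U.src_laxUnit, D.tgt_vid]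
  rw [← E.vcomp_assoc (F.laxComp _ _) (F.cell (D.runit _)),
    ← E.vcomp_assoc (E.hcompCell _ _ _) (E.vcomp _ (F.cell (D.runit _))),
    F.laxComp_runit, F.cell_vcomp, F.cell_vcomp, E.vcomp_assoc, E.vcomp_assoc, U.mapCell_fac,
    ← E.vcomp_assoc (F.cell (U.laxComp hF _ _)), ← E.vcomp_assoc (F.cell (D.hcompCell _ _ _)),
    ← E.vcomp_assoc (F.laxComp _ _), U.hcompCell_laxComp_fac hF _ _ _ h₁,
    ← E.hcompCell_vcomp, ← E.vcomp_assoc (E.hcompCell _ _ _),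
    DoubleCat.hcompCell_vcomp' _ _ _ _ _ _
      (by rw [E.vid_vcomp, F.cell_vid, E.vid_vcomp]) (U.laxUnit_fac hF Y)
      ((U.tgt_counitPro M).trans (E.src_hidMap _).symm), ← E.runit_naturality]
  exact congrArg (fun t => E.vcomp t _)
    (E.hcompCell_congr rfl (congrArg E.hidMap (U.tgt_counitPro M).symm) _ _)

/-- The action of the right adjoint on arrows. -/
def mapHom {X Y : E.Obj} (f : X ⟶ Y) : U.obj X ⟶ U.obj Y :=
  U.lift (U.counit X ≫ f)

theorem mapHom_fac {X Y : E.Obj} (f : X ⟶ Y) :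
    F.map (U.mapHom f) ≫ U.counit Y = U.counit X ≫ f :=
  U.fac _

theorem mapHom_comp {X Y Z : E.Obj} (f : X ⟶ Y) (g : Y ⟶ Z) :
    U.mapHom (f ≫ g) = U.mapHom f ≫ U.mapHom g :=
  U.hom_ext (by
    rw [U.mapHom_fac, F.map_comp, Category.assoc (F.map (U.mapHom f)), U.mapHom_fac,
      ← Category.assoc, ← Category.assoc, U.mapHom_fac])

theorem mapHom_id (X : E.Obj) : U.mapHom (𝟙 X) = 𝟙 (U.obj X) := by
  rw [mapHom, Category.comp_id, U.lift_counit]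

theorem mapCell_vid {X Y : E.Obj} (M : E.Pro X Y) : U.mapCell (E.vid M) = D.vid (U.pro M) :=
  U.cell_ext (by rw [U.mapCell_fac, E.vcomp_vid, F.cell_vid, E.vid_vcomp])

theorem mapCell_vcomp {X Y X' Y' X'' Y'' : E.Obj} {M : E.Pro X Y} {N : E.Pro X' Y'}
    {P : E.Pro X'' Y''} (α : E.Cell M N) (β : E.Cell N P) :
    U.mapCell (E.vcomp α β) = D.vcomp (U.mapCell α) (U.mapCell β) :=
  U.cell_ext (by
    rw [U.mapCell_fac, F.cell_vcomp, E.vcomp_assoc (F.cell (U.mapCell α)), U.mapCell_fac,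
      ← E.vcomp_assoc, ← E.vcomp_assoc, U.mapCell_fac])

/-- The lax right adjoint of a pseudo double functor given by universal arrows. -/
noncomputable def rightAdjoint : LaxDoubleFunctor E D where
  obj X := U.obj X
  map f := U.mapHom f
  map_id X := U.mapHom_id X
  map_comp f g := U.mapHom_comp f g
  pro M := U.pro M
  cell α := U.mapCell α
  src_cell α := U.src_mapCell α
  tgt_cell α := U.tgt_mapCell α
  cell_vid M := U.mapCell_vid M
  cell_vcomp α β := U.mapCell_vcomp α β
  laxComp M N := U.laxComp hF M N
  src_laxComp M N := U.src_laxComp hF M N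
  tgt_laxComp M N := U.tgt_laxComp hF M N
  laxUnit X := U.laxUnit hF X
  src_laxUnit X := U.src_laxUnit hF X
  tgt_laxUnit X := U.tgt_laxUnit hF X
  laxComp_naturality α β h := U.laxComp_naturality hF α β h _
  laxUnit_naturality f := U.laxUnit_naturality hF f
  laxComp_assoc M N P := U.laxComp_assoc hF M N P
  laxComp_lunit M := U.laxComp_lunit hF M
  laxComp_runit M := U.laxComp_runit hF M

/-- The components of the unit at objects. -/
def unitApp (x : D.Obj) : x ⟶ U.obj (F.obj x) :=
  U.lift (𝟙 (F.obj x))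

/-- The components of the unit at proarrows. -/
def unitAppPro {x y : D.Obj} (m : D.Pro x y) : D.Cell m (U.pro (F.pro m)) :=
  U.liftCell (E.vid (F.pro m))

theorem unitApp_fac (x : D.Obj) : F.map (U.unitApp x) ≫ U.counit (F.obj x) = 𝟙 (F.obj x) :=
  U.fac _

theorem unitAppPro_fac {x y : D.Obj} (m : D.Pro x y) :
    E.vcomp (F.cell (U.unitAppPro m)) (U.counitPro (F.pro m)) = E.vid (F.pro m) :=
  U.facCell _

theorem src_unitAppPro {x y : D.Obj} (m : D.Pro x y) : D.src (U.unitAppPro m) = U.unitApp x := by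
  rw [unitAppPro, U.src_liftCell, E.src_vid, unitApp]

theorem tgt_unitAppPro {x y : D.Obj} (m : D.Pro x y) : D.tgt (U.unitAppPro m) = U.unitApp y := by
  rw [unitAppPro, U.tgt_liftCell, E.tgt_vid, unitApp]

theorem unitApp_naturality {x y : D.Obj} (f : x ⟶ y) :
    f ≫ U.unitApp y = U.unitApp x ≫ U.mapHom (F.map f) :=
  U.hom_ext (by
    rw [F.map_comp, F.map_comp, Category.assoc, U.unitApp_fac, Category.assoc, U.mapHom_fac,
      ← Category.assoc, U.unitApp_fac, Category.id_comp, Category.comp_id])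

theorem unitAppPro_naturality {x y x' y' : D.Obj} {m : D.Pro x y} {n : D.Pro x' y'}
    (α : D.Cell m n) :
    D.vcomp α (U.unitAppPro n) = D.vcomp (U.unitAppPro m) (U.mapCell (F.cell α)) :=
  U.cell_ext (by
    rw [F.cell_vcomp, F.cell_vcomp, E.vcomp_assoc, U.unitAppPro_fac, E.vcomp_assoc, U.mapCell_fac,
      ← E.vcomp_assoc, U.unitAppPro_fac, E.vid_vcomp, E.vcomp_vid])

/-- Transposed and precomposed with `F.laxComp m n`, both sides become `F.laxComp m n` itself,
because the unit composed with the counit is an identity. -/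
theorem unitAppPro_hcomp {x y z : D.Obj} (m : D.Pro x y) (n : D.Pro y z) :
    U.unitAppPro (D.hcomp m n) =
      D.vcomp (D.hcompCell (U.unitAppPro m) (U.unitAppPro n)
        ((U.tgt_unitAppPro m).trans (U.src_unitAppPro n).symm))
      (D.vcomp (U.laxComp hF (F.pro m) (F.pro n)) (U.mapCell (F.laxComp m n))) := by
  apply U.cell_ext
  apply (hF.1 m n).vcomp_left_cancel
  have h : D.tgt (U.unitAppPro m) = D.src (U.unitAppPro n) :=
    (U.tgt_unitAppPro m).trans (U.src_unitAppPro n).symm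
  have h' : E.tgt (F.cell (U.unitAppPro m)) = E.src (F.cell (U.unitAppPro n)) := by
    rw [F.tgt_cell, F.src_cell, h]
  rw [U.unitAppPro_fac, F.cell_vcomp, F.cell_vcomp, E.vcomp_assoc, E.vcomp_assoc,
    U.mapCell_fac, ← E.vcomp_assoc (F.cell (U.laxComp hF _ _)),
    ← E.vcomp_assoc (F.cell (D.hcompCell _ _ _)), ← E.vcomp_assoc (F.laxComp _ _),
    U.hcompCell_laxComp_fac hF _ _ _ h',
    DoubleCat.hcompCell_vcomp' _ _ _ _ _ _ (U.unitAppPro_fac _) (U.unitAppPro_fac _)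
      ((E.tgt_vid _).trans (E.src_vid _).symm), E.hcompCell_vid, E.vid_vcomp, E.vcomp_vid]

theorem unitAppPro_hid (x : D.Obj) :
    U.unitAppPro (D.hid x) =
      D.vcomp (D.hidMap (U.unitApp x))
        (D.vcomp (U.laxUnit hF (F.obj x)) (U.mapCell (F.laxUnit x))) := by
  apply U.cell_ext
  apply (hF.2 x).vcomp_left_cancel
  rw [U.unitAppPro_fac, F.cell_vcomp, F.cell_vcomp, E.vcomp_assoc, E.vcomp_assoc,
    U.mapCell_fac, ← E.vcomp_assoc (F.cell (U.laxUnit hF _)),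
    ← E.vcomp_assoc (F.cell (D.hidMap _)), ← E.vcomp_assoc (F.laxUnit _),
    ← E.vcomp_assoc (F.laxUnit _), ← F.laxUnit_naturality, E.vcomp_assoc (E.hidMap _),
    U.laxUnit_fac, ← E.hidMap_comp, U.unitApp_fac, E.hidMap_id, E.vid_vcomp, E.vcomp_vid]

theorem rightAdjoint_map_counit (X : E.Obj) :
    U.unitApp (U.obj X) ≫ U.mapHom (U.counit X) = 𝟙 (U.obj X) :=
  U.hom_ext (by
    rw [F.map_comp, Category.assoc, U.mapHom_fac, ← Category.assoc, U.unitApp_fac, F.map_id])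

theorem rightAdjoint_cell_counitPro {X Y : E.Obj} (M : E.Pro X Y) :
    D.vcomp (U.unitAppPro (U.pro M)) (U.mapCell (U.counitPro M)) = D.vid (U.pro M) :=
  U.cell_ext (by
    rw [F.cell_vcomp, E.vcomp_assoc, U.mapCell_fac, ← E.vcomp_assoc, U.unitAppPro_fac,
      F.cell_vid])

theorem counitPro_hcomp {X Y Z : E.Obj} (M : E.Pro X Y) (N : E.Pro Y Z) :
    E.vcomp (E.vcomp (F.laxComp (U.pro M) (U.pro N)) (F.cell (U.laxComp hF M N)))
      (U.counitPro (E.hcomp M N)) =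
    E.vcomp (E.hcompCell (U.counitPro M) (U.counitPro N) (U.counit_tgt_eq_src M N))
      (E.vid _) := by
  rw [E.vcomp_assoc, U.laxComp_fac, E.vcomp_vid]

theorem counitPro_hid (X : E.Obj) :
    E.vcomp (E.vcomp (F.laxUnit (U.obj X)) (F.cell (U.laxUnit hF X))) (U.counitPro (E.hid X)) =
      E.vcomp (E.hidMap (U.counit X)) (E.vid _) := by
  rw [E.vcomp_assoc, U.laxUnit_fac, E.vcomp_vid]

/-- The adjunction given by universal arrows. -/
noncomputable def adjunction : DoubleAdjunction F (U.rightAdjoint hF) where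
  unit :=
    { app := fun x => U.unitApp x
      appPro := fun m => U.unitAppPro m
      src_appPro := fun m => U.src_unitAppPro m
      tgt_appPro := fun m => U.tgt_unitAppPro m
      naturality := fun f => U.unitApp_naturality f
      naturality_cell := fun α => U.unitAppPro_naturality α
      laxComp_appPro := fun m n => (D.vid_vcomp _).trans (U.unitAppPro_hcomp hF m n)
      laxUnit_appPro := fun x => (D.vid_vcomp _).trans (U.unitAppPro_hid hF x) }
  counit :=
    { app := fun X => U.counit X
      appPro := fun M => U.counitPro M
      src_appPro := fun M => U.src_counitPro M
      tgt_appPro := fun M => U.tgt_counitPro M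
      naturality := fun f => U.mapHom_fac f
      naturality_cell := fun α => U.mapCell_fac α
      laxComp_appPro := fun M N => U.counitPro_hcomp hF M N
      laxUnit_appPro := fun X => U.counitPro_hid hF X }
  left_triangle x := U.unitApp_fac x
  left_triangle_pro m := U.unitAppPro_fac m
  right_triangle X := U.rightAdjoint_map_counit X
  right_triangle_pro M := U.rightAdjoint_cell_counitPro M

/-- The comparison cell for composites of the right adjoint is invertible if a composite of chosen
proarrows has the universal property of the proarrow chosen for the composite. -/
theorem isInvertible_laxComp {X Y Z : E.Obj} (M : E.Pro X Y) (N : E.Pro Y Z)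
    (inj : ∀ β β' : D.Cell (D.hcomp (U.pro M) (U.pro N)) (D.hcomp (U.pro M) (U.pro N)),
      (∀ κ : E.Cell (F.pro (D.hcomp (U.pro M) (U.pro N))) (E.hcomp M N),
        E.vcomp (F.laxComp (U.pro M) (U.pro N)) κ =
          E.hcompCell (U.counitPro M) (U.counitPro N) (U.counit_tgt_eq_src M N) →
        E.vcomp (F.cell β) κ = E.vcomp (F.cell β') κ) → β = β')
    (surj : ∃ γ : D.Cell (U.pro (E.hcomp M N)) (D.hcomp (U.pro M) (U.pro N)),
      ∀ κ : E.Cell (F.pro (D.hcomp (U.pro M) (U.pro N))) (E.hcomp M N),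
        E.vcomp (F.laxComp (U.pro M) (U.pro N)) κ =
          E.hcompCell (U.counitPro M) (U.counitPro N) (U.counit_tgt_eq_src M N) →
        E.vcomp (F.cell γ) κ = U.counitPro (E.hcomp M N)) :
    D.IsInvertible (U.laxComp hF M N) := by
  obtain ⟨γ, hγ⟩ := surj
  -- The comparison cell in `E` is here the transpose of `laxComp`. Every other solution of its
  -- equation agrees with this one, by cancellation of `F.laxComp`.
  have hγ' := hγ _ (U.laxComp_fac hF M N)
  refine ⟨γ, inj _ _ fun κ hκ => ?_, U.cell_ext ?_⟩
  · rw [F.cell_vcomp, E.vcomp_assoc, hγ κ hκ, F.cell_vid, E.vid_vcomp]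
    exact (hF.1 _ _).vcomp_left_cancel ((U.laxComp_fac hF M N).trans hκ.symm)
  · rw [F.cell_vcomp, E.vcomp_assoc, hγ', F.cell_vid, E.vid_vcomp]

/-- The comparison cell for identities of the right adjoint is invertible if the identity on a
chosen object has the universal property of the proarrow chosen for the identity. -/
theorem isInvertible_laxUnit (X : E.Obj)
    (inj : ∀ β β' : D.Cell (D.hid (U.obj X)) (D.hid (U.obj X)),
      (∀ κ : E.Cell (F.pro (D.hid (U.obj X))) (E.hid X),
        E.vcomp (F.laxUnit (U.obj X)) κ = E.hidMap (U.counit X) →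
        E.vcomp (F.cell β) κ = E.vcomp (F.cell β') κ) → β = β')
    (surj : ∃ γ : D.Cell (U.pro (E.hid X)) (D.hid (U.obj X)),
      ∀ κ : E.Cell (F.pro (D.hid (U.obj X))) (E.hid X),
        E.vcomp (F.laxUnit (U.obj X)) κ = E.hidMap (U.counit X) →
        E.vcomp (F.cell γ) κ = U.counitPro (E.hid X)) :
    D.IsInvertible (U.laxUnit hF X) := by
  obtain ⟨γ, hγ⟩ := surj
  have hγ' := hγ _ (U.laxUnit_fac hF X)
  refine ⟨γ, inj _ _ fun κ hκ => ?_, U.cell_ext ?_⟩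
  · rw [F.cell_vcomp, E.vcomp_assoc, hγ κ hκ, F.cell_vid, E.vid_vcomp]
    exact (hF.2 _).vcomp_left_cancel ((U.laxUnit_fac hF X).trans hκ.symm)
  · rw [F.cell_vcomp, E.vcomp_assoc, hγ', F.cell_vid, E.vid_vcomp]

end UniversalArrows

/-! ### The singleton embedding, and cones over families. -/

namespace DoubleCat

variable {D : DoubleCat.{u, v, w, c}}

/-- The embedding of a double category into its finite families is pseudo. -/
theorem singleton_isPseudo (D : DoubleCat.{u, v, w, c}) : D.singleton.IsPseudo := by
  refine ⟨fun {x y z} m n => ⟨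
    { src := FinFam.Hom.id _
      tgt := FinFam.Hom.id _
      base := fun _ => ()
      l_base := fun _ => rfl
      r_base := fun _ => rfl
      cell := fun _ _ _ _ _ => D.vid (D.hcomp m n)
      src_cell := fun _ _ _ _ _ => D.src_vid _
      tgt_cell := fun _ _ _ _ _ => D.tgt_vid _ }, ?_, ?_⟩, fun x => ⟨
    { src := FinFam.Hom.id _
      tgt := FinFam.Hom.id _
      base := fun _ => ()
      l_base := fun _ => rfl
      r_base := fun _ => rfl
      cell := fun _ _ _ _ _ => D.vid (D.hid x)
      src_cell := fun _ _ _ _ _ => D.src_vid _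
      tgt_cell := fun _ _ _ _ _ => D.tgt_vid _ }, ?_, ?_⟩⟩
  · exact FinFam.Cell.ext' (FinFam.Hom.id_comp _) (FinFam.Hom.id_comp _) (fun _ => rfl)
      fun _ _ _ _ b _ _ _ _ _ _ => heq_of_eq (D.vid_vcomp _)
  · exact FinFam.Cell.ext' (FinFam.Hom.id_comp _) (FinFam.Hom.id_comp _) (fun _ => rfl)
      fun _ _ _ _ b _ _ _ _ _ _ => heq_of_eq (D.vid_vcomp _)
  · exact FinFam.Cell.ext' (FinFam.Hom.id_comp _) (FinFam.Hom.id_comp _) (fun _ => rfl)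
      fun _ _ _ _ b _ _ _ _ _ _ => heq_of_eq (D.vid_vcomp _)
  · exact FinFam.Cell.ext' (FinFam.Hom.id_comp _) (FinFam.Hom.id_comp _) (fun _ => rfl)
      fun _ _ _ _ b _ _ _ _ _ _ => heq_of_eq (D.vid_vcomp _)

end DoubleCat

namespace FinFam

variable {D : DoubleCat.{u, v, w, c}}

/-- An arrow from a singleton family to a family, as a cone. -/
def Hom.ofCone {a : D.Obj} {X : FinFam D} (f : ∀ i, a ⟶ X.obj i) : D.singleton.obj a ⟶ X :=
  { base := fun _ => (), hom := fun {_ j} _ => f j : Hom (D.singleton.obj a) X }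

/-- The components of an arrow from a singleton family. -/
def Hom.cone {a : D.Obj} {X : FinFam D} (f : D.singleton.obj a ⟶ X) (j : X.I) : a ⟶ X.obj j :=
  Hom.hom (X := D.singleton.obj a) (i := ()) (j := j) f rfl

theorem Hom.cone_ext {a : D.Obj} {X : FinFam D} {f g : D.singleton.obj a ⟶ X}
    (h : ∀ j, Hom.cone f j = Hom.cone g j) : f = g :=
  Hom.ext' (funext fun _ => rfl) fun _ j _ _ => h j

/-- A cell from a singleton proarrow to a family of proarrows, as a cone. -/
def Cell.ofCone {a b : D.Obj} {p : D.Pro a b} {X Y : FinFam D} {M : Pro X Y}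
    (f : ∀ i, a ⟶ X.obj i) (g : ∀ j, b ⟶ Y.obj j)
    (κ : ∀ a, D.Cell p (M.pro a rfl rfl)) (hs : ∀ a, D.src (κ a) = f (M.l a))
    (ht : ∀ a, D.tgt (κ a) = g (M.r a)) : D.finFamOp.Cell (D.singleton.pro p) M :=
  { src := Hom.ofCone f
    tgt := Hom.ofCone g
    base := fun _ => ()
    l_base := fun _ => rfl
    r_base := fun _ => rfl
    cell := fun a _ _ hk hl => by
      subst hk hl
      exact κ a
    src_cell := fun a _ _ hk hl => by
      subst hk hl
      exact hs a
    tgt_cell := fun a _ _ hk hl => by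
      subst hk hl
      exact ht a : Cell (D.singleton.pro p) M }

/-- The components of a cell from a singleton proarrow. -/
def Cell.cone {a b : D.Obj} {p : D.Pro a b} {X Y : FinFam D} {M : Pro X Y}
    (α : D.finFamOp.Cell (D.singleton.pro p) M) (c : M.A) {k : X.I} {l : Y.I} (hk : M.l c = k)
    (hl : M.r c = l) : D.Cell p (M.pro c hk hl) :=
  Cell.cell (M := D.singleton.pro p) (i := ()) (j := ()) α c rfl rfl hk hl

theorem Cell.src_cone {a b : D.Obj} {p : D.Pro a b} {X Y : FinFam D} {M : Pro X Y}
    (α : D.finFamOp.Cell (D.singleton.pro p) M) (c : M.A) {k : X.I} {l : Y.I} (hk : M.l c = k)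
    (hl : M.r c = l) : D.src (Cell.cone α c hk hl) = Hom.cone (D.finFamOp.src α) k :=
  Cell.src_cell (M := D.singleton.pro p) (i := ()) (j := ()) α c rfl rfl hk hl

theorem Cell.tgt_cone {a b : D.Obj} {p : D.Pro a b} {X Y : FinFam D} {M : Pro X Y}
    (α : D.finFamOp.Cell (D.singleton.pro p) M) (c : M.A) {k : X.I} {l : Y.I} (hk : M.l c = k)
    (hl : M.r c = l) : D.tgt (Cell.cone α c hk hl) = Hom.cone (D.finFamOp.tgt α) l :=
  Cell.tgt_cell (M := D.singleton.pro p) (i := ()) (j := ()) α c rfl rfl hk hl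

theorem Cell.cone_ext {a b : D.Obj} {p : D.Pro a b} {X Y : FinFam D} {M : Pro X Y}
    {α β : D.finFamOp.Cell (D.singleton.pro p) M} (hs : D.finFamOp.src α = D.finFamOp.src β)
    (ht : D.finFamOp.tgt α = D.finFamOp.tgt β)
    (h : ∀ c, Cell.cone α c rfl rfl = Cell.cone β c rfl rfl) : α = β :=
  Cell.ext' hs ht (fun _ => rfl) fun _ _ _ _ c _ _ _ _ hk hl => by
    subst hk hl
    exact heq_of_eq (h c)

/-- The components of a cell out of the singleton proarrow on a composite, which is determined by
a pair of cells out of singleton proarrows. -/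
theorem Cell.cone_of_laxComp_vcomp {a b d : D.Obj} {p : D.Pro a b} {q : D.Pro b d}
    {X Y Z : FinFam D} {M : Pro X Y} {N : Pro Y Z}
    {κ : D.finFamOp.Cell (D.singleton.pro (D.hcomp p q)) (hcomp M N)}
    {α : D.finFamOp.Cell (D.singleton.pro p) M} {β : D.finFamOp.Cell (D.singleton.pro q) N}
    {h : D.finFamOp.tgt α = D.finFamOp.src β}
    (e : D.finFamOp.vcomp (D.singleton.laxComp p q) κ = D.finFamOp.hcompCell α β h)
    (s : M.A) (t : N.A) (hst : M.r s = N.l t)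
    (h' : D.tgt (Cell.cone α s rfl rfl) = D.src (Cell.cone β t hst.symm rfl)) :
    Cell.cone κ (⟨(s, t), hst⟩ : (hcomp M N).A) rfl rfl =
      D.hcompCell (Cell.cone α s rfl rfl) (Cell.cone β t hst.symm rfl) h' := by
  -- The types of the components of a cell depend on its map of apexes. With the right-hand cell
  -- generalized to a variable, the equation can be substituted and no transport is needed.
  have key : ∀ {κ' : Cell (hcomp (D.singleton.pro p) (D.singleton.pro q)) (hcomp M N)},
      vcomp (D.singleton.laxComp p q) κ = κ' →
      D.vcomp (D.vid _) (Cell.cone κ (⟨(s, t), hst⟩ : (hcomp M N).A) rfl rfl) =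
        κ'.cell (i := ()) (j := ()) (⟨(s, t), hst⟩ : (hcomp M N).A) rfl rfl rfl rfl := by
    intro κ' e
    subst e
    rfl
  rw [D.vid_vcomp] at key
  exact key e

theorem Cell.cone_of_laxUnit_vcomp {a : D.Obj} {X : FinFam D}
    {κ : D.finFamOp.Cell (D.singleton.pro (D.hid a)) (hid X)} {f : D.singleton.obj a ⟶ X}
    (e : D.finFamOp.vcomp (D.singleton.laxUnit a) κ = D.finFamOp.hidMap f) (i : X.I) :
    Cell.cone κ (M := hid X) i rfl rfl = D.hidMap (Hom.cone f i) := by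
  have key : ∀ {κ' : Cell (hid (D.singleton.obj a)) (hid X)},
      vcomp (D.singleton.laxUnit a) κ = κ' →
      D.vcomp (D.vid _) (Cell.cone κ (M := hid X) i rfl rfl) =
        κ'.cell (i := ()) (j := ()) i rfl rfl rfl rfl := by
    intro κ' e
    subst e
    rfl
  rw [D.vid_vcomp] at key
  exact key e

end FinFam

/-! ### Products of families, componentwise. -/

/-- Products of finite families of objects, and of finite families of proarrows indexed by spans, in
terms of components. -/
structure FamilyProducts (D : DoubleCat.{u, v, w, c}) where
  obj : FinFam D → D.Obj
  proj : ∀ (X : FinFam D) (i : X.I), obj X ⟶ X.obj i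
  lift : ∀ {X : FinFam D} {a : D.Obj}, (∀ i, a ⟶ X.obj i) → (a ⟶ obj X)
  lift_proj : ∀ {X : FinFam D} {a : D.Obj} (f : ∀ i, a ⟶ X.obj i) (i : X.I),
    lift f ≫ proj X i = f i
  hom_ext : ∀ {X : FinFam D} {a : D.Obj} {f g : a ⟶ obj X},
    (∀ i, f ≫ proj X i = g ≫ proj X i) → f = g
  pro : ∀ {X Y : FinFam D}, FinFam.Pro X Y → D.Pro (obj X) (obj Y)
  projPro : ∀ {X Y : FinFam D} (M : FinFam.Pro X Y) (a : M.A), D.Cell (pro M) (M.pro a rfl rfl)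
  src_projPro : ∀ {X Y : FinFam D} (M : FinFam.Pro X Y) (a : M.A),
    D.src (projPro M a) = proj X (M.l a)
  tgt_projPro : ∀ {X Y : FinFam D} (M : FinFam.Pro X Y) (a : M.A),
    D.tgt (projPro M a) = proj Y (M.r a)
  -- The boundaries are prescribed separately: the legs of the span need not be surjective, so the
  -- component cells do not determine them.
  exists_lift : ∀ {X Y : FinFam D} (M : FinFam.Pro X Y) {s t : D.Obj} (p : D.Pro s t)
    (f : s ⟶ obj X) (g : t ⟶ obj Y) (κ : ∀ a, D.Cell p (M.pro a rfl rfl)),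
    (∀ a, D.src (κ a) = f ≫ proj X (M.l a)) → (∀ a, D.tgt (κ a) = g ≫ proj Y (M.r a)) →
    ∃ β : D.Cell p (pro M), D.src β = f ∧ D.tgt β = g ∧ ∀ a, D.vcomp β (projPro M a) = κ a
  cell_ext : ∀ {X Y : FinFam D} {M : FinFam.Pro X Y} {s t : D.Obj} {p : D.Pro s t}
    {β β' : D.Cell p (pro M)}, D.src β = D.src β' → D.tgt β = D.tgt β' →
    (∀ a, D.vcomp β (projPro M a) = D.vcomp β' (projPro M a)) → β = β'

namespace FamilyProducts

variable {D : DoubleCat.{u, v, w, c}} (P : FamilyProducts D)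

/-- The projections of a product of proarrows, with any names for the indices. -/
def projPro' {X Y : FinFam D} (M : FinFam.Pro X Y) (a : M.A) {k : X.I} {l : Y.I} (hk : M.l a = k)
    (hl : M.r a = l) : D.Cell (P.pro M) (M.pro a hk hl) := by
  subst hk hl
  exact P.projPro M a

theorem src_projPro' {X Y : FinFam D} (M : FinFam.Pro X Y) (a : M.A) {k : X.I} {l : Y.I}
    (hk : M.l a = k) (hl : M.r a = l) : D.src (P.projPro' M a hk hl) = P.proj X k := by
  subst hk hl
  exact P.src_projPro M a

theorem tgt_projPro' {X Y : FinFam D} (M : FinFam.Pro X Y) (a : M.A) {k : X.I} {l : Y.I}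
    (hk : M.l a = k) (hl : M.r a = l) : D.tgt (P.projPro' M a hk hl) = P.proj Y l := by
  subst hk hl
  exact P.tgt_projPro M a

/-- The universal cell from a product of proarrows. -/
def counitPro {X Y : FinFam D} (M : FinFam.Pro X Y) :
    D.finFamOp.Cell (D.singleton.pro (P.pro M)) M :=
  FinFam.Cell.ofCone (P.proj X) (P.proj Y) (P.projPro M) (P.src_projPro M) (P.tgt_projPro M)

theorem cone_counitPro {X Y : FinFam D} (M : FinFam.Pro X Y) (a : M.A) {k : X.I} {l : Y.I}
    (hk : M.l a = k) (hl : M.r a = l) :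
    FinFam.Cell.cone (P.counitPro M) a hk hl = P.projPro' M a hk hl := by
  subst hk hl
  rfl

/-- A cell out of a singleton consists of its two boundary cones and its component cells. The
boundary cones are lifted to arrows, and the component cells are then lifted over these arrows. -/
theorem exists_liftCell {s t : D.Obj} {p : D.Pro s t} {X Y : FinFam D} {M : FinFam.Pro X Y}
    (α : D.finFamOp.Cell (D.singleton.pro p) M) : ∃ β : D.Cell p (P.pro M),
      D.finFamOp.vcomp (D.singleton.cell β) (P.counitPro M) = α := by
  obtain ⟨β, hs, ht, h⟩ := P.exists_lift M p
    (P.lift (FinFam.Hom.cone (D.finFamOp.src α))) (P.lift (FinFam.Hom.cone (D.finFamOp.tgt α)))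
    (fun a => FinFam.Cell.cone α a rfl rfl)
    (fun a => (FinFam.Cell.src_cone α a rfl rfl).trans (P.lift_proj _ _).symm)
    (fun a => (FinFam.Cell.tgt_cone α a rfl rfl).trans (P.lift_proj _ _).symm)
  refine ⟨β, FinFam.Cell.cone_ext ?_ ?_ fun a => (h a :)⟩
  · refine FinFam.Hom.cone_ext fun i => ?_
    change D.src β ≫ P.proj X i = _
    rw [hs, P.lift_proj]
  · refine FinFam.Hom.cone_ext fun i => ?_
    change D.tgt β ≫ P.proj Y i = _
    rw [ht, P.lift_proj]

/-- The universal arrows from the embedding into finite families given by products. -/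
noncomputable def universalArrows : UniversalArrows D.singleton where
  obj X := P.obj X
  counit X := FinFam.Hom.ofCone (P.proj X)
  lift f := P.lift (FinFam.Hom.cone f)
  fac f := FinFam.Hom.cone_ext fun i => P.lift_proj (FinFam.Hom.cone f) i
  hom_ext h := P.hom_ext fun i => congrArg (fun t => FinFam.Hom.cone t i) h
  pro M := P.pro M
  counitPro M := P.counitPro M
  src_counitPro _ := rfl
  tgt_counitPro _ := rfl
  liftCell α := (P.exists_liftCell α).choose
  facCell α := (P.exists_liftCell α).choose_spec
  cell_ext h := P.cell_ext
    (P.hom_ext fun i => congrArg (fun t => FinFam.Hom.cone (D.finFamOp.src t) i) h)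
    (P.hom_ext fun i => congrArg (fun t => FinFam.Hom.cone (D.finFamOp.tgt t) i) h)
    fun a => congrArg (fun t => FinFam.Cell.cone t a rfl rfl) h

/-- The lax double functor of products. -/
noncomputable def functor : LaxDoubleFunctor D.finFamOp D :=
  P.universalArrows.rightAdjoint D.singleton_isPseudo

/-- Products are right adjoint to the embedding into finite families. -/
noncomputable def adjunction : DoubleAdjunction D.singleton P.functor :=
  P.universalArrows.adjunction D.singleton_isPseudo

/-- The composite of two projections of products of proarrows at a common middle index. -/
def projComp {X Y Z : FinFam D} (M : FinFam.Pro X Y) (N : FinFam.Pro Y Z) (a : M.A) (b : N.A)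
    {j : Y.I} (ha : M.r a = j) (hb : N.l b = j) :
    D.Cell (D.hcomp (P.pro M) (P.pro N)) (D.hcomp (M.pro a rfl ha) (N.pro b hb rfl)) :=
  D.hcompCell (P.projPro' M a rfl ha) (P.projPro' N b hb rfl)
    ((P.tgt_projPro' M a rfl ha).trans (P.src_projPro' N b hb rfl).symm)

/-- This is the universal criterion for invertibility read in components. Boundaries appear in both
hypotheses because the pullback of the spans may miss indices, or even be empty. -/
theorem isInvertible_laxComp {X Y Z : FinFam D} (M : FinFam.Pro X Y) (N : FinFam.Pro Y Z)
    (inj : ∀ β β' : D.Cell (D.hcomp (P.pro M) (P.pro N)) (D.hcomp (P.pro M) (P.pro N)),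
      D.src β = D.src β' → D.tgt β = D.tgt β' →
      (∀ a b (h : M.r a = N.l b), D.vcomp β (P.projComp M N a b h rfl) =
        D.vcomp β' (P.projComp M N a b h rfl)) → β = β')
    (surj : ∃ γ : D.Cell (P.pro (FinFam.hcomp M N)) (D.hcomp (P.pro M) (P.pro N)),
      D.src γ = 𝟙 _ ∧ D.tgt γ = 𝟙 _ ∧ ∀ a b (h : M.r a = N.l b),
        D.vcomp γ (P.projComp M N a b rfl h.symm) =
          P.projPro (FinFam.hcomp M N) ⟨(a, b), h⟩) :
    D.IsInvertible (P.functor.laxComp M N) := by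
  have hκ : ∀ κ : D.finFamOp.Cell (D.singleton.pro (D.hcomp (P.pro M) (P.pro N)))
      (FinFam.hcomp M N), D.finFamOp.vcomp (D.singleton.laxComp (P.pro M) (P.pro N)) κ =
        D.finFamOp.hcompCell (P.counitPro M) (P.counitPro N) rfl →
      ∀ a b (h : M.r a = N.l b),
        FinFam.Cell.cone κ (⟨(a, b), h⟩ : (FinFam.hcomp M N).A) rfl rfl =
          P.projComp M N a b rfl h.symm := by
    intro κ e a b h
    refine (FinFam.Cell.cone_of_laxComp_vcomp e a b h ?_).trans ?_
    · rw [FinFam.Cell.src_cone, FinFam.Cell.tgt_cone]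
      rfl
    · exact D.hcompCell_congr (P.cone_counitPro ..) (P.cone_counitPro ..) _ _
  have hs : ∀ κ : D.finFamOp.Cell (D.singleton.pro (D.hcomp (P.pro M) (P.pro N)))
      (FinFam.hcomp M N), D.finFamOp.vcomp (D.singleton.laxComp (P.pro M) (P.pro N)) κ =
        D.finFamOp.hcompCell (P.counitPro M) (P.counitPro N) rfl →
      (∀ i, FinFam.Hom.cone (D.finFamOp.src κ) i = P.proj X i) ∧
        ∀ i, FinFam.Hom.cone (D.finFamOp.tgt κ) i = P.proj Z i := by
    intro κ e
    constructor
    · exact fun i => congrArg (fun t => FinFam.Hom.cone t i)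
        ((FinFam.Hom.id_comp _).symm.trans (congrArg D.finFamOp.src e))
    · exact fun i => congrArg (fun t => FinFam.Hom.cone t i)
        ((FinFam.Hom.id_comp _).symm.trans (congrArg D.finFamOp.tgt e))
  apply P.universalArrows.isInvertible_laxComp D.singleton_isPseudo
  · intro β β' H
    obtain ⟨κ, e⟩ := P.universalArrows.exists_comparison D.singleton_isPseudo M N
    have H' := H κ e
    refine inj β β' (P.hom_ext fun i => ?_) (P.hom_ext fun i => ?_) fun a b h => ?_
    · have := congrArg (fun t => FinFam.Hom.cone (D.finFamOp.src t) i) H'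
      exact (congrArg (D.src β ≫ ·) ((hs κ e).1 i)).symm.trans
        (this.trans (congrArg (D.src β' ≫ ·) ((hs κ e).1 i)))
    · have := congrArg (fun t => FinFam.Hom.cone (D.finFamOp.tgt t) i) H'
      exact (congrArg (D.tgt β ≫ ·) ((hs κ e).2 i)).symm.trans
        (this.trans (congrArg (D.tgt β' ≫ ·) ((hs κ e).2 i)))
    · have key : ∀ (j : Y.I) (hj : N.l b = j) (hj' : M.r a = j),
          D.vcomp β (P.projComp M N a b rfl (hj.trans hj'.symm)) =
            D.vcomp β' (P.projComp M N a b rfl (hj.trans hj'.symm)) →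
          D.vcomp β (P.projComp M N a b hj' hj) = D.vcomp β' (P.projComp M N a b hj' hj) := by
        intro j hj hj'
        subst hj'
        exact fun t => t
      refine key _ rfl h ?_
      rw [← hκ κ e a b h]
      exact congrArg (fun t => FinFam.Cell.cone (M := FinFam.hcomp M N) t ⟨(a, b), h⟩ rfl rfl) H'
  · obtain ⟨γ, hγs, hγt, hγ⟩ := surj
    refine ⟨γ, fun κ e => FinFam.Cell.cone_ext ?_ ?_ ?_⟩
    · exact FinFam.Hom.cone_ext fun i =>
        (congrArg₂ (· ≫ ·) hγs ((hs κ e).1 i)).trans (Category.id_comp _)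
    · exact FinFam.Hom.cone_ext fun i =>
        (congrArg₂ (· ≫ ·) hγt ((hs κ e).2 i)).trans (Category.id_comp _)
    · rintro ⟨⟨a, b⟩, h⟩
      refine Eq.trans ?_ (hγ a b h)
      rw [← hκ κ e a b h]
      rfl

/-- Every index of `X` occurs in the identity span, so the components already determine the
boundaries and `inj` need not mention them. -/
theorem isInvertible_laxUnit (X : FinFam D)
    (inj : ∀ β β' : D.Cell (D.hid (P.obj X)) (D.hid (P.obj X)),
      (∀ i, D.vcomp β (D.hidMap (P.proj X i)) = D.vcomp β' (D.hidMap (P.proj X i))) → β = β')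
    (surj : ∃ γ : D.Cell (P.pro (FinFam.hid X)) (D.hid (P.obj X)),
      D.src γ = 𝟙 _ ∧ D.tgt γ = 𝟙 _ ∧ ∀ i, D.vcomp γ (D.hidMap (P.proj X i)) =
        P.projPro (FinFam.hid X) i) :
    D.IsInvertible (P.functor.laxUnit X) := by
  have hs : ∀ κ : D.finFamOp.Cell (D.singleton.pro (D.hid (P.obj X))) (FinFam.hid X),
      D.finFamOp.vcomp (D.singleton.laxUnit (P.obj X)) κ =
        D.finFamOp.hidMap (FinFam.Hom.ofCone (P.proj X)) →
      (∀ i, FinFam.Hom.cone (D.finFamOp.src κ) i = P.proj X i) ∧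
        ∀ i, FinFam.Hom.cone (D.finFamOp.tgt κ) i = P.proj X i := by
    intro κ e
    constructor
    · exact fun i => congrArg (fun t => FinFam.Hom.cone t i)
        ((FinFam.Hom.id_comp _).symm.trans (congrArg D.finFamOp.src e))
    · exact fun i => congrArg (fun t => FinFam.Hom.cone t i)
        ((FinFam.Hom.id_comp _).symm.trans (congrArg D.finFamOp.tgt e))
  apply P.universalArrows.isInvertible_laxUnit D.singleton_isPseudo
  · intro β β' H
    obtain ⟨κ, e⟩ := P.universalArrows.exists_unitComparison D.singleton_isPseudo X
    refine inj β β' fun i => ?_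
    have hκ : FinFam.Cell.cone κ (M := FinFam.hid X) i rfl rfl = D.hidMap (P.proj X i) :=
      FinFam.Cell.cone_of_laxUnit_vcomp e i
    rw [← hκ]
    exact congrArg (fun t => FinFam.Cell.cone (M := FinFam.hid X) t i rfl rfl) (H κ e)
  · obtain ⟨γ, hγs, hγt, hγ⟩ := surj
    refine ⟨γ, fun κ e => FinFam.Cell.cone_ext ?_ ?_ ?_⟩
    · exact FinFam.Hom.cone_ext fun i =>
        (congrArg₂ (· ≫ ·) hγs ((hs κ e).1 i)).trans (Category.id_comp _)
    · exact FinFam.Hom.cone_ext fun i =>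
        (congrArg₂ (· ≫ ·) hγt ((hs κ e).2 i)).trans (Category.id_comp _)
    · intro i
      have hκ : FinFam.Cell.cone κ (M := FinFam.hid X) i rfl rfl = D.hidMap (P.proj X i) :=
        FinFam.Cell.cone_of_laxUnit_vcomp e i
      refine Eq.trans ?_ (hγ i)
      rw [← hκ]
      rfl

end FamilyProducts

/-! ### Parallel products extracted from the diagonal adjunction. -/

/-- Products of `I`-indexed families of objects and of `I`-indexed families of proarrows, in terms of
components. -/
structure ParallelProducts (D : DoubleCat.{u, v, w, c}) (I : Type) where
  obj : (I → D.Obj) → D.Obj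
  proj : ∀ (x : I → D.Obj) (i : I), obj x ⟶ x i
  lift : ∀ {x : I → D.Obj} {a : D.Obj}, (∀ i, a ⟶ x i) → (a ⟶ obj x)
  lift_proj : ∀ {x : I → D.Obj} {a : D.Obj} (f : ∀ i, a ⟶ x i) (i : I), lift f ≫ proj x i = f i
  hom_ext : ∀ {x : I → D.Obj} {a : D.Obj} {f g : a ⟶ obj x},
    (∀ i, f ≫ proj x i = g ≫ proj x i) → f = g
  pro : ∀ {x y : I → D.Obj}, (∀ i, D.Pro (x i) (y i)) → D.Pro (obj x) (obj y)
  projPro : ∀ {x y : I → D.Obj} (m : ∀ i, D.Pro (x i) (y i)) (i : I), D.Cell (pro m) (m i)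
  src_projPro : ∀ {x y : I → D.Obj} (m : ∀ i, D.Pro (x i) (y i)) (i : I),
    D.src (projPro m i) = proj x i
  tgt_projPro : ∀ {x y : I → D.Obj} (m : ∀ i, D.Pro (x i) (y i)) (i : I),
    D.tgt (projPro m i) = proj y i
  -- In contrast to products indexed by spans, every object occurs at the boundary of some
  -- component, so the boundary of a lift is forced.
  exists_lift : ∀ {x y : I → D.Obj} (m : ∀ i, D.Pro (x i) (y i)) {a b : D.Obj} (p : D.Pro a b)
    (α : ∀ i, D.Cell p (m i)), ∃ β : D.Cell p (pro m), ∀ i, D.vcomp β (projPro m i) = α i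
  cell_ext : ∀ {x y : I → D.Obj} {m : ∀ i, D.Pro (x i) (y i)} {a b : D.Obj} {p : D.Pro a b}
    {β β' : D.Cell p (pro m)}, (∀ i, D.vcomp β (projPro m i) = D.vcomp β' (projPro m i)) → β = β'

namespace ParallelProducts

variable {D : DoubleCat.{u, v, w, c}} {I : Type}

/-- Parallel products from a right adjoint of the diagonal. -/
def ofAdjunction {P : LaxDoubleFunctor (D.power I) D} (A : DoubleAdjunction (D.diag I) P) :
    ParallelProducts D I where
  obj x := P.obj x
  proj x i := A.counit.app x i
  lift {x a} f := A.unit.app a ≫ P.map (x := fun _ => a) (y := x) f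
  lift_proj {x a} f i := by
    refine (Category.assoc _ _ _).trans ?_
    have h₁ := congrFun (A.counit.naturality (x := fun _ => a) (y := x) f) i
    have h₂ := congrFun (A.left_triangle a) i
    refine (congrArg (A.unit.app a ≫ ·) h₁).trans ?_
    refine (Category.assoc _ _ _).symm.trans ?_
    exact (congrArg (· ≫ f i) h₂).trans (Category.id_comp _)
  hom_ext {x a f g} h := by
    -- An arrow is recovered as the transpose of its components, by naturality of the unit and a
    -- triangle identity. The same device proves `cell_ext`.
    have key : ∀ f : a ⟶ P.obj x, f = A.unit.app a ≫
        P.map (x := fun _ => a) (y := x) fun i => f ≫ A.counit.app x i := fun f => by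
      have h₁ := A.unit.naturality f
      have h₂ := A.right_triangle x
      refine (Category.comp_id f).symm.trans ((congrArg (f ≫ ·) h₂).symm.trans ?_)
      refine (Category.assoc _ _ _).symm.trans ?_
      refine (congrArg (· ≫ P.map (A.counit.app x)) h₁).trans ?_
      refine (Category.assoc _ _ _).trans ?_
      exact congrArg (A.unit.app a ≫ ·) (P.map_comp _ _).symm
    have e : (fun i => f ≫ A.counit.app x i) = fun i => g ≫ A.counit.app x i := funext h
    rw [key f, key g]
    exact congrArg (A.unit.app a ≫ P.map (x := fun _ => a) (y := x) ·) e
  pro {x y} m := P.pro (x := x) (y := y) m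
  projPro {x y} m i := A.counit.appPro (x := x) (y := y) m i
  src_projPro {x y} m i := congrFun (A.counit.src_appPro (x := x) (y := y) m) i
  tgt_projPro {x y} m i := congrFun (A.counit.tgt_appPro (x := x) (y := y) m) i
  exists_lift {x y} m {a b} p α := by
    refine ⟨D.vcomp (A.unit.appPro p) (P.cell (x := fun _ => a) (y := fun _ => b) (x' := x)
      (y' := y) (m := fun _ => p) (n := m) α), fun i => ?_⟩
    refine (D.vcomp_assoc _ _ _).trans ?_
    have h₁ := congrFun (A.counit.naturality_cell (x := fun _ => a) (y := fun _ => b) (x' := x)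
      (y' := y) (m := fun _ => p) (n := m) α) i
    have h₂ := congrFun (A.left_triangle_pro p) i
    refine (congrArg (D.vcomp (A.unit.appPro p)) h₁).trans ?_
    refine (D.vcomp_assoc _ _ _).symm.trans ?_
    exact (congrArg (fun t => D.vcomp t (α i)) h₂).trans (D.vid_vcomp _)
  cell_ext {x y m a b p β β'} h := by
    have key : ∀ β : D.Cell p (P.pro (x := x) (y := y) m), β = D.vcomp (A.unit.appPro p)
        (P.cell (x := fun _ => a) (y := fun _ => b) (x' := x) (y' := y) (m := fun _ => p) (n := m)
          fun i => D.vcomp β (A.counit.appPro (x := x) (y := y) m i)) := fun β => by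
      have h₁ := A.unit.naturality_cell β
      have h₂ := A.right_triangle_pro (x := x) (y := y) m
      refine (D.vcomp_vid β).symm.trans ((congrArg (D.vcomp β) h₂).symm.trans ?_)
      refine (D.vcomp_assoc _ _ _).symm.trans ?_
      refine (congrArg (fun t => D.vcomp t (P.cell (A.counit.appPro (x := x) (y := y) m)))
        h₁).trans ?_
      refine (D.vcomp_assoc _ _ _).trans ?_
      exact congrArg (D.vcomp (A.unit.appPro p)) (P.cell_vcomp _ _).symm
    have e : (fun i => D.vcomp β (A.counit.appPro (x := x) (y := y) m i)) =
        fun i => D.vcomp β' (A.counit.appPro (x := x) (y := y) m i) := funext h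
    rw [key β, key β']
    exact congrArg (fun t => D.vcomp (A.unit.appPro p) (P.cell (x := fun _ => a)
      (y := fun _ => b) (x' := x) (y' := y) (m := fun _ => p) (n := m) t)) e

variable (P : ParallelProducts D I)

theorem projPro_tgt_eq_src {x y z : I → D.Obj} (m : ∀ i, D.Pro (x i) (y i))
    (n : ∀ i, D.Pro (y i) (z i)) (i : I) :
    D.tgt (P.projPro m i) = D.src (P.projPro n i) :=
  (P.tgt_projPro m i).trans (P.src_projPro n i).symm

/-- Parallel products are strong if they commute with external composition and identities. -/
structure IsStrong : Prop where
  comp : ∀ {x y z : I → D.Obj} (m : ∀ i, D.Pro (x i) (y i)) (n : ∀ i, D.Pro (y i) (z i)),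
    ∃ κ : D.Cell (D.hcomp (P.pro m) (P.pro n)) (P.pro fun i => D.hcomp (m i) (n i)),
      D.IsInvertible κ ∧ D.src κ = 𝟙 _ ∧ D.tgt κ = 𝟙 _ ∧ ∀ i, D.vcomp κ (P.projPro _ i) =
        D.hcompCell (P.projPro m i) (P.projPro n i) (P.projPro_tgt_eq_src m n i)
  unit : ∀ x : I → D.Obj,
    ∃ κ : D.Cell (D.hid (P.obj x)) (P.pro fun i => D.hid (x i)),
      D.IsInvertible κ ∧ D.src κ = 𝟙 _ ∧ D.tgt κ = 𝟙 _ ∧ ∀ i, D.vcomp κ (P.projPro _ i) =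
        D.hidMap (P.proj x i)

theorem isStrong_ofAdjunction {P : LaxDoubleFunctor (D.power I) D}
    (A : DoubleAdjunction (D.diag I) P) (hP : P.IsPseudo) : (ofAdjunction A).IsStrong where
  comp {x y z} m n := by
    refine ⟨P.laxComp (x := x) (y := y) (z := z) m n, hP.1 _ _, P.src_laxComp _ _,
      P.tgt_laxComp _ _, fun i => ?_⟩
    have h := congrFun (A.counit.laxComp_appPro (x := x) (y := y) (z := z) m n) i
    -- The surplus identity cells are the comparison cells of the strict diagonal and of the
    -- identity double functor.
    refine Eq.trans ?_ (h.trans (D.vcomp_vid _))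
    exact congrArg (fun t => D.vcomp t _) (D.vid_vcomp _).symm
  unit x := by
    refine ⟨P.laxUnit x, hP.2 _, P.src_laxUnit _, P.tgt_laxUnit _, fun i => ?_⟩
    have h := congrFun (A.counit.laxUnit_appPro x) i
    refine Eq.trans ?_ (h.trans (D.vcomp_vid _))
    exact congrArg (fun t => D.vcomp t _) (D.vid_vcomp _).symm

end ParallelProducts

/-! ### Products of families in an equipment. -/

namespace FamilyProducts

variable {D : DoubleCat.{u, v, w, c}}

/-- In an equipment, a product of a family of proarrows is a restriction of a parallel product. -/
noncomputable def ofParallelProducts (hD : D.IsEquipment)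
    (P : ∀ (I : Type), Finite I → ParallelProducts D I) : FamilyProducts D := by
  -- The niche has the parallel product over the apex at the bottom and, as its sides, the arrows
  -- reindexing the products of `X` and of `Y` along the legs.
  have R : ∀ {X Y : FinFam D} (M : FinFam.Pro X Y),
      ∃ (m : D.Pro ((P X.I X.fin).obj X.obj) ((P Y.I Y.fin).obj Y.obj))
        (ρ : D.Cell m ((P M.A M.fin).pro fun a => M.pro a rfl rfl)),
        D.src ρ = (P M.A M.fin).lift (fun a => (P X.I X.fin).proj X.obj (M.l a)) ∧
        D.tgt ρ = (P M.A M.fin).lift (fun a => (P Y.I Y.fin).proj Y.obj (M.r a)) ∧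
        D.IsRestriction ρ := fun M => hD _ _ _
  choose pro ρ hs ht hρ using @R
  exact
  { obj := fun X => (P X.I X.fin).obj X.obj
    proj := fun X i => (P X.I X.fin).proj X.obj i
    lift := fun f => (P _ _).lift f
    lift_proj := fun f i => (P _ _).lift_proj f i
    hom_ext := fun h => (P _ _).hom_ext h
    pro := fun M => pro M
    projPro := fun M a => D.vcomp (ρ M) ((P M.A M.fin).projPro _ a)
    src_projPro := fun M a => by
      rw [D.src_vcomp, hs, (P M.A M.fin).src_projPro, (P M.A M.fin).lift_proj]
    tgt_projPro := fun M a => by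
      rw [D.tgt_vcomp, ht, (P M.A M.fin).tgt_projPro, (P M.A M.fin).lift_proj]
    -- The components induce one cell into the parallel product over the apex. Its boundaries factor
    -- through the reindexing arrows by `f` and `g`, so it factors through the restriction.
    exists_lift := fun {X Y} M {s t} p f g κ hκs hκt => by
      obtain ⟨α, hα⟩ := (P M.A M.fin).exists_lift (fun a => M.pro a rfl rfl) p κ
      obtain ⟨β, ⟨h₁, h₂, h₃⟩, -⟩ := hρ M p f g α
        ((P M.A M.fin).hom_ext fun a => by
          rw [Category.assoc, hs, (P M.A M.fin).lift_proj, ← hκs, ← hα, D.src_vcomp,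
            (P M.A M.fin).src_projPro])
        ((P M.A M.fin).hom_ext fun a => by
          rw [Category.assoc, ht, (P M.A M.fin).lift_proj, ← hκt, ← hα, D.tgt_vcomp,
            (P M.A M.fin).tgt_projPro])
      exact ⟨β, h₁, h₂, fun a => by rw [← D.vcomp_assoc, h₃, hα]⟩
    cell_ext := fun {X Y M s t p β β'} h₁ h₂ h₃ => by
      have e : D.vcomp β (ρ M) = D.vcomp β' (ρ M) :=
        (P M.A M.fin).cell_ext fun a => by rw [D.vcomp_assoc, D.vcomp_assoc, h₃]
      exact (hρ M p (D.src β') (D.tgt β') (D.vcomp β' (ρ M)) (D.src_vcomp _ _)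
        (D.tgt_vcomp _ _)).unique ⟨h₁, h₂, e⟩ ⟨rfl, rfl, rfl⟩ }

end FamilyProducts

theorem DoubleCat.hasLaxFiniteProducts_of_isPrecartesian (D : DoubleCat.{u, v, w, c})
    (hD : D.IsEquipment) (h : D.IsPrecartesian) : D.HasLaxFiniteProducts := by
  choose P A using h
  exact ⟨_, ⟨(FamilyProducts.ofParallelProducts hD fun I _ =>
    ParallelProducts.ofAdjunction (A I).some).adjunction⟩⟩

/-! ### Unit coherence, companions and conjoints, and restrictions of composites. -/

namespace DoubleCat

variable {D : DoubleCat.{u, v, w, c}}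

theorem isInvertible_assoc {x y z t : D.Obj} (m : D.Pro x y) (n : D.Pro y z) (p : D.Pro z t) :
    D.IsInvertible (D.assoc m n p) :=
  ⟨_, D.assoc_assocInv m n p, D.assocInv_assoc m n p⟩

theorem isInvertible_lunit {x y : D.Obj} (m : D.Pro x y) : D.IsInvertible (D.lunit m) :=
  ⟨_, D.lunit_lunitInv m, D.lunitInv_lunit m⟩

theorem isInvertible_runit {x y : D.Obj} (m : D.Pro x y) : D.IsInvertible (D.runit m) :=
  ⟨_, D.runit_runitInv m, D.runitInv_runit m⟩

theorem assocInv_naturality {x y z t x' y' z' t' : D.Obj} {m : D.Pro x y} {n : D.Pro y z}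
    {p : D.Pro z t} {m' : D.Pro x' y'} {n' : D.Pro y' z'} {p' : D.Pro z' t'}
    (α : D.Cell m m') (β : D.Cell n n') (γ : D.Cell p p') (h : D.tgt α = D.src β)
    (h' : D.tgt β = D.src γ) :
    D.vcomp (D.hcompCell α (D.hcompCell β γ h') (h.trans (D.src_hcompCell β γ h').symm))
      (D.assocInv m' n' p') =
      D.vcomp (D.assocInv m n p)
        (D.hcompCell (D.hcompCell α β h) γ ((D.tgt_hcompCell α β h).trans h')) := by
  apply (isInvertible_assoc m n p).vcomp_left_cancel
  rw [← D.vcomp_assoc, ← D.assoc_naturality α β γ h h', D.vcomp_assoc, D.assoc_assocInv,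
    D.vcomp_vid, ← D.vcomp_assoc, D.assoc_assocInv, D.vid_vcomp]

/-- Whiskering with an identity proarrow is faithful, because the unitor conjugates it back to the
original cell. -/
theorem hcompCell_vid_injective {x y y' : D.Obj} {m : D.Pro x y} {n : D.Pro x y'}
    {α β : D.Cell m n} (hα : D.src α = 𝟙 x) (hβ : D.src β = 𝟙 x)
    (e : D.hcompCell (D.vid (D.hid x)) α ((D.tgt_vid _).trans hα.symm) =
      D.hcompCell (D.vid (D.hid x)) β ((D.tgt_vid _).trans hβ.symm)) : α = β := by
  have key : ∀ (γ : D.Cell m n) (hγ : D.src γ = 𝟙 x),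
      D.vcomp (D.hcompCell (D.vid (D.hid x)) γ ((D.tgt_vid _).trans hγ.symm)) (D.lunit n) =
        D.vcomp (D.lunit m) γ := fun γ hγ => by
    rw [← D.lunit_naturality]
    exact congrArg (fun t => D.vcomp t _)
      (D.hcompCell_congr (by rw [hγ, D.hidMap_id]) rfl _ _)
  apply (isInvertible_lunit m).vcomp_left_cancel
  rw [← key α hα, ← key β hβ, e]

theorem hcompCell_injective_vid {x x' y : D.Obj} {m : D.Pro x y} {n : D.Pro x' y}
    {α β : D.Cell m n} (hα : D.tgt α = 𝟙 y) (hβ : D.tgt β = 𝟙 y)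
    (e : D.hcompCell α (D.vid (D.hid y)) (hα.trans (D.src_vid _).symm) =
      D.hcompCell β (D.vid (D.hid y)) (hβ.trans (D.src_vid _).symm)) : α = β := by
  have key : ∀ (γ : D.Cell m n) (hγ : D.tgt γ = 𝟙 y),
      D.vcomp (D.hcompCell γ (D.vid (D.hid y)) (hγ.trans (D.src_vid _).symm)) (D.runit n) =
        D.vcomp (D.runit m) γ := fun γ hγ => by
    rw [← D.runit_naturality]
    exact congrArg (fun t => D.vcomp t _)
      (D.hcompCell_congr rfl (by rw [hγ, D.hidMap_id]) _ _)
  apply (isInvertible_runit m).vcomp_left_cancel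
  rw [← key α hα, ← key β hβ, e]

/-- Kelly's argument for monoidal categories: whisker with an identity proarrow, precompose with
invertible associators, and combine the pentagon with two uses of the triangle. -/
theorem assoc_lunit {x y z : D.Obj} (m : D.Pro x y) (n : D.Pro y z) :
    D.vcomp (D.assoc (D.hid x) m n) (D.lunit (D.hcomp m n)) =
      D.hcompCell (D.lunit m) (D.vid n) ((D.tgt_lunit m).trans (D.src_vid n).symm) := by
  refine hcompCell_vid_injective (by rw [D.src_vcomp, D.src_assoc, D.src_lunit, Category.comp_id])
    (by rw [D.src_hcompCell, D.src_lunit]) ?_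
  apply (isInvertible_assoc (D.hid x) (D.hcomp (D.hid x) m) n).vcomp_left_cancel
  apply ((isInvertible_assoc (D.hid x) (D.hid x) m).hcompCell_vid (D.tgt_assoc _ _ _) n
    ((D.tgt_assoc _ _ _).trans (D.src_vid n).symm)).vcomp_left_cancel
  have e' : D.hcompCell (D.runit (D.hid x)) (D.hcompCell (D.vid m) (D.vid n)
      ((D.tgt_vid _).trans (D.src_vid _).symm)) ((D.tgt_runit _).trans
        ((D.src_hcompCell _ _ _).trans (D.src_vid _)).symm) =
      D.hcompCell (D.runit (D.hid x)) (D.vid (D.hcomp m n))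
        ((D.tgt_runit _).trans (D.src_vid _).symm) :=
    D.hcompCell_congr rfl (D.hcompCell_vid m n) _ _
  rw [D.hcompCell_vid_vcomp _ _ _ (D.src_assoc _ _ _) (D.src_lunit _),
    ← D.vcomp_assoc (D.assoc _ _ _), ← D.vcomp_assoc (D.hcompCell _ _ _), D.pentagon,
    D.vcomp_assoc, D.triangle, ← e', ← D.assoc_naturality _ _ _
      ((D.tgt_runit _).trans (D.src_vid _).symm) ((D.tgt_vid _).trans (D.src_vid _).symm),
    ← D.assoc_naturality _ _ _ ((D.tgt_vid _).trans (D.src_lunit _).symm), ← D.vcomp_assoc]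
  refine congrArg (fun t => D.vcomp t _) ?_
  rw [hcompCell_vcomp' _ _ _ _ _ _ (D.triangle _ _) (D.vid_vcomp _)]

/-- The mirror image of `assoc_lunit`, with the invertible associator composed at the end instead.
-/
theorem assoc_runit {x y z : D.Obj} (m : D.Pro x y) (n : D.Pro y z) :
    D.vcomp (D.assoc m n (D.hid z)) (D.hcompCell (D.vid m) (D.runit n)
      ((D.tgt_vid m).trans (D.src_runit n).symm)) = D.runit (D.hcomp m n) := by
  refine hcompCell_injective_vid (by rw [D.tgt_vcomp, D.tgt_assoc, D.tgt_hcompCell, D.tgt_runit,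
    Category.comp_id]) (D.tgt_runit _) ?_
  apply (isInvertible_assoc m n (D.hid z)).vcomp_right_cancel
  rw [D.hcompCell_vcomp_vid _ _ _ (D.tgt_assoc _ _ _) (by rw [D.tgt_hcompCell, D.tgt_runit]),
    ← D.triangle, D.vcomp_assoc, D.vcomp_assoc, D.assoc_naturality _ _ _ _
      ((D.tgt_runit _).trans (D.src_vid _).symm)]
  have e := D.assoc_naturality (D.vid m) (D.vid n) (D.lunit (D.hid z))
    ((D.tgt_vid _).trans (D.src_vid _).symm) ((D.tgt_vid _).trans (D.src_lunit _).symm)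
  have e' : D.hcompCell (D.hcompCell (D.vid m) (D.vid n) ((D.tgt_vid _).trans (D.src_vid _).symm))
      (D.lunit (D.hid z)) ((D.tgt_hcompCell _ _ _).trans
        ((D.tgt_vid _).trans (D.src_lunit _).symm)) =
      D.hcompCell (D.vid (D.hcomp m n)) (D.lunit (D.hid z))
        ((D.tgt_vid _).trans (D.src_lunit _).symm) :=
    D.hcompCell_congr (D.hcompCell_vid m n) rfl _ _
  rw [← e', e, ← D.vcomp_assoc (D.assoc (D.hcomp m n) _ _), ← D.pentagon, D.vcomp_assoc, D.vcomp_assoc]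
  refine congrArg (D.vcomp _) (congrArg (D.vcomp _) ?_)
  rw [hcompCell_vcomp' _ _ _ _ _ _ (D.vid_vcomp _) (D.triangle _ _)]

theorem IsRestriction.vcomp {x y x' y' x'' y'' : D.Obj} {m : D.Pro x y} {n : D.Pro x' y'}
    {p : D.Pro x'' y''} {ρ : D.Cell m n} {σ : D.Cell n p} (hρ : D.IsRestriction ρ)
    (hσ : D.IsRestriction σ) : D.IsRestriction (D.vcomp ρ σ) := by
  intro a b s q r α hs ht
  obtain ⟨β, ⟨h₁, h₂, h₃⟩, hβ⟩ := hσ s (q ≫ D.src ρ) (r ≫ D.tgt ρ) α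
    (by rw [hs, D.src_vcomp, Category.assoc]) (by rw [ht, D.tgt_vcomp, Category.assoc])
  obtain ⟨γ, ⟨h₄, h₅, h₆⟩, hγ⟩ := hρ s q r β h₁ h₂
  refine ⟨γ, ⟨h₄, h₅, by rw [← D.vcomp_assoc, h₆, h₃]⟩, ?_⟩
  rintro δ ⟨h₇, h₈, h₉⟩
  refine hγ δ ⟨h₇, h₈, hβ _ ⟨?_, ?_, ?_⟩⟩
  · rw [D.src_vcomp, h₇]
  · rw [D.tgt_vcomp, h₈]
  · rw [D.vcomp_assoc, h₉]

/-- A companion `F` of an arrow `f`, with its two binding cells. -/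
structure Companion {x x' : D.Obj} (f : x ⟶ x') where
  pro : D.Pro x x'
  counit : D.Cell pro (D.hid x')
  unit : D.Cell (D.hid x) pro
  src_counit : D.src counit = f
  tgt_counit : D.tgt counit = 𝟙 x'
  src_unit : D.src unit = 𝟙 x
  tgt_unit : D.tgt unit = f
  unit_counit : D.vcomp unit counit = D.hidMap f

/-- The companion is the restriction of the identity proarrow along `f` and an identity arrow, and
its unit is the factorization of `D.hidMap f`. -/
theorem IsEquipment.nonempty_companion (hD : D.IsEquipment) {x x' : D.Obj} (f : x ⟶ x') :
    Nonempty (Companion f) := by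
  obtain ⟨F, χ, hs, ht, hχ⟩ := hD f (𝟙 x') (D.hid x')
  obtain ⟨η, ⟨h₁, h₂, h₃⟩, -⟩ := hχ (D.hid x) (𝟙 x) f (D.hidMap f)
    (by rw [D.src_hidMap, hs, Category.id_comp]) (by rw [D.tgt_hidMap, ht, Category.comp_id])
  exact ⟨⟨F, χ, η, hs, ht, h₁, h₂, h₃⟩⟩

/-- The action of a companion of `f` on a proarrow `m`, exhibiting `m'` as `F ⊙ m`. -/
structure Companion.IsAction {x x' y : D.Obj} {f : x ⟶ x'} (F : Companion f) {m : D.Pro x' y}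
    {m' : D.Pro x y} (ρ : D.Cell m' m) (κ : D.Cell (D.hcomp F.pro m) m') : Prop where
  src_cell : D.src ρ = f
  tgt_cell : D.tgt ρ = 𝟙 y
  src_act : D.src κ = 𝟙 x
  tgt_act : D.tgt κ = 𝟙 y
  act_cell : D.vcomp κ ρ = D.vcomp (D.hcompCell F.counit (D.vid m)
    (F.tgt_counit.trans (D.src_vid m).symm)) (D.lunit m)
  unit_act : D.vcomp (D.hcompCell F.unit ρ (F.tgt_unit.trans src_cell.symm)) κ = D.lunit m'

/-- The action factors the counit of the companion, whiskered with `m` and followed by the unitor,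
through the restriction. The unit law is an equality of two factorizations of the same cell. -/
theorem IsRestriction.exists_isAction {x x' y : D.Obj} {f : x ⟶ x'} (F : Companion f)
    {m : D.Pro x' y} {m' : D.Pro x y} {ρ : D.Cell m' m} (hρ : D.IsRestriction ρ)
    (hs : D.src ρ = f) (ht : D.tgt ρ = 𝟙 y) : ∃ κ, F.IsAction ρ κ := by
  obtain ⟨κ, ⟨h₁, h₂, h₃⟩, -⟩ := hρ (D.hcomp F.pro m) (𝟙 x) (𝟙 y)
    (D.vcomp (D.hcompCell F.counit (D.vid m)
      (F.tgt_counit.trans (D.src_vid m).symm)) (D.lunit m))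
    (by rw [D.src_vcomp, D.src_hcompCell, F.src_counit, D.src_lunit, hs, Category.id_comp,
      Category.comp_id])
    (by rw [D.tgt_vcomp, D.tgt_hcompCell, D.tgt_vid, D.tgt_lunit, ht])
  refine ⟨κ, hs, ht, h₁, h₂, h₃, ?_⟩
  refine (hρ (D.hcomp (D.hid x) m') (𝟙 x) (𝟙 y) (D.vcomp (D.lunit m') ρ)
    (by rw [D.src_vcomp, D.src_lunit]) (by rw [D.tgt_vcomp, D.tgt_lunit])).unique
    ⟨?_, ?_, ?_⟩ ⟨D.src_lunit _, D.tgt_lunit _, rfl⟩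
  · rw [D.src_vcomp, D.src_hcompCell, F.src_unit, h₁, Category.comp_id]
  · rw [D.tgt_vcomp, D.tgt_hcompCell, ht, h₂, Category.comp_id]
  · rw [D.vcomp_assoc, h₃, ← D.vcomp_assoc,
      hcompCell_vcomp' _ _ _ _ _ _ F.unit_counit (D.vcomp_vid ρ)
        ((D.tgt_hidMap f).trans hs.symm), ← D.lunit_naturality]
    exact congrArg (fun t => D.vcomp t _) (D.hcompCell_congr (by rw [hs]) rfl _ _)

/-- With the previous lemma this makes being a restriction along `f` equational: it amounts to
having an action. Equations, unlike a universal property, evidently survive external composition. -/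
theorem Companion.IsAction.isRestriction {x x' y : D.Obj} {f : x ⟶ x'} {F : Companion f}
    {m : D.Pro x' y} {m' : D.Pro x y} {ρ : D.Cell m' m} {κ : D.Cell (D.hcomp F.pro m) m'}
    (h : F.IsAction ρ κ) : D.IsRestriction ρ := by
  intro a b p q r α hs ht
  rw [h.src_cell] at hs
  rw [h.tgt_cell, Category.comp_id] at ht
  have h₁ : D.tgt (D.vcomp (D.hidMap q) F.unit) = D.src α := by
    rw [D.tgt_vcomp, D.tgt_hidMap, F.tgt_unit, hs]
  -- Insert an identity proarrow before `p`, send it to the companion by `q` and the unit while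
  -- applying `α` to `p`, and then act.
  refine ⟨D.vcomp (D.lunitInv p) (D.vcomp (D.hcompCell (D.vcomp (D.hidMap q) F.unit) α h₁) κ),
    ⟨?_, ?_, ?_⟩, ?_⟩
  · rw [D.src_vcomp, D.src_lunitInv, D.src_vcomp, D.src_hcompCell, D.src_vcomp, D.src_hidMap,
      F.src_unit, h.src_act, Category.id_comp, Category.comp_id, Category.comp_id]
  · rw [D.tgt_vcomp, D.tgt_lunitInv, D.tgt_vcomp, D.tgt_hcompCell, h.tgt_act, Category.id_comp,
      Category.comp_id, ht]
  · rw [D.vcomp_assoc, D.vcomp_assoc, h.act_cell, ← D.vcomp_assoc (D.hcompCell _ _ _),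
      hcompCell_vcomp' (γ := D.hidMap (D.src α)) (δ := α) _ _ _ _ _ _
        (by rw [D.vcomp_assoc, F.unit_counit, ← D.hidMap_comp, hs]) (D.vcomp_vid α)
        (D.tgt_hidMap _), D.lunit_naturality, ← D.vcomp_assoc, D.lunitInv_lunit, D.vid_vcomp]
  · rintro β ⟨rfl, -, rfl⟩
    rw [D.hcompCell_vcomp _ _ _ _ (D.tgt_hidMap _) (F.tgt_unit.trans h.src_cell.symm),
      D.vcomp_assoc, h.unit_act, D.lunit_naturality, ← D.vcomp_assoc, D.lunitInv_lunit,
      D.vid_vcomp]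

/-- Whiskering carries an action to an action, up to reassociation; `assoc_lunit` reconciles the
unitors. -/
theorem Companion.IsAction.hcompCell_vid {x x' y z : D.Obj} {f : x ⟶ x'} {F : Companion f}
    {m : D.Pro x' y} {m' : D.Pro x y} {ρ : D.Cell m' m} {κ : D.Cell (D.hcomp F.pro m) m'}
    (h : F.IsAction ρ κ) (n : D.Pro y z) :
    F.IsAction (D.hcompCell ρ (D.vid n) (h.tgt_cell.trans (D.src_vid n).symm))
      (D.vcomp (D.assocInv F.pro m n)
        (D.hcompCell κ (D.vid n) (h.tgt_act.trans (D.src_vid n).symm))) where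
  src_cell := by rw [D.src_hcompCell, h.src_cell]
  tgt_cell := by rw [D.tgt_hcompCell, D.tgt_vid]
  src_act := by rw [D.src_vcomp, D.src_assocInv, D.src_hcompCell, h.src_act, Category.comp_id]
  tgt_act := by rw [D.tgt_vcomp, D.tgt_assocInv, D.tgt_hcompCell, D.tgt_vid, Category.comp_id]
  act_cell := by
    rw [D.vcomp_assoc, hcompCell_vcomp' _ _ _ _ _ _ h.act_cell (D.vid_vcomp _)
      (by rw [D.tgt_vcomp, D.tgt_hcompCell, D.tgt_vid, D.src_vid, D.tgt_lunit, Category.comp_id]),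
      D.hcompCell_vcomp_vid _ _ _ (by rw [D.tgt_hcompCell, D.tgt_vid]) (D.tgt_lunit _),
      ← D.vcomp_assoc, ← assocInv_naturality _ _ _ _ ((D.tgt_vid _).trans (D.src_vid _).symm),
      D.vcomp_assoc, ← assoc_lunit, ← D.vcomp_assoc (D.assocInv _ _ _), D.assocInv_assoc,
      D.vid_vcomp]
    exact congrArg (fun t => D.vcomp t _)
      (D.hcompCell_congr rfl (D.hcompCell_vid _ _) _ _)
  unit_act := by
    rw [← D.vcomp_assoc, assocInv_naturality _ _ _ (F.tgt_unit.trans h.src_cell.symm),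
      D.vcomp_assoc, hcompCell_vcomp' _ _ _ _ _ _ h.unit_act (D.vid_vcomp _)
        ((D.tgt_lunit _).trans (D.src_vid _).symm), ← assoc_lunit, ← D.vcomp_assoc,
      D.assocInv_assoc, D.vid_vcomp]

/-- A conjoint `G` of an arrow `g`, with its two binding cells. -/
structure Conjoint {z z' : D.Obj} (g : z ⟶ z') where
  pro : D.Pro z' z
  counit : D.Cell pro (D.hid z')
  unit : D.Cell (D.hid z) pro
  src_counit : D.src counit = 𝟙 z'
  tgt_counit : D.tgt counit = g
  src_unit : D.src unit = g
  tgt_unit : D.tgt unit = 𝟙 z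
  unit_counit : D.vcomp unit counit = D.hidMap g

theorem IsEquipment.nonempty_conjoint (hD : D.IsEquipment) {z z' : D.Obj} (g : z ⟶ z') :
    Nonempty (Conjoint g) := by
  obtain ⟨G, χ, hs, ht, hχ⟩ := hD (𝟙 z') g (D.hid z')
  obtain ⟨η, ⟨h₁, h₂, h₃⟩, -⟩ := hχ (D.hid z) g (𝟙 z) (D.hidMap g)
    (by rw [D.src_hidMap, hs, Category.comp_id]) (by rw [D.tgt_hidMap, ht, Category.id_comp])
  exact ⟨⟨G, χ, η, hs, ht, h₁, h₂, h₃⟩⟩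

/-- The action of a conjoint of `g` on a proarrow `m`, exhibiting `m'` as `m ⊙ G`. -/
structure Conjoint.IsAction {x z z' : D.Obj} {g : z ⟶ z'} (G : Conjoint g) {m : D.Pro x z'}
    {m' : D.Pro x z} (ρ : D.Cell m' m) (κ : D.Cell (D.hcomp m G.pro) m') : Prop where
  src_cell : D.src ρ = 𝟙 x
  tgt_cell : D.tgt ρ = g
  src_act : D.src κ = 𝟙 x
  tgt_act : D.tgt κ = 𝟙 z
  act_cell : D.vcomp κ ρ = D.vcomp (D.hcompCell (D.vid m) G.counit
    ((D.tgt_vid m).trans G.src_counit.symm)) (D.runit m)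
  unit_act : D.vcomp (D.hcompCell ρ G.unit (tgt_cell.trans G.src_unit.symm)) κ = D.runit m'

theorem IsRestriction.exists_conjoint_isAction {x z z' : D.Obj} {g : z ⟶ z'} (G : Conjoint g)
    {m : D.Pro x z'} {m' : D.Pro x z} {ρ : D.Cell m' m} (hρ : D.IsRestriction ρ)
    (hs : D.src ρ = 𝟙 x) (ht : D.tgt ρ = g) : ∃ κ, G.IsAction ρ κ := by
  obtain ⟨κ, ⟨h₁, h₂, h₃⟩, -⟩ := hρ (D.hcomp m G.pro) (𝟙 x) (𝟙 z)
    (D.vcomp (D.hcompCell (D.vid m) G.counit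
      ((D.tgt_vid m).trans G.src_counit.symm)) (D.runit m))
    (by rw [D.src_vcomp, D.src_hcompCell, D.src_vid, D.src_runit, hs])
    (by rw [D.tgt_vcomp, D.tgt_hcompCell, G.tgt_counit, D.tgt_runit, ht, Category.id_comp,
      Category.comp_id])
  refine ⟨κ, hs, ht, h₁, h₂, h₃, ?_⟩
  refine (hρ (D.hcomp m' (D.hid z)) (𝟙 x) (𝟙 z) (D.vcomp (D.runit m') ρ)
    (by rw [D.src_vcomp, D.src_runit]) (by rw [D.tgt_vcomp, D.tgt_runit])).unique
    ⟨?_, ?_, ?_⟩ ⟨D.src_runit _, D.tgt_runit _, rfl⟩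
  · rw [D.src_vcomp, D.src_hcompCell, hs, h₁, Category.comp_id]
  · rw [D.tgt_vcomp, D.tgt_hcompCell, G.tgt_unit, h₂, Category.comp_id]
  · rw [D.vcomp_assoc, h₃, ← D.vcomp_assoc,
      hcompCell_vcomp' _ _ _ _ _ _ (D.vcomp_vid ρ) G.unit_counit
        (ht.trans (D.src_hidMap g).symm), ← D.runit_naturality]
    exact congrArg (fun t => D.vcomp t _) (D.hcompCell_congr rfl (by rw [ht]) _ _)

theorem Conjoint.IsAction.isRestriction {x z z' : D.Obj} {g : z ⟶ z'} {G : Conjoint g}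
    {m : D.Pro x z'} {m' : D.Pro x z} {ρ : D.Cell m' m} {κ : D.Cell (D.hcomp m G.pro) m'}
    (h : G.IsAction ρ κ) : D.IsRestriction ρ := by
  intro a b p q r α hs ht
  rw [h.src_cell, Category.comp_id] at hs
  rw [h.tgt_cell] at ht
  have h₁ : D.tgt α = D.src (D.vcomp (D.hidMap r) G.unit) := by
    rw [D.src_vcomp, D.src_hidMap, G.src_unit, ht]
  refine ⟨D.vcomp (D.runitInv p) (D.vcomp (D.hcompCell α (D.vcomp (D.hidMap r) G.unit) h₁) κ),
    ⟨?_, ?_, ?_⟩, ?_⟩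
  · rw [D.src_vcomp, D.src_runitInv, D.src_vcomp, D.src_hcompCell, h.src_act, Category.id_comp,
      Category.comp_id, hs]
  · rw [D.tgt_vcomp, D.tgt_runitInv, D.tgt_vcomp, D.tgt_hcompCell, D.tgt_vcomp, D.tgt_hidMap,
      G.tgt_unit, h.tgt_act, Category.id_comp, Category.comp_id, Category.comp_id]
  · rw [D.vcomp_assoc, D.vcomp_assoc, h.act_cell, ← D.vcomp_assoc (D.hcompCell _ _ _),
      hcompCell_vcomp' (γ := α) (δ := D.hidMap (D.tgt α)) _ _ _ _ _ _ (D.vcomp_vid α)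
        (by rw [D.vcomp_assoc, G.unit_counit, ← D.hidMap_comp, ht])
        (D.src_hidMap _).symm, D.runit_naturality, ← D.vcomp_assoc, D.runitInv_runit,
      D.vid_vcomp]
  · rintro β ⟨-, rfl, rfl⟩
    rw [D.hcompCell_vcomp _ _ _ _ (D.src_hidMap _).symm (h.tgt_cell.trans G.src_unit.symm),
      D.vcomp_assoc, h.unit_act, D.runit_naturality, ← D.vcomp_assoc, D.runitInv_runit,
      D.vid_vcomp]

theorem Conjoint.IsAction.vid_hcompCell {x y z z' : D.Obj} {g : z ⟶ z'} {G : Conjoint g}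
    {m : D.Pro y z'} {m' : D.Pro y z} {ρ : D.Cell m' m} {κ : D.Cell (D.hcomp m G.pro) m'}
    (h : G.IsAction ρ κ) (n : D.Pro x y) :
    G.IsAction (D.hcompCell (D.vid n) ρ ((D.tgt_vid n).trans h.src_cell.symm))
      (D.vcomp (D.assoc n m G.pro)
        (D.hcompCell (D.vid n) κ ((D.tgt_vid n).trans h.src_act.symm))) where
  src_cell := by rw [D.src_hcompCell, D.src_vid]
  tgt_cell := by rw [D.tgt_hcompCell, h.tgt_cell]
  src_act := by rw [D.src_vcomp, D.src_assoc, D.src_hcompCell, D.src_vid, Category.comp_id]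
  tgt_act := by rw [D.tgt_vcomp, D.tgt_assoc, D.tgt_hcompCell, h.tgt_act, Category.comp_id]
  act_cell := by
    rw [D.vcomp_assoc, hcompCell_vcomp' _ _ _ _ _ _ (D.vid_vcomp _) h.act_cell
      (by rw [D.src_vcomp, D.src_hcompCell, D.tgt_vid, D.src_vid, D.src_runit, Category.comp_id]),
      D.hcompCell_vid_vcomp _ _ _ (by rw [D.src_hcompCell, D.src_vid]) (D.src_runit _),
      ← D.vcomp_assoc, ← D.assoc_naturality _ _ _ ((D.tgt_vid _).trans (D.src_vid _).symm),
      D.vcomp_assoc, assoc_runit]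
    exact congrArg (fun t => D.vcomp t _)
      (D.hcompCell_congr (D.hcompCell_vid _ _) rfl _ _)
  unit_act := by
    rw [← D.vcomp_assoc, D.assoc_naturality _ _ _ _ (h.tgt_cell.trans G.src_unit.symm),
      D.vcomp_assoc, hcompCell_vcomp' _ _ _ _ _ _ (D.vid_vcomp _) h.unit_act
        ((D.tgt_vid _).trans (D.src_runit _).symm), assoc_runit]

/-- In an equipment, restrictions along outer boundaries are preserved by external composition. -/
theorem IsRestriction.hcompCell (hD : D.IsEquipment) {x x' y z z' : D.Obj} {m : D.Pro x' y}
    {m' : D.Pro x y} {n : D.Pro y z'} {n' : D.Pro y z} {ρ : D.Cell m' m} {σ : D.Cell n' n}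
    (hρ : D.IsRestriction ρ) (hσ : D.IsRestriction σ) (ht : D.tgt ρ = 𝟙 y) (hs : D.src σ = 𝟙 y) :
    D.IsRestriction (D.hcompCell ρ σ (ht.trans hs.symm)) := by
  obtain ⟨F⟩ := hD.nonempty_companion (D.src ρ)
  obtain ⟨G⟩ := hD.nonempty_conjoint (D.tgt σ)
  obtain ⟨κ, hκ⟩ := hρ.exists_isAction F rfl ht
  obtain ⟨μ, hμ⟩ := hσ.exists_conjoint_isAction G hs rfl
  -- By interchange, the composite is `ρ` whiskered with `n'` followed by `σ` whiskered with `m`: a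
  -- left restriction followed by a right one.
  have e := hcompCell_vcomp' ρ (D.vid n') (D.vid m) σ (ht.trans (D.src_vid n').symm)
    ((D.tgt_vid m).trans hs.symm) (D.vcomp_vid ρ) (D.vid_vcomp σ) (ht.trans hs.symm)
  rw [← e]
  intro a b
  exact IsRestriction.vcomp (hκ.hcompCell_vid n').isRestriction
    (hμ.vid_hcompCell m).isRestriction

end DoubleCat

/-! ### Parallel cones, and the comparison cells in a cartesian equipment. -/

/-- A cone of cells exhibiting a proarrow as a parallel product of proarrows. -/
structure DoubleCat.IsParallelCone (D : DoubleCat.{u, v, w, c}) {I : Type} {x y : I → D.Obj}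
    {m : ∀ i, D.Pro (x i) (y i)} {a b : D.Obj} {p : D.Pro a b} (π : ∀ i, D.Cell p (m i)) :
    Prop where
  src_ext : ∀ {s : D.Obj} {f g : s ⟶ a}, (∀ i, f ≫ D.src (π i) = g ≫ D.src (π i)) → f = g
  tgt_ext : ∀ {s : D.Obj} {f g : s ⟶ b}, (∀ i, f ≫ D.tgt (π i) = g ≫ D.tgt (π i)) → f = g
  exists_lift : ∀ {s t : D.Obj} {q : D.Pro s t} (α : ∀ i, D.Cell q (m i)),
    ∃ β : D.Cell q p, ∀ i, D.vcomp β (π i) = α i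
  cell_ext : ∀ {s t : D.Obj} {q : D.Pro s t} {β β' : D.Cell q p},
    (∀ i, D.vcomp β (π i) = D.vcomp β' (π i)) → β = β'

namespace ParallelProducts

variable {D : DoubleCat.{u, v, w, c}} {I : Type} (P : ParallelProducts D I)

theorem isParallelCone {x y : I → D.Obj} (m : ∀ i, D.Pro (x i) (y i)) :
    D.IsParallelCone (P.projPro m) where
  src_ext h := P.hom_ext fun i => by
    have := h i
    rwa [P.src_projPro] at this
  tgt_ext h := P.hom_ext fun i => by
    have := h i
    rwa [P.tgt_projPro] at this
  exists_lift α := P.exists_lift m _ α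
  cell_ext h := P.cell_ext h

/-- The invertible comparison cell transports the universal property from the parallel product of
the composites. -/
theorem IsStrong.isParallelCone_hcomp {P : ParallelProducts D I} (hP : P.IsStrong)
    {x y z : I → D.Obj} (m : ∀ i, D.Pro (x i) (y i)) (n : ∀ i, D.Pro (y i) (z i)) :
    D.IsParallelCone fun i =>
      D.hcompCell (P.projPro m i) (P.projPro n i) (P.projPro_tgt_eq_src m n i) where
  src_ext h := P.hom_ext fun i => by
    have := h i
    rwa [D.src_hcompCell, P.src_projPro] at this
  tgt_ext h := P.hom_ext fun i => by
    have := h i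
    rwa [D.tgt_hcompCell, P.tgt_projPro] at this
  exists_lift {s t q} α := by
    obtain ⟨κ, ⟨μ, -, hμ⟩, -, -, hκ⟩ := hP.comp m n
    obtain ⟨β, hβ⟩ := P.exists_lift (fun i => D.hcomp (m i) (n i)) q α
    refine ⟨D.vcomp β μ, fun i => ?_⟩
    rw [← hκ, D.vcomp_assoc, ← D.vcomp_assoc μ, hμ, D.vid_vcomp, hβ]
  cell_ext {s t q β β'} h := by
    obtain ⟨κ, hi, -, -, hκ⟩ := hP.comp m n
    refine hi.vcomp_right_cancel (P.cell_ext fun i => ?_)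
    rw [D.vcomp_assoc, D.vcomp_assoc, hκ, h]

theorem IsStrong.isParallelCone_hid {P : ParallelProducts D I} (hP : P.IsStrong)
    (x : I → D.Obj) :
    D.IsParallelCone (m := fun i => D.hid (x i)) fun i => D.hidMap (P.proj x i) where
  src_ext h := P.hom_ext fun i => by
    have := h i
    rwa [D.src_hidMap] at this
  tgt_ext h := P.hom_ext fun i => by
    have := h i
    rwa [D.tgt_hidMap] at this
  exists_lift {s t q} α := by
    obtain ⟨κ, ⟨μ, -, hμ⟩, -, -, hκ⟩ := hP.unit x
    obtain ⟨β, hβ⟩ := P.exists_lift (fun i => D.hid (x i)) q α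
    refine ⟨D.vcomp β μ, fun i => ?_⟩
    rw [← hκ, D.vcomp_assoc, ← D.vcomp_assoc μ, hμ, D.vid_vcomp, hβ]
  cell_ext {s t q β β'} h := by
    obtain ⟨κ, hi, -, -, hκ⟩ := hP.unit x
    refine hi.vcomp_right_cancel (P.cell_ext fun i => ?_)
    rw [D.vcomp_assoc, D.vcomp_assoc, hκ, h]

end ParallelProducts

namespace FinFam.Pro

variable {D : DoubleCat.{u, v, w, c}} {X Y : FinFam D} (M : Pro X Y)

/-- A component of a cone over a family of proarrows reindexed along a section `e` of its right
leg. -/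
def reindexRight (e : Y.I → M.A) (he : ∀ j, M.r (e j) = j) {a b : D.Obj} {p : D.Pro a b}
    (π : ∀ j, D.Cell p (M.pro (e j) rfl (he j))) (s : M.A) (j : Y.I) (h : e j = s)
    (hj : M.r s = j) : D.Cell p (M.pro s rfl hj) := by
  subst h
  exact π j

/-- A component of a cone over a family of proarrows reindexed along a section `e` of its left
leg. -/
def reindexLeft (e : X.I → M.A) (he : ∀ i, M.l (e i) = i) {a b : D.Obj} {p : D.Pro a b}
    (π : ∀ i, D.Cell p (M.pro (e i) (he i) rfl)) (s : M.A) (i : X.I) (h : e i = s)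
    (hi : M.l s = i) : D.Cell p (M.pro s hi rfl) := by
  subst h
  exact π i

end FinFam.Pro

namespace FamilyProducts

variable {D : DoubleCat.{u, v, w, c}} (F : FamilyProducts D)

/-- The product of a family of proarrows whose right leg is a bijection is a restriction of a
parallel product along its left boundary. -/
theorem exists_isRestriction_right {X Y : FinFam D} (M : FinFam.Pro X Y) (e : Y.I → M.A)
    (he : ∀ j, M.r (e j) = j) (he' : ∀ s, e (M.r s) = s) {a : D.Obj} {p : D.Pro a (F.obj Y)}
    {π : ∀ j, D.Cell p (M.pro (e j) rfl (he j))} (ht : ∀ j, D.tgt (π j) = F.proj Y j)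
    (hπ : D.IsParallelCone π) :
    ∃ ρ : D.Cell (F.pro M) p, D.IsRestriction ρ ∧ D.tgt ρ = 𝟙 _ ∧
      ∀ j, D.vcomp ρ (π j) = F.projPro' M (e j) rfl (he j) := by
  -- The target of this cell is an identity because the cone has the projections of `Y` as targets;
  -- its source, left implicit, is the arrow along which one restricts.
  obtain ⟨ρ, hρ⟩ := hπ.exists_lift fun j => F.projPro' M (e j) rfl (he j)
  have hρ₁ : D.tgt ρ = 𝟙 _ := F.hom_ext fun j => by
    rw [Category.id_comp, ← ht j, ← D.tgt_vcomp, hρ, F.tgt_projPro', ht]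
  -- Since `e` is inverse to the right leg, the `Y.I`-indexed cone has a component at every apex
  -- element `s`. Keeping `s` and `j` as separate variables allows substitution in either direction.
  have hρ' : ∀ s j (h : e j = s) (hj : M.r s = j),
      D.vcomp ρ (M.reindexRight e he π s j h hj) = F.projPro' M s rfl hj := by
    intro s j h hj
    subst h
    exact hρ j
  refine ⟨ρ, ?_, hρ₁, hρ⟩
  intro s t q f g α hs ht
  obtain ⟨β, h₁, h₂, h₃⟩ := F.exists_lift M q f g
    (fun s => D.vcomp α (M.reindexRight e he π s (M.r s) (he' s) rfl))
    (fun s => by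
      rw [D.src_vcomp, hs, Category.assoc, ← D.src_vcomp, hρ', F.src_projPro'])
    (fun s => by
      rw [D.tgt_vcomp, ht, Category.assoc, ← D.tgt_vcomp, hρ', F.tgt_projPro'])
  have h₄ : ∀ s j (h : e j = s) (hj : M.r s = j), D.vcomp β (F.projPro' M s rfl hj) =
      D.vcomp α (M.reindexRight e he π s j h hj) := by
    intro s j h hj
    subst hj
    exact h₃ s
  refine ⟨β, ⟨h₁, h₂, hπ.cell_ext fun j => ?_⟩, ?_⟩
  · rw [D.vcomp_assoc, hρ]
    exact h₄ (e j) j rfl (he j)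
  · rintro γ ⟨h₅, h₆, h₇⟩
    refine F.cell_ext (h₅.trans h₁.symm) (h₆.trans h₂.symm) fun s => ?_
    rw [h₃, ← h₇, D.vcomp_assoc, hρ']
    rfl

/-- The product of a family of proarrows whose left leg is a bijection is a restriction of a
parallel product along its right boundary. -/
theorem exists_isRestriction_left {X Y : FinFam D} (M : FinFam.Pro X Y) (e : X.I → M.A)
    (he : ∀ i, M.l (e i) = i) (he' : ∀ s, e (M.l s) = s) {b : D.Obj} {p : D.Pro (F.obj X) b}
    {π : ∀ i, D.Cell p (M.pro (e i) (he i) rfl)} (hs : ∀ i, D.src (π i) = F.proj X i)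
    (hπ : D.IsParallelCone π) :
    ∃ ρ : D.Cell (F.pro M) p, D.IsRestriction ρ ∧ D.src ρ = 𝟙 _ ∧
      ∀ i, D.vcomp ρ (π i) = F.projPro' M (e i) (he i) rfl := by
  obtain ⟨ρ, hρ⟩ := hπ.exists_lift fun i => F.projPro' M (e i) (he i) rfl
  have hρ₁ : D.src ρ = 𝟙 _ := F.hom_ext fun i => by
    rw [Category.id_comp, ← hs i, ← D.src_vcomp, hρ, F.src_projPro', hs]
  have hρ' : ∀ s i (h : e i = s) (hi : M.l s = i),
      D.vcomp ρ (M.reindexLeft e he π s i h hi) = F.projPro' M s hi rfl := by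
    intro s i h hi
    subst h
    exact hρ i
  refine ⟨ρ, ?_, hρ₁, hρ⟩
  intro s t q f g α hs ht
  obtain ⟨β, h₁, h₂, h₃⟩ := F.exists_lift M q f g
    (fun s => D.vcomp α (M.reindexLeft e he π s (M.l s) (he' s) rfl))
    (fun s => by
      rw [D.src_vcomp, hs, Category.assoc, ← D.src_vcomp, hρ', F.src_projPro'])
    (fun s => by
      rw [D.tgt_vcomp, ht, Category.assoc, ← D.tgt_vcomp, hρ', F.tgt_projPro'])
  have h₄ : ∀ s i (h : e i = s) (hi : M.l s = i), D.vcomp β (F.projPro' M s hi rfl) =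
      D.vcomp α (M.reindexLeft e he π s i h hi) := by
    intro s i h hi
    subst hi
    exact h₃ s
  refine ⟨β, ⟨h₁, h₂, hπ.cell_ext fun i => ?_⟩, ?_⟩
  · rw [D.vcomp_assoc, hρ]
    exact h₄ (e i) i rfl (he i)
  · rintro γ ⟨h₅, h₆, h₇⟩
    refine F.cell_ext (h₅.trans h₁.symm) (h₆.trans h₂.symm) fun s => ?_
    rw [h₃, ← h₇, D.vcomp_assoc, hρ']
    rfl

/-- The projections of the product of a composite family, with any name for the middle index. -/
def projHcomp {X Y Z : FinFam D} (M : FinFam.Pro X Y) (N : FinFam.Pro Y Z) (s : M.A) (t : N.A)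
    {j : Y.I} (hs : M.r s = j) (ht : N.l t = j) :
    D.Cell (F.pro (FinFam.hcomp M N)) (D.hcomp (M.pro s rfl hs) (N.pro t ht rfl)) := by
  subst hs
  exact F.projPro (FinFam.hcomp M N) ⟨(s, t), ht.symm⟩

theorem src_projHcomp {X Y Z : FinFam D} (M : FinFam.Pro X Y) (N : FinFam.Pro Y Z) (s : M.A)
    (t : N.A) {j : Y.I} (hs : M.r s = j) (ht : N.l t = j) :
    D.src (F.projHcomp M N s t hs ht) = F.proj X (M.l s) := by
  subst hs
  exact F.src_projPro (FinFam.hcomp M N) ⟨(s, t), ht.symm⟩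

theorem tgt_projHcomp {X Y Z : FinFam D} (M : FinFam.Pro X Y) (N : FinFam.Pro Y Z) (s : M.A)
    (t : N.A) {j : Y.I} (hs : M.r s = j) (ht : N.l t = j) :
    D.tgt (F.projHcomp M N s t hs ht) = F.proj Z (N.r t) := by
  subst hs
  exact F.tgt_projPro (FinFam.hcomp M N) ⟨(s, t), ht.symm⟩

/-- Both products are outer restrictions of the apexes `p` and `q` of parallel cones, so their
composite is a restriction of `p ⊙ q`. As `p ⊙ q` carries a parallel cone too, the composite has the
universal property of the product of the composite family. -/
theorem isInvertible_laxComp_of_isParallelCone (hD : D.IsEquipment) {X Y Z : FinFam D}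
    (M : FinFam.Pro X Y) (N : FinFam.Pro Y Z) (e : Y.I → M.A) (he : ∀ j, M.r (e j) = j)
    (he' : ∀ s, e (M.r s) = s) (d : Y.I → N.A) (hd : ∀ j, N.l (d j) = j)
    (hd' : ∀ s, d (N.l s) = s) {a b : D.Obj} {p : D.Pro a (F.obj Y)} {q : D.Pro (F.obj Y) b}
    {π : ∀ j, D.Cell p (M.pro (e j) rfl (he j))} {θ : ∀ j, D.Cell q (N.pro (d j) (hd j) rfl)}
    (ht : ∀ j, D.tgt (π j) = F.proj Y j) (hs : ∀ j, D.src (θ j) = F.proj Y j)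
    (hπ : D.IsParallelCone π) (hθ : D.IsParallelCone θ)
    (hπθ : D.IsParallelCone fun j => D.hcompCell (π j) (θ j) ((ht j).trans (hs j).symm)) :
    D.IsInvertible (F.functor.laxComp M N) := by
  obtain ⟨ρ, hρ, hρt, hρπ⟩ := F.exists_isRestriction_right M e he he' ht hπ
  obtain ⟨σ, hσ, hσs, hσθ⟩ := F.exists_isRestriction_left N d hd hd' hs hθ
  have hρσ : D.IsRestriction (D.hcompCell ρ σ (hρt.trans hσs.symm)) := by
    intro a b
    exact hρ.hcompCell hD hσ hρt hσs
  have key : ∀ j, D.vcomp (D.hcompCell ρ σ (hρt.trans hσs.symm))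
      (D.hcompCell (π j) (θ j) ((ht j).trans (hs j).symm)) =
        F.projComp M N (e j) (d j) (he j) (hd j) := fun j =>
    DoubleCat.hcompCell_vcomp' _ _ _ _ _ _ (hρπ j) (hσθ j) _
  apply F.isInvertible_laxComp
  · intro β β' hβs hβt h
    have h' : ∀ s t j (h₁ : M.r s = j) (h₂ : N.l t = j),
        D.vcomp β (F.projComp M N s t h₁ h₂) = D.vcomp β' (F.projComp M N s t h₁ h₂) := by
      intro s t j h₁ h₂
      subst h₂
      exact h s t h₁
    refine (hρσ _ (D.src β') (D.tgt β') (D.vcomp β' (D.hcompCell ρ σ (hρt.trans hσs.symm)))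
      (D.src_vcomp _ _) (D.tgt_vcomp _ _)).unique ⟨hβs, hβt, hπθ.cell_ext fun j => ?_⟩
      ⟨rfl, rfl, rfl⟩
    rw [D.vcomp_assoc, D.vcomp_assoc, key, h']
  · obtain ⟨α, hα⟩ := hπθ.exists_lift fun j => F.projHcomp M N (e j) (d j) (he j) (hd j)
    obtain ⟨γ, ⟨h₁, h₂, h₃⟩, -⟩ := hρσ _ (𝟙 _) (𝟙 _) α
      (hπθ.src_ext fun j => by
        rw [← D.src_vcomp, hα, Category.id_comp, ← D.src_vcomp, key, F.src_projHcomp, projComp,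
          D.src_hcompCell, F.src_projPro'])
      (hπθ.tgt_ext fun j => by
        rw [← D.tgt_vcomp, hα, Category.id_comp, ← D.tgt_vcomp, key, F.tgt_projHcomp, projComp,
          D.tgt_hcompCell, F.tgt_projPro'])
    have h₄ : ∀ s t j (h : M.r s = j) (h' : N.l t = j), e j = s → d j = t →
        D.vcomp γ (F.projComp M N s t h h') = F.projHcomp M N s t h h' := by
      intro s t j h h' hs ht
      subst hs ht
      rw [← key, ← D.vcomp_assoc, h₃, hα]
    -- By bijectivity, every matching pair in the pullback is `(e j, d j)` for its middle index `j`,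
    -- so the cone over `Y.I` accounts for all projections.
    exact ⟨γ, h₁, h₂, fun s t h => h₄ s t _ rfl h.symm (he' s) (by rw [h, hd'])⟩

/-- The identity span has identity legs, so a parallel cone of identity cells already has the
required universal property. No restriction is needed, hence no equipment hypothesis. -/
theorem isInvertible_laxUnit_of_isParallelCone (X : FinFam D)
    (h : D.IsParallelCone (m := fun i => D.hid (X.obj i)) fun i => D.hidMap (F.proj X i)) :
    D.IsInvertible (F.functor.laxUnit X) := by
  apply F.isInvertible_laxUnit
  · exact fun β β' e => h.cell_ext e
  · obtain ⟨α, hα⟩ := h.exists_lift fun i => F.projPro (FinFam.hid X) i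
    refine ⟨α, F.hom_ext fun i => ?_, F.hom_ext fun i => ?_, hα⟩
    · have := congrArg D.src (hα i)
      rw [D.src_vcomp, D.src_hidMap] at this
      exact this.trans ((F.src_projPro (FinFam.hid X) i).trans (Category.id_comp _).symm)
    · have := congrArg D.tgt (hα i)
      rw [D.tgt_vcomp, D.tgt_hidMap] at this
      exact this.trans ((F.tgt_projPro (FinFam.hid X) i).trans (Category.id_comp _).symm)

theorem isInvertible_laxComp_ofParallelProducts (hD : D.IsEquipment)
    (P : ∀ (I : Type), Finite I → ParallelProducts D I)
    (hP : ∀ (I : Type) (hI : Finite I), (P I hI).IsStrong) {X Y Z : FinFam D} (M : FinFam.Pro X Y)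
    (N : FinFam.Pro Y Z) (hM : Function.Bijective M.r) (hN : Function.Bijective N.l) :
    D.IsInvertible ((ofParallelProducts hD P).functor.laxComp M N) := by
  obtain ⟨e, he', he⟩ := Function.bijective_iff_has_inverse.mp hM
  obtain ⟨d, hd', hd⟩ := Function.bijective_iff_has_inverse.mp hN
  exact (ofParallelProducts hD P).isInvertible_laxComp_of_isParallelCone hD M N e he he' d hd hd'
    (π := (P Y.I Y.fin).projPro fun j => M.pro (e j) rfl (he j))
    (θ := (P Y.I Y.fin).projPro fun j => N.pro (d j) (hd j) rfl)
    (fun j => (P Y.I Y.fin).tgt_projPro _ j) (fun j => (P Y.I Y.fin).src_projPro _ j)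
    ((P Y.I Y.fin).isParallelCone _) ((P Y.I Y.fin).isParallelCone _)
    ((hP Y.I Y.fin).isParallelCone_hcomp _ _)

theorem isInvertible_laxUnit_ofParallelProducts (hD : D.IsEquipment)
    (P : ∀ (I : Type), Finite I → ParallelProducts D I)
    (hP : ∀ (I : Type) (hI : Finite I), (P I hI).IsStrong) (X : FinFam D) :
    D.IsInvertible ((ofParallelProducts hD P).functor.laxUnit X) := by
  exact (ofParallelProducts hD P).isInvertible_laxUnit_of_isParallelCone X
    ((hP X.I X.fin).isParallelCone_hid X.obj)

end FamilyProducts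

theorem DoubleCat.hasIsoStrongFiniteProducts_of_isCartesian (D : DoubleCat.{u, v, w, c})
    (hD : D.IsEquipment) (h : D.IsCartesian) : D.HasIsoStrongFiniteProducts := by
  choose P hP A using h
  have hS : ∀ (I : Type) (_ : Finite I),
      (ParallelProducts.ofAdjunction (A I).some).IsStrong := fun I _ =>
    ParallelProducts.isStrong_ofAdjunction _ (hP I)
  exact ⟨_, ⟨(FamilyProducts.ofParallelProducts hD fun I _ =>
      ParallelProducts.ofAdjunction (A I).some).adjunction⟩,
    fun M N hM hN => FamilyProducts.isInvertible_laxComp_ofParallelProducts hD _ hS M N hM hN,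
    fun X => FamilyProducts.isInvertible_laxUnit_ofParallelProducts hD _ hS X⟩

/-! ### A counterexample to the converses: quintets of relations. -/

/-- The category of types and relations. -/
abbrev relationCategory : Category.{0} Type where
  Hom X Y := X → Y → Prop
  id _ := Eq
  comp R S := Relation.Comp R S
  id_comp _ := Relation.eq_comp
  comp_id _ := Relation.comp_eq
  assoc _ _ _ := Relation.comp_assoc

/-- A square of relations filled by an inclusion `src ⊙ n ⊆ m ⊙ tgt`. -/
@[ext]
structure RelationSquare {X Y X' Y' : Type} (m : X → Y → Prop) (n : X' → Y' → Prop) where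
  src : X → X' → Prop
  tgt : Y → Y' → Prop
  le : ∀ {s t v}, src s t → n t v → ∃ w, m s w ∧ tgt w v

/-- The double category of quintets in the locally ordered category of relations, with the local
order reversed: both the arrows and the proarrows are relations. -/
def relationQuintets : DoubleCat.{1, 0, 1, 0} where
  Obj := Type
  cat := relationCategory
  Pro X Y := ULift (X → Y → Prop)
  Cell m n := RelationSquare m.down n.down
  src α := α.src
  tgt α := α.tgt
  vid m :=
    { src := Eq
      tgt := Eq
      le := fun {s t v} h h' => ⟨v, h ▸ h', rfl⟩ }
  vcomp α β :=
    { src := Relation.Comp α.src β.src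
      tgt := Relation.Comp α.tgt β.tgt
      le := by
        rintro s t v ⟨r, h₁, h₂⟩ h
        obtain ⟨w, hw, h₃⟩ := β.le h₂ h
        obtain ⟨z, hz, h₄⟩ := α.le h₁ hw
        exact ⟨z, hz, w, h₄, h₃⟩ }
  src_vid _ := rfl
  tgt_vid _ := rfl
  src_vcomp _ _ := rfl
  tgt_vcomp _ _ := rfl
  vid_vcomp _ := RelationSquare.ext Relation.eq_comp Relation.eq_comp
  vcomp_vid _ := RelationSquare.ext Relation.comp_eq Relation.comp_eq
  vcomp_assoc _ _ _ := RelationSquare.ext Relation.comp_assoc Relation.comp_assoc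
  hid _ := ⟨Eq⟩
  hidMap f :=
    { src := f
      tgt := f
      le := fun {s t v} h h' => ⟨s, rfl, h' ▸ h⟩ }
  src_hidMap _ := rfl
  tgt_hidMap _ := rfl
  hidMap_id _ := rfl
  hidMap_comp _ _ := rfl
  hcomp m n := ⟨Relation.Comp m.down n.down⟩
  hcompCell α β h :=
    { src := α.src
      tgt := β.tgt
      le := by
        rintro s t v h₁ ⟨r, h₂, h₃⟩
        obtain ⟨w, hw, h₄⟩ := α.le h₁ h₂
        replace h : α.tgt = β.src := h
        rw [h] at h₄
        obtain ⟨z, hz, h₅⟩ := β.le h₄ h₃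
        exact ⟨z, ⟨w, hw, hz⟩, h₅⟩ }
  src_hcompCell _ _ _ := rfl
  tgt_hcompCell _ _ _ := rfl
  hcompCell_vid _ _ := rfl
  hcompCell_vcomp _ _ _ _ _ _ := rfl
  assoc m n p :=
    { src := Eq
      tgt := Eq
      le := by
        rintro s _ v rfl h
        exact ⟨v, Relation.comp_assoc (r := m.down) (p := n.down) (q := p.down) ▸ h, rfl⟩ }
  assocInv m n p :=
    { src := Eq
      tgt := Eq
      le := by
        rintro s _ v rfl h
        exact ⟨v, (Relation.comp_assoc (r := m.down) (p := n.down) (q := p.down)).symm ▸ h, rfl⟩ }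
  src_assoc _ _ _ := rfl
  tgt_assoc _ _ _ := rfl
  assoc_assocInv _ _ _ := RelationSquare.ext Relation.eq_comp Relation.eq_comp
  assocInv_assoc _ _ _ := RelationSquare.ext Relation.eq_comp Relation.eq_comp
  assoc_naturality _ _ _ _ _ := RelationSquare.ext
    (Relation.comp_eq.trans Relation.eq_comp.symm) (Relation.comp_eq.trans Relation.eq_comp.symm)
  lunit m :=
    { src := Eq
      tgt := Eq
      le := by
        rintro s _ v rfl h
        exact ⟨v, ⟨s, rfl, h⟩, rfl⟩ }
  lunitInv m :=
    { src := Eq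
      tgt := Eq
      le := by
        rintro s _ v rfl ⟨_, rfl, h⟩
        exact ⟨v, h, rfl⟩ }
  src_lunit _ := rfl
  tgt_lunit _ := rfl
  lunit_lunitInv _ := RelationSquare.ext Relation.eq_comp Relation.eq_comp
  lunitInv_lunit _ := RelationSquare.ext Relation.eq_comp Relation.eq_comp
  lunit_naturality _ := RelationSquare.ext
    (Relation.comp_eq.trans Relation.eq_comp.symm) (Relation.comp_eq.trans Relation.eq_comp.symm)
  runit m :=
    { src := Eq
      tgt := Eq
      le := by
        rintro s _ v rfl h
        exact ⟨v, ⟨v, h, rfl⟩, rfl⟩ }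
  runitInv m :=
    { src := Eq
      tgt := Eq
      le := by
        rintro s _ v rfl ⟨_, h, rfl⟩
        exact ⟨_, h, rfl⟩ }
  src_runit _ := rfl
  tgt_runit _ := rfl
  runit_runitInv _ := RelationSquare.ext Relation.eq_comp Relation.eq_comp
  runitInv_runit _ := RelationSquare.ext Relation.eq_comp Relation.eq_comp
  runit_naturality _ := RelationSquare.ext
    (Relation.comp_eq.trans Relation.eq_comp.symm) (Relation.comp_eq.trans Relation.eq_comp.symm)
  pentagon _ _ _ _ := RelationSquare.ext
    (congrArg (Relation.Comp Eq) Relation.eq_comp) (congrArg (Relation.Comp Eq) Relation.eq_comp)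
  triangle _ _ := RelationSquare.ext Relation.eq_comp Relation.eq_comp

namespace relationQuintets

/-- Disjoint unions are products of relations, for objects and for proarrows. -/
def familyProducts : FamilyProducts relationQuintets where
  obj X := (i : X.I) × (X.obj i : Type)
  proj X i := fun p t => p = ⟨i, t⟩
  lift f := fun s p => f p.1 s p.2
  lift_proj {X a} f i := by
    funext s t
    refine propext ⟨?_, fun h => ⟨⟨i, t⟩, h, rfl⟩⟩
    rintro ⟨_, h, rfl⟩
    exact h
  hom_ext {X a f g} h := by
    have key : ∀ (f : a → ((i : X.I) × (X.obj i : Type)) → Prop) s i t,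
        Relation.Comp f (fun p t => p = ⟨i, t⟩) s t = f s ⟨i, t⟩ := by
      intro f s i t
      refine propext ⟨?_, fun h => ⟨⟨i, t⟩, h, rfl⟩⟩
      rintro ⟨_, h, rfl⟩
      exact h
    funext s ⟨i, t⟩
    exact (key f s i t).symm.trans ((congrFun (congrFun (h i) s) t).trans (key g s i t))
  pro M := ⟨fun p q => ∃ (a : M.A) (hi : M.l a = p.1) (hj : M.r a = q.1),
    (M.pro a hi hj).down p.2 q.2⟩
  projPro {X Y} M a :=
    { src := fun p t => p = ⟨M.l a, t⟩
      tgt := fun p t => p = ⟨M.r a, t⟩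
      le := by
        rintro s t v rfl h
        exact ⟨⟨M.r a, v⟩, ⟨a, rfl, rfl, h⟩, rfl⟩ }
  src_projPro _ _ := rfl
  tgt_projPro _ _ := rfl
  exists_lift {X Y} M {s t} p f g κ hs ht := by
    refine ⟨{ src := f, tgt := g, le := ?_ }, rfl, rfl, fun a =>
      RelationSquare.ext (hs a).symm (ht a).symm⟩
    -- The union over the apex stands on the smaller side of the required inclusion, so it suffices
    -- to treat one apex element `a` at a time, where the cell `κ a` provides the inclusion.
    rintro x ⟨i, y⟩ ⟨j, z⟩ h ⟨a, hi, hj, h'⟩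
    change M.l a = i at hi
    change M.r a = j at hj
    subst hi hj
    have h₁ : (κ a).src x y := by
      have e : (κ a).src = _ := hs a
      rw [e]
      exact ⟨_, h, rfl⟩
    obtain ⟨w, hw, h₂⟩ := (κ a).le h₁ h'
    have e : (κ a).tgt = _ := ht a
    rw [e] at h₂
    obtain ⟨_, h₃, rfl⟩ := h₂
    exact ⟨w, hw, h₃⟩
  cell_ext hs ht _ := RelationSquare.ext hs ht

/-- A cell with identity boundaries is an inclusion of `n` in `m`, and cells are determined by their
boundaries. The reverse inclusion therefore suffices for an inverse. -/
theorem isInvertible_of_le {X Y : relationQuintets.Obj} {m n : relationQuintets.Pro X Y}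
    (α : relationQuintets.Cell m n) (hs : relationQuintets.src α = 𝟙 X)
    (ht : relationQuintets.tgt α = 𝟙 Y) (h : ∀ s t, m.down s t → n.down s t) :
    relationQuintets.IsInvertible α := by
  have hs' : α.src = Eq := hs
  have ht' : α.tgt = Eq := ht
  refine ⟨{ src := Eq, tgt := Eq, le := ?_ }, RelationSquare.ext ?_ ?_, RelationSquare.ext ?_ ?_⟩
  · rintro s _ v rfl h'
    exact ⟨v, h _ _ h', rfl⟩
  · exact Relation.comp_eq.trans hs'
  · exact Relation.comp_eq.trans ht'
  · exact Relation.eq_comp.trans hs'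
  · exact Relation.eq_comp.trans ht'

/-- The comparison cells supply one inclusion. The other says that composing matrices of relations
gives the relation indexed by the pulled-back span, and that equal elements of a disjoint union have
equal indices. -/
theorem functor_isPseudo : familyProducts.functor.IsPseudo := by
  constructor
  · intro X Y Z M N
    refine isInvertible_of_le _ (familyProducts.functor.src_laxComp M N)
      (familyProducts.functor.tgt_laxComp M N) ?_
    -- The intermediate element lies in a single summand `j`, so `a` and `b` meet over `j` and form
    -- an element of the pullback. Bijectivity of the legs plays no role.
    rintro p q ⟨⟨j, w⟩, ⟨a, hi, hj, h⟩, ⟨b, hj', hk, h'⟩⟩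
    change M.r a = j at hj
    subst hj
    exact ⟨⟨(a, b), hj'.symm⟩, hi, hk, w, h, h'⟩
  · intro X
    refine isInvertible_of_le _ (familyProducts.functor.src_laxUnit X)
      (familyProducts.functor.tgt_laxUnit X) ?_
    rintro p _ rfl
    exact ⟨p.1, rfl, rfl, rfl⟩

theorem hasStrongFiniteProducts : relationQuintets.HasStrongFiniteProducts :=
  ⟨_, ⟨familyProducts.adjunction⟩, functor_isPseudo⟩

/-- On a one-point set, take the full relation as left arrow and bottom proarrow and the empty
relation as right arrow. A filler would include a nonempty relation in a composite with the empty
one, so the niche admits no cell, cartesian or not. -/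
theorem not_isEquipment : ¬ relationQuintets.IsEquipment := by
  intro h
  obtain ⟨m, ρ, hs, ht, -⟩ := h (x := Unit) (y := Unit) (x' := Unit) (y' := Unit)
    (fun _ _ => True) (fun _ _ => False) ⟨fun _ _ => True⟩
  have hs' : ρ.src = fun _ _ => True := hs
  have ht' : ρ.tgt = fun _ _ => False := ht
  obtain ⟨w, -, hw⟩ := ρ.le (s := ()) (t := ()) (v := ()) (by rw [hs']; trivial) trivial
  rw [ht'] at hw
  exact hw

end relationQuintets

theorem DoubleCat.HasStrongFiniteProducts.hasIsoStrongFiniteProducts {D : DoubleCat.{u, v, w, c}}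
    (h : D.HasStrongFiniteProducts) : D.HasIsoStrongFiniteProducts :=
  let ⟨P, A, hP⟩ := h
  ⟨P, A, fun M N _ _ => hP.1 M N, hP.2⟩

theorem DoubleCat.HasStrongFiniteProducts.hasLaxFiniteProducts {D : DoubleCat.{u, v, w, c}}
    (h : D.HasStrongFiniteProducts) : D.HasLaxFiniteProducts :=
  let ⟨P, A, _⟩ := h
  ⟨P, A⟩

theorem mainTheorem11 :
    (∀ D : DoubleCat.{u, v, w, c},
      D.IsEquipment → D.IsPrecartesian → D.HasLaxFiniteProducts) ∧
    (∀ D : DoubleCat.{u, v, w, c},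
      D.IsEquipment → D.IsCartesian → D.HasIsoStrongFiniteProducts) ∧
    (∃ D : DoubleCat.{1, 0, 1, 0},
      D.HasLaxFiniteProducts ∧ D.HasIsoStrongFiniteProducts ∧ D.HasStrongFiniteProducts ∧
        ¬ D.IsEquipment) :=
  ⟨fun D hD h => D.hasLaxFiniteProducts_of_isPrecartesian hD h,
    fun D hD h => D.hasIsoStrongFiniteProducts_of_isCartesian hD h,
    relationQuintets, relationQuintets.hasStrongFiniteProducts.hasLaxFiniteProducts,
    relationQuintets.hasStrongFiniteProducts.hasIsoStrongFiniteProducts,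
    relationQuintets.hasStrongFiniteProducts, relationQuintets.not_isEquipment⟩
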